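/- **Conventions.** A *Lie group* is a paracompact Hausdorff smooth manifold $G$ modelled on a (real) Fréchet space, with a group structure whose product and inverse are smooth, and with an everywhere defined exponential map $\exp:\mathfrak g\to G$ on its Lie algebra $\mathfrak g=T_1G$ (for every $\xi\in\mathfrak g$, $t\mapsto \exp(t\xi)$ is a smooth one-parameter subgroup with velocity $\xi$ at $t=0$). The bracket of $\mathfrak g$ is that of left invariant vector fields. Let $G$ be a Lie group and $A$ an abelian Lie group, written additively, with Lie algebra $\mathfrak a=T_0A$; $G$ acts trivially on $A$. *Local differentiable cohomology.* Let $C^\infty_{loc}(G^p,A)$ be the group of germs at $(1,\dots,1)$ of smooth functions $G^p\to A$, with the differential $$\delta=\sum_{i=0}^{p+1}(-1)^i d_i^*:\ C^\infty_{loc}(G^p,A)\to C^\infty_{loc}(G^{p+1},A),$$ where $d_0(g_0,\dots,g_p)=(g_1,\dots,g_p)$, $d_i(g_0,\dots,g_p)=(g_0,\dots,g_{i-1}g_i,\dots,g_p)$ for $1\le i\le p$, and $d_{p+1}(g_0,\dots,g_p)=(g_0,\dots,g_{p-1})$. Its cohomology groups are denoted $H^p_{loc}(G,A)$. *Lie algebra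 cohomology.* For $p\ge1$ let $C^p(\mathfrak g,A)$ be the group of continuous (equivalently, smooth) alternating $p$-linear maps $\mathfrak g^p\to\mathfrak a$, and let $C^0(\mathfrak g,A)=A$. The differential $d$ is zero on $C^0$, and for $p\ge1$ $$(d\omega)(\xi_0,\dots,\xi_p)=\sum_{i<j}(-1)^{i+j}\,\omega([\xi_i,\xi_j],\xi_0,\dots,\widehat{\xi_i},\dots,\widehat{\xi_j},\dots,\xi_p).$$ Its cohomology groups are denoted $H^p(\mathfrak g,A)$. *Mixed partial derivatives of $A$-valued functions.* For $f$ smooth near $0\in\mathbb R^p$ with values in $A$, $p\ge 1$, $\partial f/\partial t_1$ is regarded as an $\mathfrak a$-valued function by translation in $A$ (that is, $\frac{\partial f}{\partial t_1}(0,t_2,\dots,t_p)$ is the velocity at $s=0$ of $s\mapsto f(s,t_2,\dots,t_p)-f(0,t_2,\dots,t_p)$), and the remaining derivatives are those of an $\mathfrak a$-valued function. **Proposition 2.3.** For every $p\ge0$ there is a unique group homomorphism $$\phi:\ H^p_{loc}(G,A)\to H^p(\mathfrak g,A)$$ which is given on local differentiable cocycles $c$ by the formula $$\phi(c)(\xi_1,\dots,\xi_p)=\Bigl[\frac{\partial^p}{\partial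 t_1\cdots\partial t_p}\sum_{\sigma\in S_p}\epsilon(\sigma)\,c\bigl(\exp(t_{\sigma(1)}\xi_{\sigma(1)}),\dots,\exp(t_{\sigma(p)}\xi_{\sigma(p)})\bigr)\Bigr]_{t_1=\dots=t_p=0};$$ that is, these derivatives exist, the right-hand side is a cocycle in $C^p(\mathfrak g,A)$, and $\phi$ sends the class of $c$ to its class (for $p=0$ the formula reads $\phi(c)=c$). The map $\phi$ is natural in $G$ and $A$: if $f:G_1\to G$ and $h:A\to A_1$ are smooth homomorphisms of Lie groups as above, then $c\mapsto h\circ c\circ f^p$ on local cocycles and $\omega\mapsto dh\circ\omega\circ(df)^p$ on Lie algebra cocycles ($\omega\mapsto h(\omega)$ if $p=0$) induce homomorphisms $H^p_{loc}(G,A)\to H^p_{loc}(G_1,A_1)$ and $H^p(\mathfrak g,A)\to H^p(\mathfrak g_1,A_1)$, and the maps $\phi$ for $(G,A)$ and $(G_1,A_1)$ commute with them. -/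

import Mathlib

namespace FrechetLie

universe u u' v w u₁ u₁' v₁ w₁

open Filter Set
open scoped Topology

/-! ### Smooth maps between locally convex spaces -/

/-- A Fréchet space: a complete metrizable locally convex real topological vector space. -/
class FrechetSpace (E : Type*) [AddCommGroup E] [Module ℝ E] [TopologicalSpace E] : Prop extends
    IsTopologicalAddGroup E, ContinuousSMul ℝ E, LocallyConvexSpace ℝ E,
    TopologicalSpace.MetrizableSpace E where
  complete : @CompleteSpace E (IsTopologicalAddGroup.rightUniformSpace E)

/-- The directional derivative `df(x; v) = lim_{t → 0} (f (x + t v) - f x) / t`. -/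
noncomputable def dirDeriv {E F : Type*} [AddCommGroup E] [Module ℝ E]
    [AddCommGroup F] [Module ℝ F] [TopologicalSpace F] (f : E → F) (x v : E) : F :=
  deriv (fun t : ℝ => f (x + t • v)) 0

/-- `f` is of class `C^n` on the open set `U`: it is continuous there and, for `n ≥ 1`, all its
directional derivatives `df(x; v)` exist for `x ∈ U` and `df` is of class `C^(n-1)` on `U × E`. -/
def CnOn {F : Type*} [AddCommGroup F] [Module ℝ F] [TopologicalSpace F] :
    ∀ (_ : ℕ) {E : Type*} [AddCommGroup E] [Module ℝ E] [TopologicalSpace E],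
      (E → F) → Set E → Prop
  | 0, _, _, _, _, f, U => ContinuousOn f U
  | n + 1, E, _, _, _, f, U => ContinuousOn f U ∧
      (∀ x ∈ U, ∀ v : E, DifferentiableAt ℝ (fun t : ℝ => f (x + t • v)) 0) ∧
      CnOn n (fun p : E × E => dirDeriv f p.1 p.2) (U ×ˢ univ)

/-- `f` is smooth on the open set `U`. -/
def CInfOn {E F : Type*} [AddCommGroup E] [Module ℝ E] [TopologicalSpace E]
    [AddCommGroup F] [Module ℝ F] [TopologicalSpace F] (f : E → F) (U : Set E) : Prop :=
  ∀ n : ℕ, CnOn n f U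

section Calculus

variable {E F H : Type*}
  [AddCommGroup E] [Module ℝ E] [TopologicalSpace E] [IsTopologicalAddGroup E] [ContinuousSMul ℝ E]
  [AddCommGroup F] [Module ℝ F] [TopologicalSpace F] [IsTopologicalAddGroup F] [ContinuousSMul ℝ F]
  [AddCommGroup H] [Module ℝ H] [TopologicalSpace H] [IsTopologicalAddGroup H] [ContinuousSMul ℝ H]

theorem hasDerivAt_iff_slope {γ : ℝ → F} {w : F} {s : ℝ} : HasDerivAt γ w s ↔
    Tendsto (fun t : ℝ => t⁻¹ • (γ (s + t) - γ s)) (𝓝[≠] 0) (𝓝 w) := by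
  have h1 : HasDerivAt γ w s ↔
      Tendsto (fun t : ℝ => (t - s)⁻¹ • (γ t - γ s - (t - s) • w)) (𝓝 s) (𝓝 0) := by
    rw [hasDerivAt_iff_hasFDerivAt, hasFDerivAt_iff_isLittleOTVS,
      Asymptotics.isLittleOTVS_iff_tendsto_inv_smul]
    · simp
    · refine Eventually.of_forall fun t ht => ?_
      rw [sub_eq_zero] at ht
      simp [ht]
  have h2 : map (fun t : ℝ => s + t) (𝓝 0) = 𝓝 s := by simp
  rw [h1, ← h2, tendsto_map'_iff]
  have h3 : Tendsto ((fun t : ℝ => (t - s)⁻¹ • (γ t - γ s - (t - s) • w)) ∘ fun t => s + t)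
      (𝓝 0) (𝓝 0) ↔
      Tendsto (fun t : ℝ => t⁻¹ • (γ (s + t) - γ s - t • w)) (𝓝[≠] 0) (𝓝 0) := by
    have e : ((fun t : ℝ => (t - s)⁻¹ • (γ t - γ s - (t - s) • w)) ∘ fun t => s + t) =
        fun t : ℝ => t⁻¹ • (γ (s + t) - γ s - t • w) := by
      ext t; simp
    rw [e, ← nhdsNE_sup_pure (0 : ℝ), tendsto_sup]
    refine ⟨fun h => h.1, fun h => ⟨h, ?_⟩⟩
    rw [tendsto_pure_left]
    intro s hs
    simpa using mem_of_mem_nhds hs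
  rw [h3]
  have h4 : (fun t : ℝ => t⁻¹ • (γ (s + t) - γ s - t • w)) =ᶠ[𝓝[≠] 0]
      fun t : ℝ => t⁻¹ • (γ (s + t) - γ s) - w := by
    filter_upwards [self_mem_nhdsWithin] with t ht
    rw [smul_sub, smul_smul, inv_mul_cancel₀ ht, one_smul]
  rw [tendsto_congr' h4]
  constructor
  · intro h; simpa using h.add_const w
  · intro h; simpa using h.sub_const w

theorem hasDerivAt_unique [T2Space F] {γ : ℝ → F} {w w' : F} {s : ℝ}
    (h : HasDerivAt γ w s) (h' : HasDerivAt γ w' s) : w = w' :=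
  tendsto_nhds_unique (hasDerivAt_iff_slope.1 h) (hasDerivAt_iff_slope.1 h')

theorem hasDerivAt_deriv {γ : ℝ → F} {s : ℝ} (h : DifferentiableAt ℝ γ s) :
    HasDerivAt γ (deriv γ s) s := by
  have := h.hasFDerivAt
  rw [hasFDerivAt_iff_hasDerivAt] at this
  exact this

theorem HasDerivAt.diffAt {γ : ℝ → F} {w : F} {s : ℝ} (h : HasDerivAt γ w s) :
    DifferentiableAt ℝ γ s := ⟨_, hasDerivAt_iff_hasFDerivAt.1 h⟩

theorem deriv_eq_of_hasDerivAt [T2Space F] {γ : ℝ → F} {w : F} {s : ℝ} (h : HasDerivAt γ w s) :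
    deriv γ s = w :=
  hasDerivAt_unique (hasDerivAt_deriv (HasDerivAt.diffAt h)) h

theorem hasDerivAt_congr {γ δ : ℝ → F} {w : F} {s : ℝ} (h : γ =ᶠ[𝓝 s] δ)
    (hγ : HasDerivAt γ w s) : HasDerivAt δ w s := by
  rw [hasDerivAt_iff_slope] at *
  refine hγ.congr' ?_
  have h2 : Tendsto (fun t : ℝ => s + t) (𝓝[≠] 0) (𝓝 s) := by
    have : Tendsto (fun t : ℝ => s + t) (𝓝 0) (𝓝 s) := by
      simpa using (continuous_const_add s).tendsto 0
    exact this.mono_left nhdsWithin_le_nhds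
  filter_upwards [h2.eventually h] with t ht
  rw [ht, h.self_of_nhds]

theorem tendsto_line (x v : E) : Tendsto (fun t : ℝ => x + t • v) (𝓝 0) (𝓝 x) := by
  have : Continuous fun t : ℝ => x + t • v := by fun_prop
  simpa using this.tendsto 0

theorem CnOn.continuousOn {n : ℕ} {f : E → F} {U : Set E} (h : CnOn n f U) : ContinuousOn f U := by
  cases n with
  | zero => exact h
  | succ n => exact h.1

theorem CnOn.of_succ {F : Type*} [AddCommGroup F] [Module ℝ F] [TopologicalSpace F] {n : ℕ} :
    ∀ {E : Type*} [AddCommGroup E] [Module ℝ E] [TopologicalSpace E] {f : E → F} {U : Set E},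
      CnOn (n + 1) f U → CnOn n f U := by
  induction n with
  | zero => intro E _ _ _ f U h; exact h.1
  | succ n ih => intro E _ _ _ f U h; exact ⟨h.1, h.2.1, ih h.2.2⟩

theorem CnOn.mono {F : Type*} [AddCommGroup F] [Module ℝ F] [TopologicalSpace F] {n : ℕ} :
    ∀ {E : Type*} [AddCommGroup E] [Module ℝ E] [TopologicalSpace E] {f : E → F} {U V : Set E},
      CnOn n f U → V ⊆ U → CnOn n f V := by
  induction n with
  | zero => intro E _ _ _ f U V h hV; exact ContinuousOn.mono h hV
  | succ n ih =>
    intro E _ _ _ f U V h hV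
    exact ⟨h.1.mono hV, fun x hx => h.2.1 x (hV hx), ih h.2.2 (prod_mono hV subset_rfl)⟩

theorem dirDeriv_congr [T2Space F] {f g : E → F} {U : Set E} (hU : IsOpen U) (h : EqOn f g U)
    {x : E} (hx : x ∈ U) (v : E)
    (hd : DifferentiableAt ℝ (fun t : ℝ => f (x + t • v)) 0) :
    DifferentiableAt ℝ (fun t : ℝ => g (x + t • v)) 0 ∧ dirDeriv f x v = dirDeriv g x v := by
  have key := hasDerivAt_congr (δ := fun t : ℝ => g (x + t • v))
    (by filter_upwards [(tendsto_line x v).eventually (hU.mem_nhds hx)] with t ht using h ht)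
    (hasDerivAt_deriv hd)
  exact ⟨HasDerivAt.diffAt key, (deriv_eq_of_hasDerivAt key).symm⟩

theorem CnOn.congr [T2Space F] {n : ℕ} :
    ∀ {E : Type*} [AddCommGroup E] [Module ℝ E] [TopologicalSpace E] [IsTopologicalAddGroup E]
      [ContinuousSMul ℝ E] {f g : E → F} {U : Set E}, IsOpen U →
      CnOn n f U → EqOn f g U → CnOn n g U := by
  induction n with
  | zero => intro E _ _ _ _ _ f g U _ h hfg; exact ContinuousOn.congr h hfg.symm
  | succ n ih =>
    intro E _ _ _ _ _ f g U hU h hfg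
    refine ⟨h.1.congr hfg.symm, fun x hx v => (dirDeriv_congr hU hfg hx v (h.2.1 x hx v)).1,
      ih (hU.prod isOpen_univ) h.2.2 fun p hp => ?_⟩
    exact (dirDeriv_congr hU hfg hp.1 p.2 (h.2.1 _ hp.1 _)).2

theorem CnOn.of_local {F : Type*} [AddCommGroup F] [Module ℝ F] [TopologicalSpace F] {n : ℕ} :
    ∀ {E : Type*} [AddCommGroup E] [Module ℝ E] [TopologicalSpace E] {f : E → F} {U : Set E},
      (∀ x ∈ U, ∃ V, IsOpen V ∧ x ∈ V ∧ CnOn n f V) → CnOn n f U := by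
  induction n with
  | zero =>
    intro E _ _ _ f U h x hx
    obtain ⟨V, hV, hxV, hf⟩ := h x hx
    exact (ContinuousOn.continuousAt hf (hV.mem_nhds hxV)).continuousWithinAt
  | succ n ih =>
    intro E _ _ _ f U h
    refine ⟨fun x hx => ?_, fun x hx v => ?_, ih fun p hp => ?_⟩
    · obtain ⟨V, hV, hxV, hf⟩ := h x hx
      exact (ContinuousOn.continuousAt hf.1 (hV.mem_nhds hxV)).continuousWithinAt
    · obtain ⟨V, hV, hxV, hf⟩ := h x hx
      exact hf.2.1 x hxV v
    · obtain ⟨V, hV, hxV, hf⟩ := h p.1 hp.1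
      exact ⟨V ×ˢ univ, hV.prod isOpen_univ, ⟨hxV, trivial⟩, hf.2.2⟩

/-- Mean value inequality: along a straight line the difference quotient lies in every closed
convex set that contains all the derivatives. -/
theorem slope_mem [LocallyConvexSpace ℝ F] {g : ℝ → F} {g' : ℝ → F} {K : Set F}
    (hK : Convex ℝ K) (hKc : IsClosed K) {t : ℝ} (ht : t ≠ 0)
    (hg : ∀ s, |s| ≤ |t| → HasDerivAt g (g' s) s) (hg' : ∀ s, |s| ≤ |t| → g' s ∈ K) :
    t⁻¹ • (g t - g 0) ∈ K := by
  by_contra hcon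
  obtain ⟨ℓ, u, h1, h2⟩ := geometric_hahn_banach_closed_point hK hKc hcon
  have hd : ∀ s, |s| ≤ |t| → HasDerivAt (fun s => ℓ (g s)) (ℓ (g' s)) s := by
    intro s hs
    have := hasDerivAt_iff_slope.1 (hg s hs)
    rw [hasDerivAt_iff_slope]
    have h3 := (ℓ.continuous.tendsto (g' s)).comp this
    refine h3.congr fun r => ?_
    simp
  have hb : ∀ s, |s| ≤ |t| → ℓ (g' s) < u := fun s hs => h1 _ (hg' s hs)
  have h2' : u < (ℓ (g t) - ℓ (g 0)) / t := by
    have : ℓ (t⁻¹ • (g t - g 0)) = (ℓ (g t) - ℓ (g 0)) / t := by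
      simp [div_eq_inv_mul]
    rwa [this] at h2
  rcases lt_or_gt_of_ne ht with h | h
  · have hs : ∀ s ∈ Icc t 0, |s| ≤ |t| := fun s hs => by
      rw [abs_of_nonpos hs.2, abs_of_neg h]; linarith [hs.1]
    obtain ⟨c, hc, hce⟩ := exists_hasDerivAt_eq_slope (fun s => ℓ (g s)) (fun s => ℓ (g' s)) h
      (fun s hs' => (hd s (hs s hs')).continuousAt.continuousWithinAt)
      (fun s hs' => hd s (hs s (Ioo_subset_Icc_self hs')))
    have := hb c (hs c (Ioo_subset_Icc_self hc))
    rw [hce] at this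
    have e : (ℓ (g 0) - ℓ (g t)) / (0 - t) = (ℓ (g t) - ℓ (g 0)) / t := by
      rw [zero_sub, div_neg, ← neg_div, neg_sub]
    rw [e] at this
    linarith
  · have hs : ∀ s ∈ Icc 0 t, |s| ≤ |t| := fun s hs => by
      rw [abs_of_nonneg hs.1, abs_of_pos h]; exact hs.2
    obtain ⟨c, hc, hce⟩ := exists_hasDerivAt_eq_slope (fun s => ℓ (g s)) (fun s => ℓ (g' s)) h
      (fun s hs' => (hd s (hs s hs')).continuousAt.continuousWithinAt)
      (fun s hs' => hd s (hs s (Ioo_subset_Icc_self hs')))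
    have := hb c (hs c (Ioo_subset_Icc_self hc))
    rw [hce, sub_zero] at this
    linarith

/-- A `C^1` map has the expected derivative along curves that are differentiable at one point. -/
theorem hasDerivAt_comp_curve [LocallyConvexSpace ℝ H] {g : F → H} {V : Set F} (hV : IsOpen V)
    (hg : CnOn 1 g V) {γ : ℝ → F} {w : F} (h0 : γ 0 ∈ V) (hγ : HasDerivAt γ w 0) :
    HasDerivAt (fun t => g (γ t)) (dirDeriv g (γ 0) w) 0 := by
  rw [hasDerivAt_iff_slope] at hγ ⊢
  simp only [zero_add] at hγ ⊢
  set q : ℝ → F := fun t => t⁻¹ • (γ t - γ 0) with hq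
  have hγq : ∀ t : ℝ, t ≠ 0 → γ t = γ 0 + t • q t := by
    intro t ht
    simp [hq, smul_smul, mul_inv_cancel₀ ht]
  -- the derivative along the segment from `γ 0` to `γ t`
  have hc : ContinuousAt (fun p : F × F => dirDeriv g p.1 p.2) (γ 0, w) :=
    ContinuousOn.continuousAt hg.2.2 ((hV.prod isOpen_univ).mem_nhds ⟨h0, trivial⟩)
  have hLC : LocallyConvexSpace ℝ H := inferInstance
  rw [tendsto_iff_forall_eventually_mem]
  intro S hS
  obtain ⟨K, ⟨hK1, hK2, hK3⟩, hKS⟩ : ∃ K : Set H, (K ∈ 𝓝 (dirDeriv g (γ 0) w) ∧ IsClosed K ∧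
      Convex ℝ K) ∧ K ⊆ S := by
    obtain ⟨C, hC, hCc, hCS⟩ := exists_mem_nhds_isClosed_subset hS
    obtain ⟨K, ⟨hK, hKc⟩, hKC⟩ := (LocallyConvexSpace.convex_basis (𝕜 := ℝ) _).mem_iff.1 hC
    exact ⟨closure K, ⟨mem_of_superset hK subset_closure, isClosed_closure, hKc.closure⟩,
      (closure_minimal hKC hCc).trans hCS⟩
  have hmap : Tendsto (fun p : ℝ × ℝ => (γ 0 + p.2 • q p.1, q p.1)) ((𝓝[≠] 0) ×ˢ 𝓝 0)
      (𝓝 (γ 0, w)) := by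
    refine Tendsto.prodMk_nhds ?_ (hγ.comp tendsto_fst)
    have := (tendsto_snd (f := 𝓝[≠] (0:ℝ)) (g := 𝓝 (0:ℝ))).smul
      (hγ.comp (tendsto_fst (f := 𝓝[≠] (0:ℝ)) (g := 𝓝 (0:ℝ))))
    simpa using this.const_add (γ 0)
  have hev := hmap.eventually ((hc.eventually hK1).and
    ((hV.prod isOpen_univ).mem_nhds (⟨h0, trivial⟩ : (γ 0, w) ∈ V ×ˢ univ)))
  rw [eventually_prod_iff] at hev
  obtain ⟨P, hP, Q, hQ, hPQ⟩ := hev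
  obtain ⟨ε, hε, hεQ⟩ := Metric.eventually_nhds_iff.1 hQ
  have hsmall : ∀ᶠ t : ℝ in 𝓝[≠] 0, |t| < ε := by
    refine nhdsWithin_le_nhds ?_
    filter_upwards [Metric.ball_mem_nhds (0:ℝ) hε] with t ht
    simpa using ht
  filter_upwards [hP, hsmall, self_mem_nhdsWithin] with t hPt htε ht0
  apply hKS
  have hmem : ∀ s, |s| ≤ |t| → Q s := fun s hs => hεQ (by simpa using hs.trans_lt htε)
  have := slope_mem (g := fun s => g (γ 0 + s • q t))
    (g' := fun s => dirDeriv g (γ 0 + s • q t) (q t)) hK3 hK2 ht0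
    (fun s hs => by
      have hd := hasDerivAt_deriv (hg.2.1 _ (hPQ hPt (hmem s hs)).2.1 (q t))
      rw [hasDerivAt_iff_slope] at hd ⊢
      refine hd.congr fun r => ?_
      simp [add_smul, add_assoc])
    (fun s hs => (hPQ hPt (hmem s hs)).1)
  simpa [← hγq t ht0] using this

end Calculus

section Composition

variable {E F H : Type*}
  [AddCommGroup E] [Module ℝ E] [TopologicalSpace E] [IsTopologicalAddGroup E] [ContinuousSMul ℝ E]
  [AddCommGroup F] [Module ℝ F] [TopologicalSpace F] [IsTopologicalAddGroup F] [ContinuousSMul ℝ F]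
  [AddCommGroup H] [Module ℝ H] [TopologicalSpace H] [IsTopologicalAddGroup H] [ContinuousSMul ℝ H]

theorem hasDerivAt_clm (L : E →L[ℝ] F) (x v : E) :
    HasDerivAt (fun t : ℝ => L (x + t • v)) (L v) 0 := by
  rw [hasDerivAt_iff_slope]
  refine tendsto_const_nhds.congr' ?_
  filter_upwards [self_mem_nhdsWithin] with t ht
  simp [smul_smul, inv_mul_cancel₀ ht]

theorem cnOn_clm [T2Space F] (n : ℕ) :
    ∀ {E : Type*} [AddCommGroup E] [Module ℝ E] [TopologicalSpace E] [IsTopologicalAddGroup E]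
      [ContinuousSMul ℝ E] (L : E →L[ℝ] F) (U : Set E), CnOn n L U := by
  induction n with
  | zero => intro E _ _ _ _ _ L U; exact L.continuous.continuousOn
  | succ n ih =>
    intro E _ _ _ _ _ L U
    refine ⟨L.continuous.continuousOn, fun x _ v => HasDerivAt.diffAt (hasDerivAt_clm L x v), ?_⟩
    have e : (fun p : E × E => dirDeriv L p.1 p.2) = L.comp (ContinuousLinearMap.snd ℝ E E) := by
      ext p
      exact deriv_eq_of_hasDerivAt (hasDerivAt_clm L p.1 p.2)
    rw [e]
    exact ih _ _

theorem cnOn_const [T2Space F] (n : ℕ) :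
    ∀ {E : Type*} [AddCommGroup E] [Module ℝ E] [TopologicalSpace E] [IsTopologicalAddGroup E]
      [ContinuousSMul ℝ E] (c : F) (U : Set E), CnOn n (fun _ : E => c) U := by
  induction n with
  | zero => intro E _ _ _ _ _ c U; exact continuousOn_const
  | succ n ih =>
    intro E _ _ _ _ _ c U
    have h : HasDerivAt (fun _ : ℝ => c) 0 0 := by
      rw [hasDerivAt_iff_slope]; simp
    refine ⟨continuousOn_const, fun x _ v => HasDerivAt.diffAt h, ?_⟩
    have e : (fun p : E × E => dirDeriv (fun _ : E => c) p.1 p.2) = fun _ => 0 := by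
      ext p
      exact deriv_eq_of_hasDerivAt h
    rw [e]
    exact ih _ _

theorem hasDerivAt_prodMk {γ : ℝ → F} {δ : ℝ → H} {w : F} {z : H} {s : ℝ}
    (h : HasDerivAt γ w s) (h' : HasDerivAt δ z s) :
    HasDerivAt (fun t => (γ t, δ t)) (w, z) s := by
  rw [hasDerivAt_iff_slope] at *
  exact h.prodMk_nhds h'

theorem CnOn.prodMk [T2Space F] [T2Space H] {n : ℕ} :
    ∀ {E : Type*} [AddCommGroup E] [Module ℝ E] [TopologicalSpace E] [IsTopologicalAddGroup E]
      [ContinuousSMul ℝ E] {f : E → F} {g : E → H} {U : Set E}, IsOpen U →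
      CnOn n f U → CnOn n g U → CnOn n (fun x => (f x, g x)) U := by
  induction n with
  | zero => intro E _ _ _ _ _ f g U _ hf hg; exact ContinuousOn.prodMk hf hg
  | succ n ih =>
    intro E _ _ _ _ _ f g U hU hf hg
    have key : ∀ x ∈ U, ∀ v : E, HasDerivAt (fun t : ℝ => (f (x + t • v), g (x + t • v)))
        (dirDeriv f x v, dirDeriv g x v) 0 := fun x hx v =>
      hasDerivAt_prodMk (hasDerivAt_deriv (hf.2.1 x hx v)) (hasDerivAt_deriv (hg.2.1 x hx v))
    refine ⟨hf.1.prodMk hg.1, fun x hx v => HasDerivAt.diffAt (key x hx v), ?_⟩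
    refine CnOn.congr (hU.prod isOpen_univ) (ih (hU.prod isOpen_univ) hf.2.2 hg.2.2) fun p hp => ?_
    exact (deriv_eq_of_hasDerivAt (key p.1 hp.1 p.2)).symm

theorem CnOn.comp_clm {n : ℕ} :
    ∀ {E' E : Type*} [AddCommGroup E'] [Module ℝ E'] [TopologicalSpace E']
      [AddCommGroup E] [Module ℝ E] [TopologicalSpace E] {f : E → F} {U : Set E} (L : E' →L[ℝ] E),
      CnOn n f U → CnOn n (fun x => f (L x)) (L ⁻¹' U) := by
  induction n with
  | zero =>
    intro E' E _ _ _ _ _ _ f U L hf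
    exact ContinuousOn.comp hf L.continuous.continuousOn fun x hx => hx
  | succ n ih =>
    intro E' E _ _ _ _ _ _ f U L hf
    refine ⟨ContinuousOn.comp hf.1 L.continuous.continuousOn fun x hx => hx, fun x hx v => ?_, ?_⟩
    · simpa using hf.2.1 (L x) hx (L v)
    · have h := ih (L.prodMap L) hf.2.2
      have e : (fun p : E' × E' => dirDeriv (fun x => f (L x)) p.1 p.2) =
          fun p => (fun q : E × E => dirDeriv f q.1 q.2) (L.prodMap L p) := by
        ext p; simp [dirDeriv]
      rw [e]
      exact h.mono fun p hp => ⟨hp.1, trivial⟩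

/-- The chain rule. -/
theorem CnOn.comp [T2Space H] [LocallyConvexSpace ℝ H] {n : ℕ} :
    ∀ {E : Type*} {F : Type*} [AddCommGroup E] [Module ℝ E] [TopologicalSpace E]
      [IsTopologicalAddGroup E] [ContinuousSMul ℝ E]
      [AddCommGroup F] [Module ℝ F] [TopologicalSpace F]
      [IsTopologicalAddGroup F] [ContinuousSMul ℝ F] [T2Space F]
      {f : E → F} {g : F → H} {U : Set E} {V : Set F}, IsOpen U → IsOpen V →
      CnOn n g V → CnOn n f U → MapsTo f U V → CnOn n (fun x => g (f x)) U := by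
  induction n with
  | zero => intro E F _ _ _ _ _ _ _ _ _ _ _ f g U V _ _ hg hf hm; exact ContinuousOn.comp hg hf hm
  | succ n ih =>
    intro E F _ _ _ _ _ _ _ _ _ _ _ f g U V hU hV hg hf hm
    have hg1 : CnOn 1 g V := ⟨hg.1, hg.2.1, hg.2.2.continuousOn⟩
    have key : ∀ x ∈ U, ∀ v : E, HasDerivAt (fun t : ℝ => g (f (x + t • v)))
        (dirDeriv g (f x) (dirDeriv f x v)) 0 := by
      intro x hx v
      have := hasDerivAt_comp_curve (γ := fun t : ℝ => f (x + t • v)) hV hg1 (by simpa using hm hx)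
        (hasDerivAt_deriv (hf.2.1 x hx v))
      simpa [dirDeriv] using this
    refine ⟨hg.1.comp hf.1 hm, fun x hx v => HasDerivAt.diffAt (key x hx v), ?_⟩
    have hUo : IsOpen (U ×ˢ (univ : Set E)) := hU.prod isOpen_univ
    have h1 : CnOn n (fun p : E × E => f p.1) (U ×ˢ univ) :=
      (hf.of_succ.comp_clm (ContinuousLinearMap.fst ℝ E E)).mono fun p hp => hp.1
    have h2 : CnOn n (fun p : E × E => (f p.1, dirDeriv f p.1 p.2)) (U ×ˢ univ) :=
      CnOn.prodMk hUo h1 hf.2.2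
    have h3 := ih hUo (hV.prod isOpen_univ) hg.2.2 h2 fun p hp => ⟨hm hp.1, trivial⟩
    refine CnOn.congr hUo h3 fun p hp => (deriv_eq_of_hasDerivAt (key p.1 hp.1 p.2)).symm

end Composition

/-! ### Manifolds modelled on Fréchet spaces -/

section Manifolds

/-- A map `f`, defined on the open set `U` of `M`, is smooth with respect to the atlases `𝒜` of `M`
and `ℬ` of `N`: it is continuous on `U` and smooth when read in the charts. -/
def SmoothOn {M E N F : Type*} [TopologicalSpace M] [TopologicalSpace N]
    [AddCommGroup E] [Module ℝ E] [TopologicalSpace E]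
    [AddCommGroup F] [Module ℝ F] [TopologicalSpace F]
    (𝒜 : Set (OpenPartialHomeomorph M E)) (ℬ : Set (OpenPartialHomeomorph N F))
    (f : M → N) (U : Set M) : Prop :=
  ContinuousOn f U ∧ ∀ e ∈ 𝒜, ∀ e' ∈ ℬ,
    CInfOn (e' ∘ f ∘ e.symm) (e.target ∩ e.symm ⁻¹' (U ∩ f ⁻¹' e'.source))

/-- The product atlas on `M × N`. -/
def prodAtlas {M E N F : Type*} [TopologicalSpace M] [TopologicalSpace N]
    [TopologicalSpace E] [TopologicalSpace F]
    (𝒜 : Set (OpenPartialHomeomorph M E)) (ℬ : Set (OpenPartialHomeomorph N F)) :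
    Set (OpenPartialHomeomorph (M × N) (E × F)) :=
  {e | ∃ e₁ ∈ 𝒜, ∃ e₂ ∈ ℬ, e = e₁.prod e₂}

/-- The product atlas on `M^p`. -/
def powAtlas {M E : Type*} [TopologicalSpace M] [TopologicalSpace E]
    (𝒜 : Set (OpenPartialHomeomorph M E)) (p : ℕ) :
    Set (OpenPartialHomeomorph (Fin p → M) (Fin p → E)) :=
  {e | ∃ c : Fin p → OpenPartialHomeomorph M E, (∀ i, c i ∈ 𝒜) ∧
    e = OpenPartialHomeomorph.pi c}

/-- A paracompact (Hausdorff) smooth manifold modelled on the space `E`. -/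
class FrechetManifold (E M : Type*) [AddCommGroup E] [Module ℝ E] [TopologicalSpace E]
    [TopologicalSpace M] [ChartedSpace E M] : Prop extends T2Space M, ParacompactSpace M where
  compatible : ∀ e ∈ atlas E M, ∀ e' ∈ atlas E M, CInfOn (e.symm.trans e') (e.symm.trans e').source

/-- The tangent map at `x` of a map `f : M → N` between manifolds. The tangent spaces at `x` and
at `f x` are identified with the model spaces through the preferred charts at these points. -/
noncomputable def tangentMapAt (E F : Type*) {M N : Type*} [AddCommGroup E] [Module ℝ E]
    [TopologicalSpace E] [AddCommGroup F] [Module ℝ F] [TopologicalSpace F]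
    [TopologicalSpace M] [ChartedSpace E M] [TopologicalSpace N] [ChartedSpace F N]
    (f : M → N) (x : M) (v : E) : F :=
  dirDeriv (chartAt F (f x) ∘ f ∘ (chartAt E x).symm) (chartAt E x x) v

variable {M N P E F H : Type*} [TopologicalSpace M] [TopologicalSpace N] [TopologicalSpace P]
  [AddCommGroup E] [Module ℝ E] [TopologicalSpace E] [IsTopologicalAddGroup E] [ContinuousSMul ℝ E]
  [AddCommGroup F] [Module ℝ F] [TopologicalSpace F] [IsTopologicalAddGroup F] [ContinuousSMul ℝ F]
  [T2Space F]
  [AddCommGroup H] [Module ℝ H] [TopologicalSpace H] [IsTopologicalAddGroup H] [ContinuousSMul ℝ H]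
  [T2Space H]
  {𝒜 : Set (OpenPartialHomeomorph M E)} {ℬ : Set (OpenPartialHomeomorph N F)}
  {𝒞 : Set (OpenPartialHomeomorph P H)}

theorem SmoothOn.mono {f : M → N} {U V : Set M} (hf : SmoothOn 𝒜 ℬ f U) (hV : V ⊆ U) :
    SmoothOn 𝒜 ℬ f V :=
  ⟨hf.1.mono hV, fun e he e' he' n => (hf.2 e he e' he' n).mono fun _ hx =>
    ⟨hx.1, hV hx.2.1, hx.2.2⟩⟩

theorem isOpen_chartDomain {f : M → N} {U : Set M} (hU : IsOpen U) (hf : ContinuousOn f U)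
    (e : OpenPartialHomeomorph M E) (e' : OpenPartialHomeomorph N F) :
    IsOpen (e.target ∩ e.symm ⁻¹' (U ∩ f ⁻¹' e'.source)) :=
  e.symm.isOpen_inter_preimage (hf.isOpen_inter_preimage hU e'.open_source)

theorem SmoothOn.comp [LocallyConvexSpace ℝ H] {f : M → N} {g : N → P} {U : Set M} {V : Set N}
    (hℬ : ∀ y : N, ∃ e ∈ ℬ, y ∈ e.source) (hU : IsOpen U) (hV : IsOpen V)
    (hg : SmoothOn ℬ 𝒞 g V) (hf : SmoothOn 𝒜 ℬ f U) (hm : MapsTo f U V) :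
    SmoothOn 𝒜 𝒞 (fun x => g (f x)) U := by
  have hc : ContinuousOn (fun x => g (f x)) U := hg.1.comp hf.1 hm
  refine ⟨hc, fun e he e'' he'' n => CnOn.of_local fun x hx => ?_⟩
  obtain ⟨e', he', hy⟩ := hℬ (f (e.symm x))
  have hD := isOpen_chartDomain hU hc e e''
  have hD1 := isOpen_chartDomain hU hf.1 e e'
  have hW := isOpen_chartDomain hV hg.1 e' e''
  refine ⟨_, hD1.inter hD, ⟨⟨hx.1, hx.2.1, hy⟩, hx⟩, ?_⟩
  have h := CnOn.comp (hD1.inter hD) hW (hg.2 e' he' e'' he'' n)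
    ((hf.2 e he e' he' n).mono inter_subset_left) (fun z hz => by
      have hz1 : f (e.symm z) ∈ e'.source := hz.1.2.2
      refine ⟨e'.map_source hz1, ?_, ?_⟩
      · simpa [e'.left_inv hz1] using hm hz.2.2.1
      · simpa [e'.left_inv hz1] using hz.2.2.2)
  refine CnOn.congr (hD1.inter hD) h fun z hz => ?_
  have hz1 : f (e.symm z) ∈ e'.source := hz.1.2.2
  simp [e'.left_inv hz1]

theorem SmoothOn.prodMk {f : M → N} {g : M → P} {U : Set M} (hU : IsOpen U)
    (hf : SmoothOn 𝒜 ℬ f U) (hg : SmoothOn 𝒜 𝒞 g U) :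
    SmoothOn 𝒜 (prodAtlas ℬ 𝒞) (fun x => (f x, g x)) U := by
  have hc : ContinuousOn (fun x => (f x, g x)) U := hf.1.prodMk hg.1
  refine ⟨hc, ?_⟩
  rintro e he _ ⟨e₁, he₁, e₂, he₂, rfl⟩ n
  have hD := isOpen_chartDomain hU hc e (e₁.prod e₂)
  exact CnOn.prodMk hD
    ((hf.2 e he e₁ he₁ n).mono fun z hz => ⟨hz.1, hz.2.1, hz.2.2.1⟩)
    ((hg.2 e he e₂ he₂ n).mono fun z hz => ⟨hz.1, hz.2.1, hz.2.2.2⟩)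

theorem smoothOn_const (c : N) (U : Set M) : SmoothOn 𝒜 ℬ (fun _ => c) U :=
  ⟨continuousOn_const, fun _ _ e' _ n => cnOn_const n (e' c) _⟩

end Manifolds

/-! ### Lie groups -/

section Groups

/-- `exp` is the exponential map of the additively written Lie group `A` modelled on `F`: for each
tangent vector `ξ` at `0`, `t ↦ exp (t ξ)` is a smooth one-parameter subgroup with velocity `ξ`. -/
def IsAddExponential {F A : Type*} [AddCommGroup F] [Module ℝ F] [TopologicalSpace F]
    [ContinuousSMul ℝ F] [AddGroup A] [TopologicalSpace A] [ChartedSpace F A] (exp : F → A) : Prop :=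
  ∀ ξ : F, (∀ s t : ℝ, exp ((s + t) • ξ) = exp (s • ξ) + exp (t • ξ)) ∧
    SmoothOn {OpenPartialHomeomorph.refl ℝ} (atlas F A) (fun t : ℝ => exp (t • ξ)) univ ∧
    HasDerivAt (fun t : ℝ => chartAt F (0 : A) (exp (t • ξ))) ξ 0

/-- `exp` is the exponential map of the Lie group `G` modelled on `E`: for each tangent
vector `ξ` at `1`, `t ↦ exp (t ξ)` is a smooth one-parameter subgroup with velocity `ξ`. -/
def IsExponential {E G : Type*} [AddCommGroup E] [Module ℝ E] [TopologicalSpace E]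
    [ContinuousSMul ℝ E] [Group G] [TopologicalSpace G] [ChartedSpace E G] (exp : E → G) : Prop :=
  ∀ ξ : E, (∀ s t : ℝ, exp ((s + t) • ξ) = exp (s • ξ) * exp (t • ξ)) ∧
    SmoothOn {OpenPartialHomeomorph.refl ℝ} (atlas E G) (fun t : ℝ => exp (t • ξ)) univ ∧
    HasDerivAt (fun t : ℝ => chartAt E (1 : G) (exp (t • ξ))) ξ 0

/-- A Lie group modelled on the Fréchet space `E`: a paracompact manifold with a group structure
whose product and inverse are smooth and which has an everywhere defined exponential map. -/
class FrechetLieGroup (E G : Type*) [AddCommGroup E] [Module ℝ E] [TopologicalSpace E]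
    [FrechetSpace E] [Group G] [TopologicalSpace G] [ChartedSpace E G] : Prop
    extends FrechetManifold E G where
  smooth_mul : SmoothOn (prodAtlas (atlas E G) (atlas E G)) (atlas E G)
    (fun p : G × G => p.1 * p.2) univ
  smooth_inv : SmoothOn (atlas E G) (atlas E G) (fun g : G => g⁻¹) univ
  exists_exp : ∃ exp : E → G, IsExponential exp

/-- The additively written version of `FrechetLieGroup`. -/
class FrechetLieAddGroup (F A : Type*) [AddCommGroup F] [Module ℝ F] [TopologicalSpace F]
    [FrechetSpace F] [AddGroup A] [TopologicalSpace A] [ChartedSpace F A] : Prop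
    extends FrechetManifold F A where
  smooth_add : SmoothOn (prodAtlas (atlas F A) (atlas F A)) (atlas F A)
    (fun p : A × A => p.1 + p.2) univ
  smooth_neg : SmoothOn (atlas F A) (atlas F A) (fun a : A => -a) univ
  exists_exp : ∃ exp : F → A, IsAddExponential exp

/-- The exponential map of a Lie group. The Lie algebra, that is the tangent space at `1`, is
identified with the model space `E` through the preferred chart at `1`. -/
noncomputable def lieExp (E G : Type*) [AddCommGroup E] [Module ℝ E] [TopologicalSpace E]
    [FrechetSpace E] [Group G] [TopologicalSpace G] [ChartedSpace E G] [FrechetLieGroup E G] :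
    E → G :=
  Classical.choose (FrechetLieGroup.exists_exp (E := E) (G := G))

/-- The left invariant vector field on `G` with value `ξ` at `1`, in the preferred chart at `1`. -/
noncomputable def leftInvField (E G : Type*) [AddCommGroup E] [Module ℝ E] [TopologicalSpace E]
    [Group G] [TopologicalSpace G] [ChartedSpace E G] (ξ : E) (x : E) : E :=
  dirDeriv (fun y => chartAt E (1 : G) ((chartAt E (1 : G)).symm x * (chartAt E (1 : G)).symm y))
    (chartAt E (1 : G) 1) ξ

/-- The bracket of the Lie algebra of `G`: the value at `1` of the Lie bracket
`[X, Y] = DY · X - DX · Y` of left invariant vector fields. -/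
noncomputable def lieBracket (E G : Type*) [AddCommGroup E] [Module ℝ E] [TopologicalSpace E]
    [Group G] [TopologicalSpace G] [ChartedSpace E G] (ξ η : E) : E :=
  dirDeriv (leftInvField E G η) (chartAt E (1 : G) 1) ξ -
    dirDeriv (leftInvField E G ξ) (chartAt E (1 : G) 1) η

end Groups

/-! ### Local differentiable cohomology -/

section LocalCohomology

/-- The face maps `d_0, …, d_(p+1) : G^(p+1) → G^p` of the simplicial manifold `BG`: `d_0` and
`d_(p+1)` drop the first and the last entry, the others multiply two neighbouring entries. -/
def face {G : Type*} [Group G] {p : ℕ} (i : Fin (p + 2)) (g : Fin (p + 1) → G) : Fin p → G :=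
  Fin.cases (motive := fun _ => Fin p → G) (Fin.tail g)
    (fun j => Fin.contractNth j (fun a b => a * b) g) i

theorem tendsto_face (E : Type*) {G : Type*} [AddCommGroup E] [Module ℝ E] [TopologicalSpace E]
    [FrechetSpace E] [Group G] [TopologicalSpace G] [ChartedSpace E G] [FrechetLieGroup E G]
    {p : ℕ} (i : Fin (p + 2)) :
    Tendsto (face (G := G) i) (𝓝 1) (𝓝 1) := by
  have hmul : Continuous fun p : G × G => p.1 * p.2 :=
    continuousOn_univ.1 (FrechetLieGroup.smooth_mul (E := E)).1
  have h1 : face i (1 : Fin (p + 1) → G) = 1 := by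
    refine Fin.cases rfl (fun j => ?_) i
    funext k
    simp [face, Fin.contractNth]
  have hc : Continuous (face (G := G) i) := by
    refine Fin.cases ?_ (fun j => ?_) i
    · exact continuous_pi fun k => continuous_apply k.succ
    · refine continuous_pi fun k => ?_
      simp only [face, Fin.cases_succ, Fin.contractNth]
      split_ifs
      · exact continuous_apply _
      · exact hmul.comp (Continuous.prodMk (continuous_apply k.castSucc) (continuous_apply k.succ))
      · exact continuous_apply _
  simpa [h1] using hc.tendsto 1

/-- Pull-back of germs of `A`-valued functions. -/
def germPullback {X Y A : Type*} [AddCommGroup A] {l : Filter X} {l' : Filter Y} (d : X → Y)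
    (hd : Tendsto d l l') : Germ l' A →+ Germ l A where
  toFun γ := γ.compTendsto d hd
  map_zero' := rfl
  map_add' γ δ := by
    induction γ using Germ.inductionOn
    induction δ using Germ.inductionOn
    rfl

variable (E G F A : Type*)
  [AddCommGroup E] [Module ℝ E] [TopologicalSpace E] [FrechetSpace E]
  [Group G] [TopologicalSpace G] [ChartedSpace E G] [FrechetLieGroup E G]
  [AddCommGroup F] [Module ℝ F] [TopologicalSpace F] [FrechetSpace F]
  [AddCommGroup A] [TopologicalSpace A] [ChartedSpace F A] [FrechetLieAddGroup F A]

/-- The group of germs at `(1, …, 1)` of smooth functions `G^p → A`. -/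
def localCochains (p : ℕ) : AddSubgroup (Germ (𝓝 (1 : Fin p → G)) A) where
  carrier := {γ | ∃ (f : (Fin p → G) → A) (U : Set (Fin p → G)), IsOpen U ∧ 1 ∈ U ∧
    SmoothOn (powAtlas (atlas E G) p) (atlas F A) f U ∧ γ = (f : Germ (𝓝 (1 : Fin p → G)) A)}
  zero_mem' := ⟨fun _ => 0, univ, isOpen_univ, trivial, smoothOn_const 0 univ, rfl⟩
  add_mem' := by
    rintro _ _ ⟨f, U, hU, h1, hf, rfl⟩ ⟨g, V, hV, h2, hg, rfl⟩
    refine ⟨fun x => f x + g x, U ∩ V, hU.inter hV, ⟨h1, h2⟩, ?_, rfl⟩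
    refine SmoothOn.comp (g := fun q : A × A => q.1 + q.2) ?_ (hU.inter hV) isOpen_univ
      FrechetLieAddGroup.smooth_add
      (SmoothOn.prodMk (hU.inter hV) (hf.mono inter_subset_left) (hg.mono inter_subset_right))
      fun _ _ => trivial
    exact fun q => ⟨_, ⟨_, chart_mem_atlas F q.1, _, chart_mem_atlas F q.2, rfl⟩,
      mem_chart_source F q.1, mem_chart_source F q.2⟩
  neg_mem' := by
    rintro _ ⟨f, U, hU, h1, hf, rfl⟩
    exact ⟨fun x => -f x, U, hU, h1, SmoothOn.comp (g := fun a : A => -a)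
      (fun a => ⟨_, chart_mem_atlas F a, mem_chart_source F a⟩) hU isOpen_univ
      FrechetLieAddGroup.smooth_neg hf fun _ _ => trivial, rfl⟩

/-- The differential `∑ i, (-1)^i d_i^*` on germs. -/
def localDiff (p : ℕ) :
    Germ (𝓝 (1 : Fin p → G)) A →+ Germ (𝓝 (1 : Fin (p + 1) → G)) A :=
  ∑ i : Fin (p + 2), ((-1 : ℤ) ^ (i : ℕ)) • germPullback (A := A) (face (G := G) i) (tendsto_face E i)

/-- Local differentiable `p`-cocycles. -/
def localCocycles (p : ℕ) : AddSubgroup (Germ (𝓝 (1 : Fin p → G)) A) :=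
  localCochains E G F A p ⊓ (localDiff E G A p).ker

/-- Local differentiable `p`-coboundaries. -/
def localCoboundaries : ∀ p : ℕ, AddSubgroup (Germ (𝓝 (1 : Fin p → G)) A)
  | 0 => ⊥
  | p + 1 => (localCochains E G F A p).map (localDiff E G A p)

/-- The local differentiable cohomology group `H^p_loc(G, A)`. -/
abbrev LocalCohomology (p : ℕ) : Type _ :=
  localCocycles E G F A p ⧸ (localCoboundaries E G F A p).addSubgroupOf (localCocycles E G F A p)

/-- The class of a local differentiable cocycle. -/
abbrev localClass {p : ℕ} (z : localCocycles E G F A p) : LocalCohomology E G F A p :=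
  QuotientAddGroup.mk z

end LocalCohomology

/-! ### Lie algebra cohomology -/

section LieCohomology

/-- `C^p(𝔤, A)`: for `p ≥ 1` the continuous (equivalently, smooth) alternating `p`-linear maps from
the Lie algebra `E` of `G` to the Lie algebra `F` of `A`; for `p = 0` the group `A` itself. -/
def LieCochain (E : Type u) (F : Type v) (A : Type w)
    [AddCommGroup E] [Module ℝ E] [TopologicalSpace E]
    [AddCommGroup F] [Module ℝ F] [TopologicalSpace F] : ℕ → Type (max u v w)
  | 0 => ULift.{max u v} A
  | p + 1 => ULift.{w} (E [⋀^Fin (p + 1)]→L[ℝ] F)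

noncomputable instance {E : Type u} {F : Type v} {A : Type w}
    [AddCommGroup E] [Module ℝ E] [TopologicalSpace E]
    [AddCommGroup F] [Module ℝ F] [TopologicalSpace F] [IsTopologicalAddGroup F] [AddCommGroup A] :
    ∀ p : ℕ, AddCommGroup (LieCochain E F A p)
  | 0 => inferInstanceAs (AddCommGroup (ULift.{max u v} A))
  | p + 1 => inferInstanceAs (AddCommGroup (ULift.{w} (E [⋀^Fin (p + 1)]→L[ℝ] F)))

variable (E : Type u) (G : Type u') (F : Type v) (A : Type w)
  [AddCommGroup E] [Module ℝ E] [TopologicalSpace E]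
  [Group G] [TopologicalSpace G] [ChartedSpace E G]
  [AddCommGroup F] [Module ℝ F] [TopologicalSpace F] [IsTopologicalAddGroup F]
  [AddCommGroup A]

/-- A cochain of degree `p ≥ 1` as a function of `p` elements of the Lie algebra. -/
def lieEval (p : ℕ) : LieCochain E F A (p + 1) →+ ((Fin (p + 1) → E) → F) where
  toFun ω ξ := ω.down ξ
  map_zero' := rfl
  map_add' _ _ := rfl

/-- The Chevalley–Eilenberg differential for trivial coefficients. It vanishes in degree `0`, and
`(dω)(ξ_0, …, ξ_p) = ∑ i < j, (-1)^(i+j) ω([ξ_i, ξ_j], ξ_0, …, omit ξ_i, …, omit ξ_j, …, ξ_p)`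
in degree `p ≥ 1`. -/
noncomputable def lieDiff : ∀ p : ℕ, LieCochain E F A p →+ ((Fin (p + 1) → E) → F)
  | 0 => 0
  | p + 1 =>
    { toFun := fun ω ξ => ∑ j : Fin (p + 2), ∑ i : Fin (p + 1),
        if i.castSucc < j then
          ((-1 : ℤ) ^ ((i : ℕ) + (j : ℕ))) • lieEval E F A p ω
            (Fin.cons (lieBracket E G (ξ i.castSucc) (ξ j)) (i.removeNth (j.removeNth ξ)))
        else 0
      map_zero' := by
        funext ξ
        simp
      map_add' := fun ω θ => by
        funext ξ
        simp only [map_add, Pi.add_apply, smul_add, ← Finset.sum_add_distrib]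
        refine Finset.sum_congr rfl fun j _ => Finset.sum_congr rfl fun i _ => ?_
        split_ifs <;> simp }

/-- Cocycles of the Lie algebra of `G`. -/
noncomputable def lieCocycles (p : ℕ) : AddSubgroup (LieCochain E F A p) :=
  (lieDiff E G F A p).ker

/-- Coboundaries of the Lie algebra of `G`. -/
noncomputable def lieCoboundaries : ∀ p : ℕ, AddSubgroup (LieCochain E F A p)
  | 0 => ⊥
  | p + 1 => (lieDiff E G F A p).range.comap (lieEval E F A p)

/-- The Lie algebra cohomology group `H^p(𝔤, A)`. -/
abbrev LieCohomology (p : ℕ) : Type _ :=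
  lieCocycles E G F A p ⧸ (lieCoboundaries E G F A p).addSubgroupOf (lieCocycles E G F A p)

/-- The class of a Lie algebra cocycle. -/
noncomputable abbrev lieClass {p : ℕ} (ω : lieCocycles E G F A p) : LieCohomology E G F A p :=
  QuotientAddGroup.mk ω

end LieCohomology

/-! ### The comparison map -/

section Comparison

/-- `w` is the mixed partial derivative `∂^n f / ∂t_1 ⋯ ∂t_n` at `0`, the successive derivatives
existing at all points near `0` that are needed. -/
def HasMixedPartial {F : Type*} [AddCommGroup F] [Module ℝ F] [TopologicalSpace F]
    [ContinuousSMul ℝ F] : ∀ n : ℕ, ((Fin n → ℝ) → F) → F → Prop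
  | 0, f, w => f 0 = w
  | n + 1, f, w => ∃ g : (Fin n → ℝ) → F,
      (∀ᶠ t in 𝓝 0, HasDerivAt (fun s : ℝ => f (Fin.cons s t)) (g t) 0) ∧ HasMixedPartial n g w

/-- `w` is the mixed partial derivative `∂^(n+1) f / ∂t_0 ⋯ ∂t_n` at `0` of a function `f` with
values in the abelian Lie group `A`. The first derivative is translated back to the tangent space
at `0`, so that it is a function with values in the Lie algebra `F` of `A`; the remaining
derivatives are those of an `F`-valued function. -/
def HasMixedPartialLie {F A : Type*} [AddCommGroup F] [Module ℝ F] [TopologicalSpace F]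
    [ContinuousSMul ℝ F] [AddCommGroup A] [TopologicalSpace A] [ChartedSpace F A]
    (n : ℕ) (f : (Fin (n + 1) → ℝ) → A) (w : F) : Prop :=
  ∃ g : (Fin n → ℝ) → F,
    (∀ᶠ t in 𝓝 0, HasDerivAt
      (fun s : ℝ => chartAt F (0 : A) (f (Fin.cons s t) - f (Fin.cons 0 t))) (g t) 0) ∧
    HasMixedPartial n g w

variable (E : Type u) (G : Type u') (F : Type v) (A : Type w)
  [AddCommGroup E] [Module ℝ E] [TopologicalSpace E] [FrechetSpace E]
  [Group G] [TopologicalSpace G] [ChartedSpace E G] [FrechetLieGroup E G]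
  [AddCommGroup F] [Module ℝ F] [TopologicalSpace F] [FrechetSpace F]
  [AddCommGroup A] [TopologicalSpace A] [ChartedSpace F A] [FrechetLieAddGroup F A]

/-- The Lie algebra cochain `ω` is obtained from the germ `z` of a function `c` by the formula
`ω(ξ_1, …, ξ_p) = ∂^p/∂t_1 ⋯ ∂t_p ∑ σ, ε(σ) c(exp(t_σ(1) ξ_σ(1)), …, exp(t_σ(p) ξ_σ(p)))` at
`t = 0`. For `p = 0` the formula reads `ω = c`. -/
def IsDerivedCochain : ∀ p : ℕ, Germ (𝓝 (1 : Fin p → G)) A → LieCochain E F A p → Prop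
  | 0, z, ω => ∀ c : (Fin 0 → G) → A, (c : Germ (𝓝 (1 : Fin 0 → G)) A) = z → ω.down = c 1
  | p + 1, z, ω => ∀ c : (Fin (p + 1) → G) → A, (c : Germ (𝓝 (1 : Fin (p + 1) → G)) A) = z →
      ∀ ξ : Fin (p + 1) → E, HasMixedPartialLie p
        (fun t => ∑ σ : Equiv.Perm (Fin (p + 1)), (Equiv.Perm.sign σ : ℤ) •
          c (fun i => lieExp E G (t (σ i) • ξ (σ i))))
        (lieEval E F A p ω ξ)

/-- The homomorphism `φ` is given on cocycles by the derivative formula. -/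
def IsDerivationMap {p : ℕ} (φ : LocalCohomology E G F A p →+ LieCohomology E G F A p) : Prop :=
  ∀ z : localCocycles E G F A p, ∃ ω : lieCocycles E G F A p,
    IsDerivedCochain E G F A p z ω ∧ φ (localClass E G F A z) = lieClass E G F A ω

end Comparison

/-! ### Functoriality -/

section Functoriality

/-- The image of a Lie algebra cochain under the tangent maps of homomorphisms `f : G' → G` and
`h : A → A'`: `ω'(ξ_1, …, ξ_p) = dh (ω(df ξ_1, …, df ξ_p))`, and `ω' = h ω` for `p = 0`. -/
def IsLieTransport (E : Type u) {G : Type u'} (F : Type v) {A : Type w}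
    (E₁ : Type u₁) {G₁ : Type u₁'} (F₁ : Type v₁) {A₁ : Type w₁}
    [AddCommGroup E] [Module ℝ E] [TopologicalSpace E]
    [Group G] [TopologicalSpace G] [ChartedSpace E G]
    [AddCommGroup F] [Module ℝ F] [TopologicalSpace F] [IsTopologicalAddGroup F]
    [AddCommGroup A] [TopologicalSpace A] [ChartedSpace F A]
    [AddCommGroup E₁] [Module ℝ E₁] [TopologicalSpace E₁]
    [Group G₁] [TopologicalSpace G₁] [ChartedSpace E₁ G₁]
    [AddCommGroup F₁] [Module ℝ F₁] [TopologicalSpace F₁] [IsTopologicalAddGroup F₁]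
    [AddCommGroup A₁] [TopologicalSpace A₁] [ChartedSpace F₁ A₁]
    (f : G₁ →* G) (h : A →+ A₁) : ∀ p : ℕ, LieCochain E F A p → LieCochain E₁ F₁ A₁ p → Prop
  | 0, ω, ω₁ => ω₁.down = h ω.down
  | p + 1, ω, ω₁ => ∀ ξ : Fin (p + 1) → E₁, lieEval E₁ F₁ A₁ p ω₁ ξ =
      tangentMapAt F F₁ h 0 (lieEval E F A p ω fun i => tangentMapAt E₁ E f 1 (ξ i))

variable (E : Type u) (G : Type u') (F : Type v) (A : Type w)
  [AddCommGroup E] [Module ℝ E] [TopologicalSpace E] [FrechetSpace E]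
  [Group G] [TopologicalSpace G] [ChartedSpace E G] [FrechetLieGroup E G]
  [AddCommGroup F] [Module ℝ F] [TopologicalSpace F] [FrechetSpace F]
  [AddCommGroup A] [TopologicalSpace A] [ChartedSpace F A] [FrechetLieAddGroup F A]
  (E₁ : Type u₁) (G₁ : Type u₁') (F₁ : Type v₁) (A₁ : Type w₁)
  [AddCommGroup E₁] [Module ℝ E₁] [TopologicalSpace E₁] [FrechetSpace E₁]
  [Group G₁] [TopologicalSpace G₁] [ChartedSpace E₁ G₁] [FrechetLieGroup E₁ G₁]
  [AddCommGroup F₁] [Module ℝ F₁] [TopologicalSpace F₁] [FrechetSpace F₁]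
  [AddCommGroup A₁] [TopologicalSpace A₁] [ChartedSpace F₁ A₁] [FrechetLieAddGroup F₁ A₁]

/-- `Φ` is the map `H^p_loc(G, A) → H^p_loc(G₁, A₁)` induced by `f : G₁ → G` and `h : A → A₁`: it
sends the class of `c` to the class of the germ of `h ∘ c ∘ f^p`. -/
def IsLocalInduced (f : G₁ →* G) (h : A →+ A₁) {p : ℕ}
    (Φ : LocalCohomology E G F A p →+ LocalCohomology E₁ G₁ F₁ A₁ p) : Prop :=
  ∀ z : localCocycles E G F A p, ∃ z₁ : localCocycles E₁ G₁ F₁ A₁ p,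
    (∀ c : (Fin p → G) → A, (c : Germ (𝓝 (1 : Fin p → G)) A) = z →
      ((fun g => h (c fun i => f (g i)) : (Fin p → G₁) → A₁) : Germ (𝓝 (1 : Fin p → G₁)) A₁) = z₁) ∧
    Φ (localClass E G F A z) = localClass E₁ G₁ F₁ A₁ z₁

/-- `Ψ` is the map `H^p(𝔤, A) → H^p(𝔤₁, A₁)` induced by `f : G₁ → G` and `h : A → A₁`: it sends the
class of `ω` to the class of `dh ∘ ω ∘ (df)^p`. -/
def IsLieInduced (f : G₁ →* G) (h : A →+ A₁) {p : ℕ}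
    (Ψ : LieCohomology E G F A p →+ LieCohomology E₁ G₁ F₁ A₁ p) : Prop :=
  ∀ ω : lieCocycles E G F A p, ∃ ω₁ : lieCocycles E₁ G₁ F₁ A₁ p,
    IsLieTransport E F E₁ F₁ f h p ω ω₁ ∧ Ψ (lieClass E G F A ω) = lieClass E₁ G₁ F₁ A₁ ω₁

end Functoriality

end FrechetLie

open FrechetLie

namespace FrechetLie

open Filter Set
open scoped Topology

set_option linter.unusedSectionVars false

/-! ### Calculus between locally convex spaces -/

section SmoothCalculus

variable {X Y F H : Type*}
  [AddCommGroup X] [Module ℝ X] [TopologicalSpace X] [IsTopologicalAddGroup X] [ContinuousSMul ℝ X]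
  [AddCommGroup Y] [Module ℝ Y] [TopologicalSpace Y] [IsTopologicalAddGroup Y] [ContinuousSMul ℝ Y]
  [AddCommGroup F] [Module ℝ F] [TopologicalSpace F] [IsTopologicalAddGroup F] [ContinuousSMul ℝ F]
  [AddCommGroup H] [Module ℝ H] [TopologicalSpace H] [IsTopologicalAddGroup H] [ContinuousSMul ℝ H]
  {f g : X → F} {U : Set X} {x : X}

/-! Read in the chart at the identity, a smooth cochain `c` on `G^p` becomes a function of `p`
vectors. Its iterated derivative at the identity, with one direction in each factor, is a continuous
multilinear map (`factorDeriv`, `exists_factorMultilinear`). Every variable in the defining formula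
is differentiated at `0` only, so of the curves `t ↦ exp (t ξ_i)` nothing but the initial velocity
enters, and the formula computes the antisymmetrization of `factorDeriv`
(`ChartSmooth.hasMixedPartialLie`). Existence of the derivatives, multilinearity and continuity are
therefore calculus; the substance is that antisymmetrized derivatives form a chain map.

For this, differentiate `δc` face by face. The outer faces ignore one factor and contribute zero. An
inner face puts the product of the factors `j` and `j + 1` into one slot, and differentiating
through the product gives two terms (`factorDeriv_face_middle`): a second derivative of `c` in slot
`j`, symmetric in the two vectors, and the derivative of `c` with `B(ξ_j, ξ_{j+1})` in slot `j`,
where `B`, called `leftInvDeriv`, is the mixed second derivative of the multiplication at the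
identity. Antisymmetrization kills the first term. In the second it produces `B(x, y) - B(y, x) =
[x, y]`, and a count of signs (`sum_antisymm_contract`) shows that the sum over `j` is the
Chevalley–Eilenberg differential (`antisymm_factorDeriv_coboundary`).

A function with values in `A` has no linear target. Its first derivative is translated to `0`, which
gives an `F`-valued one-form `mcDeriv`; all further derivatives are ordinary. Symmetry in all
directions then needs, besides the Schwarz theorem, that this form is closed
(`SmoothInto.dirDeriv_mcDeriv_comm`).

Mixed partial derivatives are unique, so the formula determines the cochain. Additivity, uniqueness
of `φ` and naturality all come from this. For naturality, `h ∘ c` is differentiated along the curves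
`f (exp (t ξ_i))`, whose velocities are `df ξ_i`; that `ω ↦ dh ∘ ω ∘ (df)^p` respects the
differentials rests on `df` preserving brackets (`tangentMapAt_lieBracket`). -/

theorem CInfOn.mono (h : CInfOn f U) {V : Set X} (hV : V ⊆ U) : CInfOn f V :=
  fun n => (h n).mono hV

theorem CInfOn.congr [T2Space F] (hU : IsOpen U) (h : CInfOn f U) (e : EqOn f g U) : CInfOn g U :=
  fun n => (h n).congr hU e

theorem CInfOn.continuousOn (h : CInfOn f U) : ContinuousOn f U := h 0

theorem CInfOn.continuousAt (h : CInfOn f U) (hU : IsOpen U) (hx : x ∈ U) : ContinuousAt f x :=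
  h.continuousOn.continuousAt (hU.mem_nhds hx)

theorem CInfOn.comp [T2Space F] [LocallyConvexSpace ℝ F] [T2Space Y] {g : Y → F} {f : X → Y}
    {V : Set Y} (hU : IsOpen U) (hV : IsOpen V) (hg : CInfOn g V) (hf : CInfOn f U)
    (hm : MapsTo f U V) : CInfOn (fun x => g (f x)) U :=
  fun n => CnOn.comp hU hV (hg n) (hf n) hm

theorem cInfOn_clm [T2Space F] (L : X →L[ℝ] F) (U : Set X) : CInfOn L U := fun n => cnOn_clm n L U

theorem cInfOn_const [T2Space F] (c : F) (U : Set X) : CInfOn (fun _ : X => c) U :=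
  fun n => cnOn_const n c U

theorem CInfOn.prodMk [T2Space F] [T2Space H] {g : X → H} (hU : IsOpen U) (hf : CInfOn f U)
    (hg : CInfOn g U) : CInfOn (fun x => (f x, g x)) U :=
  fun n => CnOn.prodMk hU (hf n) (hg n)

theorem CInfOn.clm_comp [T2Space F] [T2Space H] [LocallyConvexSpace ℝ H] (L : F →L[ℝ] H)
    (hU : IsOpen U) (hf : CInfOn f U) : CInfOn (fun x => L (f x)) U :=
  CInfOn.comp hU isOpen_univ (cInfOn_clm L univ) hf fun _ _ => trivial

theorem CInfOn.add [T2Space F] [LocallyConvexSpace ℝ F] (hU : IsOpen U) (hf : CInfOn f U)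
    (hg : CInfOn g U) : CInfOn (fun x => f x + g x) U :=
  CInfOn.clm_comp (ContinuousLinearMap.fst ℝ F F + ContinuousLinearMap.snd ℝ F F) hU
    (hf.prodMk hU hg)

theorem hasDerivAt_pi {ι : Type*} [Fintype ι] {γ : ℝ → ι → F} {w : ι → F} {s : ℝ} :
    HasDerivAt γ w s ↔ ∀ i, HasDerivAt (fun t => γ t i) (w i) s := by
  simp only [hasDerivAt_iff_slope, tendsto_pi_nhds]
  rfl

theorem CnOn.pi [T2Space F] {ι : Type*} [Fintype ι] {n : ℕ} :
    ∀ {X : Type*} [AddCommGroup X] [Module ℝ X] [TopologicalSpace X] [IsTopologicalAddGroup X]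
      [ContinuousSMul ℝ X] {f : X → ι → F} {U : Set X}, IsOpen U →
      (∀ i, CnOn n (fun x => f x i) U) → CnOn n f U := by
  induction n with
  | zero => intro X _ _ _ _ _ f U _ hf; exact continuousOn_pi.2 hf
  | succ n ih =>
    intro X _ _ _ _ _ f U hU hf
    have key : ∀ x ∈ U, ∀ v : X, HasDerivAt (fun t : ℝ => f (x + t • v))
        (fun i => dirDeriv (fun x => f x i) x v) 0 := fun x hx v =>
      hasDerivAt_pi.2 fun i => hasDerivAt_deriv ((hf i).2.1 x hx v)
    refine ⟨continuousOn_pi.2 fun i => (hf i).1, fun x hx v => HasDerivAt.diffAt (key x hx v), ?_⟩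
    refine CnOn.congr (hU.prod isOpen_univ)
      (ih (f := fun (p : X × X) i => dirDeriv (fun x => f x i) p.1 p.2)
        (hU.prod isOpen_univ) fun i => (hf i).2.2) fun p hp => ?_
    exact (deriv_eq_of_hasDerivAt (key p.1 hp.1 p.2)).symm

theorem CInfOn.pi [T2Space F] {ι : Type*} [Fintype ι] {f : X → ι → F} (hU : IsOpen U)
    (hf : ∀ i, CInfOn (fun x => f x i) U) : CInfOn f U :=
  fun n => CnOn.pi hU fun i => hf i n

theorem CInfOn.hasDerivAt (h : CInfOn f U) (hx : x ∈ U) (v : X) :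
    HasDerivAt (fun t : ℝ => f (x + t • v)) (dirDeriv f x v) 0 :=
  hasDerivAt_deriv ((h 1).2.1 x hx v)

theorem CInfOn.dirDeriv (h : CInfOn f U) :
    CInfOn (fun p : X × X => dirDeriv f p.1 p.2) (U ×ˢ univ) :=
  fun n => (h (n + 1)).2.2

theorem CInfOn.hasDerivAt_curve [LocallyConvexSpace ℝ F] (hU : IsOpen U) (h : CInfOn f U)
    {γ : ℝ → X} {w : X} (h0 : γ 0 ∈ U) (hγ : HasDerivAt γ w 0) :
    HasDerivAt (fun t => f (γ t)) (FrechetLie.dirDeriv f (γ 0) w) 0 :=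
  hasDerivAt_comp_curve hU (h 1) h0 hγ

theorem CInfOn.comp_prodMk_const [T2Space X] [T2Space Y] [T2Space F] [LocallyConvexSpace ℝ F]
    {f : X × Y → F}
    {W : Set (X × Y)} (hW : IsOpen W) (h : CInfOn f W) (y : Y) :
    CInfOn (fun x => f (x, y)) {x | (x, y) ∈ W} :=
  have hO : IsOpen {x | (x, y) ∈ W} := hW.preimage (by fun_prop : Continuous fun x => (x, y))
  CInfOn.comp hO hW h
    (CInfOn.prodMk hO (cInfOn_clm (ContinuousLinearMap.id ℝ X) _) (cInfOn_const y _)) fun _ hx => hx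

theorem CInfOn.dirDeriv_const [T2Space X] [T2Space F] [LocallyConvexSpace ℝ F] (hU : IsOpen U)
    (h : CInfOn f U) (v : X) : CInfOn (fun x => FrechetLie.dirDeriv f x v) U :=
  (CInfOn.comp_prodMk_const (hU.prod isOpen_univ) h.dirDeriv v).mono fun _ hx => ⟨hx, trivial⟩

/-- Closed convex neighbourhoods form a basis in a locally convex space, and the mean value
inequality `slope_mem` gives membership in exactly such sets. -/
theorem tendsto_of_closed_convex [LocallyConvexSpace ℝ F] {α : Type*} {l : Filter α} {q : α → F}
    {a : F} (h : ∀ K : Set F, K ∈ 𝓝 a → IsClosed K → Convex ℝ K → ∀ᶠ t in l, q t ∈ K) :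
    Tendsto q l (𝓝 a) := by
  rw [tendsto_iff_forall_eventually_mem]
  intro S hS
  obtain ⟨C, hC, hCc, hCS⟩ := exists_mem_nhds_isClosed_subset hS
  obtain ⟨K, ⟨hK, hKc⟩, hKC⟩ := (LocallyConvexSpace.convex_basis (𝕜 := ℝ) _).mem_iff.1 hC
  filter_upwards [h (closure K) (mem_of_superset hK subset_closure) isClosed_closure hKc.closure]
    with t ht using hCS (closure_minimal hKC hCc ht)

/-- Makes a property near `0` in the plane uniform over the square of side `|t|`, since `slope_mem`
needs control on the whole segment. -/
theorem eventually_forall_abs_le {P : ℝ × ℝ → Prop} (h : ∀ᶠ p : ℝ × ℝ in 𝓝 0, P p) :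
    ∀ᶠ t : ℝ in 𝓝 0, ∀ a b : ℝ, |a| ≤ |t| → |b| ≤ |t| → P (a, b) := by
  obtain ⟨ε, hε, hP⟩ := Metric.eventually_nhds_iff.1 h
  filter_upwards [Metric.ball_mem_nhds (0 : ℝ) hε] with t ht a b ha hb
  have ht' : |t| < ε := by simpa using ht
  refine @hP (a, b) ?_
  simp only [dist_zero_right, Prod.norm_def, Real.norm_eq_abs]
  exact max_lt (ha.trans_lt ht') (hb.trans_lt ht')

theorem CInfOn.hasDerivAt_line (h : CInfOn f U) {y v : X} {s : ℝ} (hx : y + s • v ∈ U) :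
    HasDerivAt (fun t : ℝ => f (y + t • v)) (FrechetLie.dirDeriv f (y + s • v) v) s := by
  have := hasDerivAt_iff_slope.1 (h.hasDerivAt hx v)
  rw [hasDerivAt_iff_slope]
  refine this.congr fun r => ?_
  simp [add_smul, add_assoc]

/-- The increment along `t • (v + w)` is travelled in two legs. The second leg starts at the moving
point `x + t • v`, and the mean value inequality together with joint continuity of the derivative
shows that its slope still tends to the derivative at `x`. -/
theorem CInfOn.dirDeriv_add [T2Space F] [LocallyConvexSpace ℝ F] (hU : IsOpen U) (h : CInfOn f U)
    (hx : x ∈ U) (v w : X) : FrechetLie.dirDeriv f x (v + w) =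
      FrechetLie.dirDeriv f x v + FrechetLie.dirDeriv f x w := by
  have h2 : Tendsto (fun t : ℝ => t⁻¹ • (f (x + t • v + t • w) - f (x + t • v))) (𝓝[≠] 0)
      (𝓝 (FrechetLie.dirDeriv f x w)) := by
    refine tendsto_of_closed_convex fun K hK hKc hKv => ?_
    have hc : ContinuousAt (fun p : ℝ × ℝ => x + p.1 • v + p.2 • w) 0 := by fun_prop
    have hev : ∀ᶠ p : ℝ × ℝ in 𝓝 0, x + p.1 • v + p.2 • w ∈ U ∧
        FrechetLie.dirDeriv f (x + p.1 • v + p.2 • w) w ∈ K := by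
      have hc' : Tendsto (fun p : ℝ × ℝ => x + p.1 • v + p.2 • w) (𝓝 0) (𝓝 x) := by
        simpa [ContinuousAt] using hc
      refine (hc'.eventually (hU.mem_nhds hx)).and ?_
      have hd := (h.dirDeriv.continuousAt (hU.prod isOpen_univ) (x := (x, w)) ⟨hx, trivial⟩)
      exact (hd.tendsto.comp (hc'.prodMk_nhds tendsto_const_nhds)).eventually hK
    filter_upwards [nhdsWithin_le_nhds (eventually_forall_abs_le hev), self_mem_nhdsWithin]
      with t ht ht0
    have := slope_mem (g := fun s => f (x + t • v + s • w)) hKv hKc ht0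
      (fun s hs => h.hasDerivAt_line (ht t s le_rfl hs).1) (fun s hs => (ht t s le_rfl hs).2)
    simpa using this
  have h1 := hasDerivAt_iff_slope.1 (h.hasDerivAt hx v)
  have h3 := hasDerivAt_iff_slope.1 (h.hasDerivAt hx (v + w))
  refine tendsto_nhds_unique h3 ((h1.add h2).congr fun t => ?_)
  rw [← smul_add]
  simp [add_assoc]

/-- A continuous additive map between real topological vector spaces is real linear. -/
theorem CInfOn.dirDeriv_smul [T2Space X] [T2Space F] [LocallyConvexSpace ℝ F] (hU : IsOpen U)
    (h : CInfOn f U) (hx : x ∈ U) (r : ℝ) (v : X) :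
    FrechetLie.dirDeriv f x (r • v) = r • FrechetLie.dirDeriv f x v := by
  let L : X →+ F := AddMonoidHom.mk' (FrechetLie.dirDeriv f x) (h.dirDeriv_add hU hx)
  have hL : Continuous L := by
    rw [continuous_iff_continuousAt]
    intro v
    have hd := h.dirDeriv.continuousAt (hU.prod isOpen_univ) (x := (x, v)) ⟨hx, trivial⟩
    exact hd.tendsto.comp ((continuous_const.prodMk continuous_id).tendsto v)
  exact map_real_smul L hL r v

/-- The derivative of a smooth map at a point as a continuous linear map. -/
noncomputable def CInfOn.dirDerivL [T2Space X] [T2Space F] [LocallyConvexSpace ℝ F]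
    (hU : IsOpen U) (h : CInfOn f U) (hx : x ∈ U) : X →L[ℝ] F where
  toFun := FrechetLie.dirDeriv f x
  map_add' := h.dirDeriv_add hU hx
  map_smul' := h.dirDeriv_smul hU hx
  cont := by
    rw [continuous_iff_continuousAt]
    intro v
    have hd := h.dirDeriv.continuousAt (hU.prod isOpen_univ) (x := (x, v)) ⟨hx, trivial⟩
    exact hd.tendsto.comp ((continuous_const.prodMk continuous_id).tendsto v)

/-- The second derivative is the limit of the second difference quotients. -/
theorem CInfOn.tendsto_second_difference [T2Space X] [T2Space F] [LocallyConvexSpace ℝ F]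
    (hU : IsOpen U) (h : CInfOn f U) (hx : x ∈ U) (v w : X) :
    Tendsto (fun t : ℝ => t⁻¹ • t⁻¹ • (f (x + t • v + t • w) - f (x + t • v) -
      (f (x + t • w) - f x))) (𝓝[≠] 0)
      (𝓝 (FrechetLie.dirDeriv (fun y => FrechetLie.dirDeriv f y v) x w)) := by
  refine tendsto_of_closed_convex fun K hK hKc hKv => ?_
  have hdv := h.dirDeriv_const hU v
  have hc : Tendsto (fun p : ℝ × ℝ => x + p.1 • v + p.2 • w) (𝓝 0) (𝓝 x) := by
    have : ContinuousAt (fun p : ℝ × ℝ => x + p.1 • v + p.2 • w) 0 := by fun_prop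
    simpa [ContinuousAt] using this
  have hev : ∀ᶠ p : ℝ × ℝ in 𝓝 0, x + p.1 • v + p.2 • w ∈ U ∧
      FrechetLie.dirDeriv (fun y => FrechetLie.dirDeriv f y v) (x + p.1 • v + p.2 • w) w ∈ K :=
    (hc.eventually (hU.mem_nhds hx)).and
      (((hdv.dirDeriv_const hU w).continuousAt hU hx).tendsto.comp hc |>.eventually hK)
  filter_upwards [nhdsWithin_le_nhds (eventually_forall_abs_le hev), self_mem_nhdsWithin]
    with t ht ht0
  -- The mean value inequality is used twice: here in the direction `w` for the derivative along
  -- `v`, and at the end in the direction `v` for the quotient `s ↦ t⁻¹ • (f (x + t • w + s • v) - f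
  -- (x + s • v))`.
  have hin : ∀ s, |s| ≤ |t| → t⁻¹ • (FrechetLie.dirDeriv f (x + s • v + t • w) v -
      FrechetLie.dirDeriv f (x + s • v) v) ∈ K := by
    intro s hs
    have := slope_mem (g := fun r => FrechetLie.dirDeriv f (x + s • v + r • w) v) hKv hKc ht0
      (fun r hr => hdv.hasDerivAt_line (ht s r hs hr).1) (fun r hr => (ht s r hs hr).2)
    simpa using this
  have hsh : ∀ s r : ℝ, x + r • w + s • v = x + s • v + r • w := fun s r => by abel
  have hd : ∀ s, |s| ≤ |t| → HasDerivAt (fun s => t⁻¹ • (f (x + t • w + s • v) - f (x + s • v)))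
      (t⁻¹ • (FrechetLie.dirDeriv f (x + s • v + t • w) v -
        FrechetLie.dirDeriv f (x + s • v) v)) s := by
    intro s hs
    have h1 := h.hasDerivAt_line (y := x + t • w) (v := v) (s := s)
      (by rw [hsh]; exact (ht s t hs le_rfl).1)
    have h2 := h.hasDerivAt_line (y := x) (v := v) (s := s)
      (by simpa using (ht s 0 hs (by simp)).1)
    rw [hsh] at h1
    rw [hasDerivAt_iff_slope] at h1 h2 ⊢
    refine ((h1.sub h2).const_smul t⁻¹).congr fun r => ?_
    simp only [← smul_sub]
    rw [smul_comm]
    congr 2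
    abel
  have := slope_mem hKv hKc ht0 hd hin
  simp only [zero_smul, add_zero, ← smul_sub] at this
  rw [hsh] at this
  exact this

/-- The Schwarz theorem: both sides are limits of the same second difference, which is symmetric in
`v` and `w`. -/
theorem CInfOn.dirDeriv_comm [T2Space X] [T2Space F] [LocallyConvexSpace ℝ F]
    (hU : IsOpen U) (h : CInfOn f U) (hx : x ∈ U) (v w : X) :
    FrechetLie.dirDeriv (fun y => FrechetLie.dirDeriv f y v) x w =
      FrechetLie.dirDeriv (fun y => FrechetLie.dirDeriv f y w) x v := by
  refine tendsto_nhds_unique (h.tendsto_second_difference hU hx v w)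
    ((h.tendsto_second_difference hU hx w v).congr fun t => ?_)
  rw [add_right_comm x (t • w)]
  congr 2
  abel

/-- The product rule for a function `H` of two variables that is linear in the second one, along
a line in the first variable and an arbitrary curve in the second one. -/
theorem CInfOn.hasDerivAt_of_linear [T2Space X] [T2Space Y] [T2Space F] [LocallyConvexSpace ℝ F]
    {H : X × Y → F} {U : Set X} (hU : IsOpen U) (hH : CInfOn H (U ×ˢ univ))
    (hlin : ∀ v w, H (x, v + w) = H (x, v) + H (x, w)) (hx : x ∈ U) {γ : ℝ → X} {v : X}
    (hγ0 : γ 0 = x) (hγ : HasDerivAt γ v 0)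
    {Λ : ℝ → Y} {z : Y} (hΛ : HasDerivAt Λ z 0) :
    HasDerivAt (fun s => H (γ s, Λ s))
      (FrechetLie.dirDeriv (fun y => H (y, Λ 0)) x v + H (x, z)) 0 := by
  have hO := hU.prod (isOpen_univ (X := Y))
  have h1 := hH.hasDerivAt_curve hO (γ := fun s => (γ s, Λ s)) ⟨by rwa [hγ0], trivial⟩
    (hasDerivAt_prodMk hγ hΛ)
  have hmem : (x, Λ 0) ∈ U ×ˢ (univ : Set Y) := ⟨hx, trivial⟩
  have h2 : FrechetLie.dirDeriv H (x, Λ 0) (v, z) =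
      FrechetLie.dirDeriv H (x, Λ 0) (v, 0) + FrechetLie.dirDeriv H (x, Λ 0) (0, z) := by
    rw [← hH.dirDeriv_add hO hmem]; simp
  have h3 : FrechetLie.dirDeriv H (x, Λ 0) (v, 0) =
      FrechetLie.dirDeriv (fun y => H (y, Λ 0)) x v := by
    simp [FrechetLie.dirDeriv]
  -- In its second variable `H` is additive and continuous, hence continuous linear, so it is its
  -- own derivative there.
  have h4 : FrechetLie.dirDeriv H (x, Λ 0) (0, z) = H (x, z) := by
    let L : Y →+ F := AddMonoidHom.mk' (fun v => H (x, v)) hlin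
    have hL : Continuous L := by
      rw [continuous_iff_continuousAt]
      intro v
      have hd := hH.continuousAt hO (x := (x, v)) ⟨hx, trivial⟩
      exact hd.tendsto.comp ((continuous_const.prodMk continuous_id).tendsto v)
    let L' : Y →L[ℝ] F := ⟨L.toRealLinearMap hL, hL⟩
    have : FrechetLie.dirDeriv H (x, Λ 0) (0, z) = FrechetLie.dirDeriv L' (Λ 0) z := by
      simp only [FrechetLie.dirDeriv, Prod.smul_mk, smul_zero, Prod.mk_add_mk, add_zero]
      rfl
    rw [this]
    exact deriv_eq_of_hasDerivAt (hasDerivAt_clm L' (Λ 0) z)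
  rw [hγ0, h2, h3, h4] at h1
  exact h1

end SmoothCalculus

/-! ### Iterated directional derivatives and mixed partial derivatives -/

section Iterated

variable {X Y F H : Type*}
  [AddCommGroup X] [Module ℝ X] [TopologicalSpace X] [IsTopologicalAddGroup X] [ContinuousSMul ℝ X]
  [AddCommGroup Y] [Module ℝ Y] [TopologicalSpace Y] [IsTopologicalAddGroup Y] [ContinuousSMul ℝ Y]
  [AddCommGroup F] [Module ℝ F] [TopologicalSpace F] [IsTopologicalAddGroup F] [ContinuousSMul ℝ F]
  [AddCommGroup H] [Module ℝ H] [TopologicalSpace H] [IsTopologicalAddGroup H] [ContinuousSMul ℝ H]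
  {u u' : X → F} {U : Set X} {x : X}

theorem HasDerivAt.tendsto_zero {γ : ℝ → F} {w : F} (h : HasDerivAt γ w 0) :
    Tendsto γ (𝓝 0) (𝓝 (γ 0)) := by
  have h1 := hasDerivAt_iff_slope.1 h
  have h2 : Tendsto (fun t : ℝ => t • t⁻¹ • (γ (0 + t) - γ 0) + γ 0) (𝓝[≠] 0) (𝓝 (γ 0)) := by
    have h3 : Tendsto (fun t : ℝ => t) (𝓝[≠] 0) (𝓝 0) := nhdsWithin_le_nhds
    simpa using (h3.smul h1).add_const (γ 0)
  have h4 : Tendsto γ (𝓝[≠] 0) (𝓝 (γ 0)) := by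
    refine h2.congr' ?_
    filter_upwards [self_mem_nhdsWithin] with t ht
    rw [smul_smul, mul_inv_cancel₀ ht]
    simp
  rw [← nhdsNE_sup_pure (0 : ℝ), tendsto_sup]
  exact ⟨h4, tendsto_pure_left.2 fun s hs => mem_of_mem_nhds hs⟩

theorem HasDerivAt.const_add_curve {γ : ℝ → F} {w : F} (h : HasDerivAt γ w 0) (y : F) :
    HasDerivAt (fun t => y + γ t) w 0 := by
  rw [hasDerivAt_iff_slope] at *
  simpa using h

theorem hasDerivAt_line (x v : F) (s : ℝ) : HasDerivAt (fun t : ℝ => x + t • v) v s := by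
  rw [hasDerivAt_iff_slope]
  refine tendsto_const_nhds.congr' ?_
  filter_upwards [self_mem_nhdsWithin] with t ht
  simp [add_smul, smul_smul, inv_mul_cancel₀ ht]

theorem hasDerivAt_smul (v : F) : HasDerivAt (fun t : ℝ => t • v) v 0 := by
  simpa using hasDerivAt_line 0 v 0

theorem HasDerivAt.clm_comp {γ : ℝ → F} {w : F} (h : HasDerivAt γ w 0) (L : F →L[ℝ] H) :
    HasDerivAt (fun t => L (γ t)) (L w) 0 := by
  rw [hasDerivAt_iff_slope] at *
  refine ((L.continuous.tendsto w).comp h).congr fun t => ?_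
  simp

theorem deriv_congr_of_eventuallyEq [T2Space F] {γ δ : ℝ → F} (h : γ =ᶠ[𝓝 0] δ) :
    deriv γ 0 = deriv δ 0 := by
  by_cases hγ : DifferentiableAt ℝ γ 0
  · exact (deriv_eq_of_hasDerivAt (hasDerivAt_congr h (hasDerivAt_deriv hγ))).symm
  -- Neither function is differentiable in this case, and both derivatives take the default value
  -- `0`.
  · have hδ : ¬ DifferentiableAt ℝ δ 0 := fun hδ =>
      hγ (HasDerivAt.diffAt (hasDerivAt_congr h.symm (hasDerivAt_deriv hδ)))
    simp [deriv, fderiv_zero_of_not_differentiableAt hγ, fderiv_zero_of_not_differentiableAt hδ]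

theorem dirDeriv_congr_of_eventuallyEq [T2Space F] (h : u =ᶠ[𝓝 x] u') (v : X) :
    dirDeriv u x v = dirDeriv u' x v := by
  have : (fun t : ℝ => u (x + t • v)) =ᶠ[𝓝 0] fun t : ℝ => u' (x + t • v) :=
    (tendsto_line x v).eventually h
  exact deriv_congr_of_eventuallyEq this

/-- The iterated derivative `∂_{v_{n-1}} ⋯ ∂_{v_0} u`. -/
noncomputable def iterDeriv : ∀ n : ℕ, (X → F) → (Fin n → X) → X → F
  | 0, u, _, x => u x
  | n + 1, u, v, x => iterDeriv n (fun y => dirDeriv u y (v 0)) (fun i => v i.succ) x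

theorem iterDeriv_congr [T2Space F] (hU : IsOpen U) {n : ℕ} : ∀ {u u' : X → F}, EqOn u u' U →
    ∀ (v : Fin n → X), EqOn (iterDeriv n u v) (iterDeriv n u' v) U := by
  induction n with
  | zero => intro u u' h v; exact h
  | succ n ih =>
    intro u u' h v
    exact ih (fun y hy => dirDeriv_congr_of_eventuallyEq (h.eventuallyEq_of_mem (hU.mem_nhds hy)) _) _

theorem CInfOn.dirDeriv_fun_add [T2Space F] (h : CInfOn u U) (h' : CInfOn u' U) (hx : x ∈ U)
    (v : X) : FrechetLie.dirDeriv (fun y => u y + u' y) x v =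
      FrechetLie.dirDeriv u x v + FrechetLie.dirDeriv u' x v := by
  have h1 := hasDerivAt_iff_slope.1 (h.hasDerivAt hx v)
  have h2 := hasDerivAt_iff_slope.1 (h'.hasDerivAt hx v)
  refine deriv_eq_of_hasDerivAt (hasDerivAt_iff_slope.2 ((h1.add h2).congr fun t => ?_))
  rw [← smul_add, add_sub_add_comm]

theorem CInfOn.iterDeriv_add [T2Space X] [T2Space F] [LocallyConvexSpace ℝ F] (hU : IsOpen U)
    {n : ℕ} : ∀ {u u' : X → F}, CInfOn u U → CInfOn u' U → ∀ v : Fin n → X, ∀ x ∈ U,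
      FrechetLie.iterDeriv n (fun y => u y + u' y) v x =
        FrechetLie.iterDeriv n u v x + FrechetLie.iterDeriv n u' v x := by
  induction n with
  | zero => intro u u' h h' v x hx; rfl
  | succ n ih =>
    intro u u' h h' v x hx
    refine Eq.trans ?_ (ih (h.dirDeriv_const hU _) (h'.dirDeriv_const hU _) _ x hx)
    exact iterDeriv_congr hU (fun y hy => h.dirDeriv_fun_add h' hy _) _ hx

theorem CInfOn.dirDeriv_clm_comp [T2Space H] (L : F →L[ℝ] H) (h : CInfOn u U) (hx : x ∈ U)
    (v : X) : FrechetLie.dirDeriv (fun y => L (u y)) x v = L (FrechetLie.dirDeriv u x v) :=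
  deriv_eq_of_hasDerivAt (HasDerivAt.clm_comp (h.hasDerivAt hx v) L)

theorem CInfOn.iterDeriv_clm_comp [T2Space X] [T2Space F] [LocallyConvexSpace ℝ F] [T2Space H]
    (L : F →L[ℝ] H) (hU : IsOpen U) {n : ℕ} : ∀ {u : X → F}, CInfOn u U → ∀ v : Fin n → X, ∀ x ∈ U,
      FrechetLie.iterDeriv n (fun y => L (u y)) v x = L (FrechetLie.iterDeriv n u v x) := by
  induction n with
  | zero => intro u h v x hx; rfl
  | succ n ih =>
    intro u h v x hx
    refine Eq.trans ?_ (ih (h.dirDeriv_const hU _) _ x hx)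
    exact iterDeriv_congr hU (fun y hy => h.dirDeriv_clm_comp L hy _) _ hx

theorem iterDeriv_comp_clm {n : ℕ} : ∀ (u : X → F) (L : Y →L[ℝ] X) (v : Fin n → Y) (y : Y),
    iterDeriv n (fun z => u (L z)) v y = iterDeriv n u (fun i => L (v i)) (L y) := by
  induction n with
  | zero => intro u L v y; rfl
  | succ n ih =>
    intro u L v y
    have e : (fun z => dirDeriv (fun z => u (L z)) z (v 0)) =
        fun z => (fun y => dirDeriv u y (L (v 0))) (L z) := by
      funext z; simp [dirDeriv]
    show iterDeriv n (fun z => dirDeriv (fun z => u (L z)) z (v 0)) _ y = _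
    rw [e, ih (fun y => dirDeriv u y (L (v 0)))]
    rfl

/-- Iterated derivatives along a list of directions. -/
noncomputable def listDeriv : List X → (X → F) → X → F
  | [], u, x => u x
  | a :: l, u, x => listDeriv l (fun y => dirDeriv u y a) x

theorem iterDeriv_eq_listDeriv {n : ℕ} : ∀ (u : X → F) (v : Fin n → X) (x : X),
    iterDeriv n u v x = listDeriv (List.ofFn v) u x := by
  induction n with
  | zero => intro u v x; simp [iterDeriv, listDeriv]
  | succ n ih => intro u v x; rw [List.ofFn_succ]; exact ih _ _ _

theorem listDeriv_congr [T2Space F] (hU : IsOpen U) {u u' : X → F} (h : EqOn u u' U) (l : List X) :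
    EqOn (listDeriv l u) (listDeriv l u') U := by
  induction l generalizing u u' with
  | nil => exact h
  | cons a l ih =>
    exact ih fun y hy => dirDeriv_congr_of_eventuallyEq (h.eventuallyEq_of_mem (hU.mem_nhds hy)) _

/-- Permutations of lists are generated by exchanges of neighbours, and each exchange is the Schwarz
theorem. Working with lists rather than `Fin`-indexed families makes this induction available. -/
theorem CInfOn.listDeriv_perm [T2Space X] [T2Space F] [LocallyConvexSpace ℝ F] (hU : IsOpen U)
    {l l' : List X} (hl : l.Perm l') {u : X → F} (h : CInfOn u U) (hx : x ∈ U) :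
    listDeriv l u x = listDeriv l' u x := by
  induction hl generalizing u with
  | nil => rfl
  | cons a _ ih => exact ih (h.dirDeriv_const hU a)
  | swap a b l =>
    exact listDeriv_congr hU (fun y hy => h.dirDeriv_comm hU hy b a) l hx
  | trans _ _ ih ih' => exact (ih h).trans (ih' h)

universe uX in
-- Differentiating once turns the direction used into a further parameter, so the induction runs
-- over all parameter spaces and passes from `Y` to `Y × X`. This is why `Y` ranges over the
-- universe of `X`.
theorem CInfOn.continuousOn_iterDeriv {X : Type uX} [AddCommGroup X] [Module ℝ X]
    [TopologicalSpace X] [IsTopologicalAddGroup X] [ContinuousSMul ℝ X] (x : X) {n : ℕ} :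
    ∀ {Y : Type uX} [AddCommGroup Y] [Module ℝ Y] [TopologicalSpace Y] [IsTopologicalAddGroup Y]
      [ContinuousSMul ℝ Y] {u : Y × X → F}
      {U : Set (Y × X)}, CInfOn u U →
      ContinuousOn (fun q : Y × (Fin n → X) =>
        FrechetLie.iterDeriv n (fun x' => u (q.1, x')) q.2 x) {q | (q.1, x) ∈ U} := by
  induction n with
  | zero =>
    intro Y _ _ _ _ _ u U h
    exact h.continuousOn.comp (by fun_prop) fun q hq => hq
  | succ n ih =>
    intro Y _ _ _ _ _ u U h
    -- `L` sends `((y, a), x')` to the base point `(y, x')` and the direction `(0, a)`, so the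
    -- derivative of `u` there is the partial derivative along `a`.
    let L : (Y × X) × X →L[ℝ] (Y × X) × (Y × X) :=
      (((ContinuousLinearMap.fst ℝ Y X).comp (ContinuousLinearMap.fst ℝ (Y × X) X)).prod
        (ContinuousLinearMap.snd ℝ (Y × X) X)).prod
      ((ContinuousLinearMap.inr ℝ Y X).comp
        ((ContinuousLinearMap.snd ℝ Y X).comp (ContinuousLinearMap.fst ℝ (Y × X) X)))
    have h1 : CInfOn (fun q : (Y × X) × X => FrechetLie.dirDeriv u (L q).1 (L q).2)
        (L ⁻¹' (U ×ˢ univ)) := fun m => (h.dirDeriv m).comp_clm L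
    have h2 := ContinuousOn.comp (ih (Y := Y × X) h1) (s := {q : Y × (Fin (n + 1) → X) | (q.1, x) ∈ U})
      (f := fun q : Y × (Fin (n + 1) → X) => ((q.1, q.2 0), fun i : Fin n => q.2 i.succ))
      (by fun_prop) fun q hq => (⟨hq, trivial⟩ : (q.1, x) ∈ U ∧ _)
    refine h2.congr fun q hq => ?_
    have e : ∀ y, FrechetLie.dirDeriv (fun x' => u (q.1, x')) y (q.2 0) =
        FrechetLie.dirDeriv u (q.1, y) (0, q.2 0) := fun y => by simp [FrechetLie.dirDeriv]
    simp only [FrechetLie.iterDeriv, e]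
    rfl

theorem tendsto_finCons (n : ℕ) : Tendsto (fun q : ℝ × (Fin n → ℝ) =>
    (Fin.cons q.1 q.2 : Fin (n + 1) → ℝ)) (𝓝 0 ×ˢ 𝓝 0) (𝓝 0) := by
  rw [← nhds_prod_eq]
  have : Continuous fun q : ℝ × (Fin n → ℝ) => (Fin.cons q.1 q.2 : Fin (n + 1) → ℝ) := by fun_prop
  have h := this.tendsto (0, 0)
  have e : (Fin.cons (0 : ℝ) (0 : Fin n → ℝ) : Fin (n + 1) → ℝ) = 0 := by
    funext i; refine Fin.cases rfl (fun _ => rfl) i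
  rwa [e] at h

/-- The order of the quantifiers matters: the tail is fixed first, and only then does the variable
to be differentiated move. -/
theorem eventually_finCons {n : ℕ} {P : (Fin (n + 1) → ℝ) → Prop} (h : ∀ᶠ t in 𝓝 0, P t) :
    ∀ᶠ t : Fin n → ℝ in 𝓝 0, ∀ᶠ s : ℝ in 𝓝 0, P (Fin.cons s t) := by
  have h1 := (tendsto_finCons n).eventually h
  rw [Filter.prod_comm] at h1
  exact (eventually_map.1 h1).curry

theorem HasMixedPartial.congr {n : ℕ} : ∀ {f f' : (Fin n → ℝ) → F} {w : F},
    HasMixedPartial n f w → f =ᶠ[𝓝 0] f' → HasMixedPartial n f' w := by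
  induction n with
  | zero => intro f f' w h e; exact e.self_of_nhds.symm.trans h
  | succ n ih =>
    rintro f f' w ⟨g, hg, hw⟩ e
    refine ⟨g, ?_, hw⟩
    filter_upwards [hg, eventually_finCons e] with t ht hs
    exact hasDerivAt_congr hs ht

theorem HasMixedPartial.unique [T2Space F] {n : ℕ} : ∀ {f : (Fin n → ℝ) → F} {w w' : F},
    HasMixedPartial n f w → HasMixedPartial n f w' → w = w' := by
  induction n with
  | zero => intro f w w' h h'; exact h.symm.trans h'
  | succ n ih =>
    rintro f w w' ⟨g, hg, hw⟩ ⟨g', hg', hw'⟩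
    refine ih (hw.congr ?_) hw'
    filter_upwards [hg, hg'] with t ht ht'
    exact hasDerivAt_unique ht ht'

theorem tendsto_sum_curves {n : ℕ} (x : X) {α : Fin n → ℝ → X} {v : Fin n → X}
    (h0 : ∀ i, α i 0 = 0) (hα : ∀ i, HasDerivAt (α i) (v i) 0) :
    Tendsto (fun t : Fin n → ℝ => x + ∑ i, α i (t i)) (𝓝 0) (𝓝 x) := by
  have : Tendsto (fun t : Fin n → ℝ => x + ∑ i, α i (t i)) (𝓝 0) (𝓝 (x + ∑ i, α i 0)) := by
    refine tendsto_const_nhds.add (tendsto_finsetSum _ fun i _ => ?_)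
    exact (HasDerivAt.tendsto_zero (hα i)).comp ((continuous_apply i).tendsto 0)
  simpa [h0] using this

/-- Each variable is differentiated at `0` and then set to `0`. The curves `α i` therefore need a
velocity at `0` only, and nothing else about them survives in the value. -/
theorem CInfOn.hasMixedPartial [T2Space X] [T2Space F] [LocallyConvexSpace ℝ F] (hU : IsOpen U)
    (hx : x ∈ U) {n : ℕ} : ∀ {u : X → F} {α : Fin n → ℝ → X} {v : Fin n → X}, CInfOn u U →
      (∀ i, α i 0 = 0) → (∀ i, HasDerivAt (α i) (v i) 0) →
      HasMixedPartial n (fun t => u (x + ∑ i, α i (t i))) (FrechetLie.iterDeriv n u v x) := by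
  induction n with
  | zero => intro u α v h h0 hα; simp [HasMixedPartial, FrechetLie.iterDeriv]
  | succ n ih =>
    intro u α v h h0 hα
    refine ⟨_, ?_, ih (α := fun i => α i.succ) (h.dirDeriv_const hU (v 0)) (fun i => h0 _)
      fun i => hα _⟩
    filter_upwards [(tendsto_sum_curves x (fun i => h0 (Fin.succ i)) fun i => hα _).eventually_mem
      (hU.mem_nhds hx)] with t ht
    have hγ := HasDerivAt.const_add_curve (hα 0) (x + ∑ i, α (Fin.succ i) (t i))
    have := h.hasDerivAt_curve hU (by simpa only [h0, add_zero] using ht) hγ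
    simp only [h0, add_zero] at this
    convert this using 3 with s
    rw [Fin.sum_univ_succ]
    simp only [Fin.cons_zero, Fin.cons_succ]
    abel

end Iterated

/-! ### Smooth functions with values in an abelian Lie group -/

section LieValued

variable {X Y : Type*}
  [AddCommGroup X] [Module ℝ X] [TopologicalSpace X] [IsTopologicalAddGroup X] [ContinuousSMul ℝ X]
  [AddCommGroup Y] [Module ℝ Y] [TopologicalSpace Y] [IsTopologicalAddGroup Y] [ContinuousSMul ℝ Y]
  [T2Space X] [T2Space Y]
variable (F : Type*) {A : Type*}
  [AddCommGroup F] [Module ℝ F] [TopologicalSpace F] [FrechetSpace F]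
  [AddCommGroup A] [TopologicalSpace A] [ChartedSpace F A]

/-- Smoothness on an open set of a locally convex space, with values in a manifold. -/
abbrev SmoothInto (f : X → A) (U : Set X) : Prop :=
  SmoothOn {OpenPartialHomeomorph.refl X} (atlas F A) f U

variable {F} in
theorem SmoothInto.comp {g : Y → A} {f : X → Y} {U : Set X} {V : Set Y} (hU : IsOpen U)
    (hV : IsOpen V) (hg : SmoothInto F g V) (hf : CInfOn f U) (hm : MapsTo f U V) :
    SmoothInto F (fun x => g (f x)) U := by
  refine SmoothOn.comp (ℬ := {OpenPartialHomeomorph.refl Y}) (fun y => ⟨_, rfl, trivial⟩) hU hV hg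
    ⟨hf.continuousOn, ?_⟩ hm
  rintro e rfl e' rfl
  exact hf.mono fun x hx => hx.2.1

variable {F} in
theorem SmoothInto.chart {f : X → A} {U : Set X} (hf : SmoothInto F f U) :
    CInfOn (fun x => chartAt F (0 : A) (f x)) (U ∩ f ⁻¹' (chartAt F (0 : A)).source) :=
  CInfOn.mono (hf.2 _ rfl _ (chart_mem_atlas F 0)) fun _ hx => ⟨trivial, hx⟩

variable {F} in
theorem SmoothInto.isOpen_chart {f : X → A} {U : Set X} (hU : IsOpen U) (hf : SmoothInto F f U) :
    IsOpen (U ∩ f ⁻¹' (chartAt F (0 : A)).source) :=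
  hf.1.isOpen_inter_preimage hU (chartAt F (0 : A)).open_source

variable [FrechetLieAddGroup F A]

theorem isTopologicalAddGroup (F A : Type*) [AddCommGroup F] [Module ℝ F] [TopologicalSpace F]
    [FrechetSpace F] [AddCommGroup A] [TopologicalSpace A] [ChartedSpace F A]
    [FrechetLieAddGroup F A] : IsTopologicalAddGroup A where
  continuous_add := continuousOn_univ.1 (FrechetLieAddGroup.smooth_add (F := F) (A := A)).1
  continuous_neg := continuousOn_univ.1 (FrechetLieAddGroup.smooth_neg (F := F) (A := A)).1

variable {F}

theorem SmoothInto.add {f g : X → A} {U : Set X} (hU : IsOpen U) (hf : SmoothInto F f U)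
    (hg : SmoothInto F g U) : SmoothInto F (fun x => f x + g x) U := by
  refine SmoothOn.comp (g := fun q : A × A => q.1 + q.2) ?_ hU isOpen_univ
    FrechetLieAddGroup.smooth_add (SmoothOn.prodMk hU hf hg) fun _ _ => trivial
  exact fun q => ⟨_, ⟨_, chart_mem_atlas F q.1, _, chart_mem_atlas F q.2, rfl⟩,
    mem_chart_source F q.1, mem_chart_source F q.2⟩

theorem SmoothInto.neg {f : X → A} {U : Set X} (hU : IsOpen U) (hf : SmoothInto F f U) :
    SmoothInto F (fun x => -f x) U :=
  SmoothOn.comp (g := fun a : A => -a) (fun a => ⟨_, chart_mem_atlas F a, mem_chart_source F a⟩)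
    hU isOpen_univ FrechetLieAddGroup.smooth_neg hf fun _ _ => trivial

theorem SmoothInto.sub {f g : X → A} {U : Set X} (hU : IsOpen U) (hf : SmoothInto F f U)
    (hg : SmoothInto F g U) : SmoothInto F (fun x => f x - g x) U := by
  simpa only [sub_eq_add_neg] using hf.add hU (hg.neg hU)

theorem tendsto_chart_zero {a : ℝ → A} (ha : Tendsto a (𝓝 0) (𝓝 0)) :
    ∀ᶠ t in 𝓝 0, a t ∈ (chartAt F (0 : A)).source :=
  ha ((chartAt F (0 : A)).open_source.mem_nhds (mem_chart_source F 0))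

/-- Velocities at `0` of curves through `0` in `A` add up. -/
theorem hasDerivAt_chart_add {a b : ℝ → A} (ha : Tendsto a (𝓝 0) (𝓝 0))
    (hb : Tendsto b (𝓝 0) (𝓝 0)) (ha0 : a 0 = 0) (hb0 : b 0 = 0) {v w : F}
    (hv : HasDerivAt (fun t => chartAt F (0 : A) (a t)) v 0)
    (hw : HasDerivAt (fun t => chartAt F (0 : A) (b t)) w 0) :
    HasDerivAt (fun t => chartAt F (0 : A) (a t + b t)) (v + w) 0 := by
  set e := chartAt F (0 : A) with he
  have h0 : (0 : A) ∈ e.source := mem_chart_source F 0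
  have := isTopologicalAddGroup F A
  have hO : IsOpen ((e.prod e).target ∩ (e.prod e).symm ⁻¹'
      (univ ∩ (fun q : A × A => q.1 + q.2) ⁻¹' e.source)) :=
    (e.prod e).symm.isOpen_inter_preimage
      (isOpen_univ.inter (e.open_source.preimage continuous_add))
  have hm := (FrechetLieAddGroup.smooth_add (F := F) (A := A)).2 (e.prod e)
    ⟨_, chart_mem_atlas F 0, _, chart_mem_atlas F 0, rfl⟩ e (chart_mem_atlas F 0)
  set O := (e.prod e).target ∩ (e.prod e).symm ⁻¹'
      (univ ∩ (fun q : A × A => q.1 + q.2) ⁻¹' e.source) with hOdef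
  have hmem : (e 0, e 0) ∈ O := by
    refine ⟨⟨e.map_source h0, e.map_source h0⟩, trivial, ?_⟩
    simp [e.left_inv h0, h0]
  have h1 := hm.hasDerivAt_curve hO (γ := fun t => (e (a t), e (b t)))
    (by simpa [ha0, hb0] using hmem) (hasDerivAt_prodMk hv hw)
  simp only [ha0, hb0] at h1
  -- Restricted to either axis, addition is the identity in the chart; additivity of the derivative
  -- then gives the value `v + w` on `(v, w)`.
  have hone : ∀ v : F, dirDeriv (e ∘ (fun q : A × A => q.1 + q.2) ∘ (e.prod e).symm) (e 0, e 0)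
      (v, 0) = v ∧ dirDeriv (e ∘ (fun q : A × A => q.1 + q.2) ∘ (e.prod e).symm) (e 0, e 0)
      (0, v) = v := by
    intro v
    have hev := (tendsto_line (e 0) v).eventually (e.open_target.mem_nhds (e.map_source h0))
    constructor
    all_goals
      refine deriv_eq_of_hasDerivAt (hasDerivAt_congr ?_ (hasDerivAt_line (e 0) v 0))
      filter_upwards [hev] with t ht
      simp [e.left_inv h0, e.right_inv ht]
  rw [show (v, w) = (v, (0 : F)) + (0, w) by simp, hm.dirDeriv_add hO hmem, (hone v).1,
    (hone w).2] at h1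
  refine hasDerivAt_congr ?_ h1
  filter_upwards [tendsto_chart_zero (F := F) ha, tendsto_chart_zero (F := F) hb] with t hat hbt
  simp [e.left_inv hat, e.left_inv hbt]

theorem hasDerivAt_chart_neg {a : ℝ → A} (ha : Tendsto a (𝓝 0) (𝓝 0)) (ha0 : a 0 = 0) {v : F}
    (hv : HasDerivAt (fun t => chartAt F (0 : A) (a t)) v 0) :
    HasDerivAt (fun t => chartAt F (0 : A) (-a t)) (-v) 0 := by
  set e := chartAt F (0 : A) with he
  have h0 : (0 : A) ∈ e.source := mem_chart_source F 0
  have := isTopologicalAddGroup F A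
  have hO : IsOpen (e.target ∩ e.symm ⁻¹' (univ ∩ (fun q : A => -q) ⁻¹' e.source)) :=
    e.symm.isOpen_inter_preimage (isOpen_univ.inter (e.open_source.preimage continuous_neg))
  have hm := (FrechetLieAddGroup.smooth_neg (F := F) (A := A)).2 e (chart_mem_atlas F 0) e
    (chart_mem_atlas F 0)
  have h1 := hm.hasDerivAt_curve hO (γ := fun t => e (a t))
    (by simp [ha0, h0, e.left_inv h0, e.map_source h0]) hv
  have h2 : HasDerivAt (fun t => e (-a t))
      (dirDeriv (e ∘ (fun q : A => -q) ∘ e.symm) (e (a 0)) v) 0 := by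
    refine hasDerivAt_congr ?_ h1
    filter_upwards [tendsto_chart_zero (F := F) ha] with t hat
    simp [e.left_inv hat]
  have hna : Tendsto (fun t => -a t) (𝓝 0) (𝓝 0) := by simpa using ha.neg
  have h3 := hasDerivAt_chart_add ha hna ha0 (by simp [ha0]) hv h2
  -- The velocity of `-a` exists by smoothness of negation; it is identified by differentiating the
  -- constant curve `a + (-a)`.
  have h4 : v + dirDeriv (e ∘ (fun q : A => -q) ∘ e.symm) (e (a 0)) v = 0 := by
    refine hasDerivAt_unique h3 ?_
    simp [hasDerivAt_iff_slope]
  rwa [← neg_eq_of_add_eq_zero_right h4] at h2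

variable (F) in
/-- The derivative of an `A`-valued function, translated back to the tangent space at `0`. -/
noncomputable def mcDeriv (f : X → A) (x v : X) : F :=
  deriv (fun t : ℝ => chartAt F (0 : A) (f (x + t • v) - f x)) 0

/-- Differences of values lie in the chart domain at `0` as long as the two points are close, so a
single smooth `F`-valued function near the diagonal encodes all translated derivatives. -/
theorem SmoothInto.difference {f : X → A} {U : Set X} (hU : IsOpen U) (hf : SmoothInto F f U) :
    ∃ W : Set (X × X), IsOpen W ∧ (∀ x ∈ U, (x, x) ∈ W) ∧ (∀ p ∈ W, p.1 ∈ U ∧ p.2 ∈ U) ∧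
      CInfOn (fun p : X × X => chartAt F (0 : A) (f p.2 - f p.1)) W := by
  have h1 : SmoothInto F (fun p : X × X => f p.1) (U ×ˢ U) :=
    SmoothInto.comp (hU.prod hU) hU hf (cInfOn_clm (ContinuousLinearMap.fst ℝ X X) _)
      fun p hp => hp.1
  have h2 : SmoothInto F (fun p : X × X => f p.2) (U ×ˢ U) :=
    SmoothInto.comp (hU.prod hU) hU hf (cInfOn_clm (ContinuousLinearMap.snd ℝ X X) _)
      fun p hp => hp.2
  have h3 := h2.sub (hU.prod hU) h1
  exact ⟨_, h3.isOpen_chart (hU.prod hU), fun x hx => ⟨⟨hx, hx⟩, by simp⟩,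
    fun p hp => hp.1, h3.chart⟩

theorem SmoothInto.mcDeriv {f : X → A} {U : Set X} (hU : IsOpen U) (hf : SmoothInto F f U) :
    CInfOn (fun p : X × X => FrechetLie.mcDeriv F f p.1 p.2) (U ×ˢ univ) := by
  obtain ⟨W, hW, hUW, -, h⟩ := hf.difference hU
  -- `L (x, v)` is the diagonal point `(x, x)` with the direction `(0, v)`: only the second argument
  -- of the difference moves.
  let L : X × X →L[ℝ] (X × X) × (X × X) :=
    ((ContinuousLinearMap.fst ℝ X X).prod (ContinuousLinearMap.fst ℝ X X)).prod
      ((ContinuousLinearMap.inr ℝ X X).comp (ContinuousLinearMap.snd ℝ X X))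
  have h1 : CInfOn (fun q : X × X => dirDeriv (fun p : X × X => chartAt F (0 : A) (f p.2 - f p.1))
      (L q).1 (L q).2) (L ⁻¹' (W ×ˢ univ)) := fun m => (h.dirDeriv m).comp_clm L
  have e : (fun q : X × X => dirDeriv (fun p : X × X => chartAt F (0 : A) (f p.2 - f p.1))
      (L q).1 (L q).2) = fun p : X × X => FrechetLie.mcDeriv F f p.1 p.2 := by
    funext q
    simp [dirDeriv, FrechetLie.mcDeriv, L]
  rw [e] at h1
  exact h1.mono fun q hq => ⟨hUW q.1 hq.1, trivial⟩

theorem SmoothInto.mcDeriv_const {f : X → A} {U : Set X} (hU : IsOpen U) (hf : SmoothInto F f U)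
    (v : X) : CInfOn (fun x => FrechetLie.mcDeriv F f x v) U :=
  (CInfOn.comp_prodMk_const (hU.prod isOpen_univ) (hf.mcDeriv hU) v).mono fun _ hx => ⟨hx, trivial⟩

/-- For a fixed base point the translated derivative is the ordinary derivative of a smooth
`F`-valued function, from which linearity in the direction is inherited. -/
theorem SmoothInto.difference_const {f : X → A} {U : Set X} (hU : IsOpen U)
    (hf : SmoothInto F f U) {x : X} (hx : x ∈ U) :
    ∃ V : Set X, IsOpen V ∧ x ∈ V ∧ CInfOn (fun y => chartAt F (0 : A) (f y - f x)) V ∧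
      ∀ v, FrechetLie.mcDeriv F f x v = dirDeriv (fun y => chartAt F (0 : A) (f y - f x)) x v := by
  have := isTopologicalAddGroup F A
  have h : SmoothInto F (fun y => f y - f x) U := hf.sub hU (smoothOn_const _ _)
  exact ⟨_, h.isOpen_chart hU, ⟨hx, by simp⟩, h.chart, fun v => rfl⟩

theorem SmoothInto.hasDerivAt_curve {f : X → A} {U : Set X} (hU : IsOpen U)
    (hf : SmoothInto F f U) {γ : ℝ → X} {w : X} (h0 : γ 0 ∈ U) (hγ : HasDerivAt γ w 0) :
    HasDerivAt (fun t => chartAt F (0 : A) (f (γ t) - f (γ 0)))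
      (FrechetLie.mcDeriv F f (γ 0) w) 0 := by
  obtain ⟨V, hV, hxV, h, e⟩ := hf.difference_const hU h0
  rw [e]
  exact h.hasDerivAt_curve hV hxV hγ

theorem SmoothInto.mcDeriv_add {f : X → A} {U : Set X} (hU : IsOpen U) (hf : SmoothInto F f U)
    {x : X} (hx : x ∈ U) (v w : X) : FrechetLie.mcDeriv F f x (v + w) =
      FrechetLie.mcDeriv F f x v + FrechetLie.mcDeriv F f x w := by
  obtain ⟨V, hV, hxV, h, e⟩ := hf.difference_const hU hx
  simp only [e]
  exact h.dirDeriv_add hV hxV v w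

theorem SmoothInto.tendsto_sub {f : X → A} {U : Set X} (hU : IsOpen U) (hf : SmoothInto F f U)
    {x : X} (hx : x ∈ U) (v : X) : Tendsto (fun t : ℝ => f (x + t • v) - f x) (𝓝 0) (𝓝 0) := by
  have := isTopologicalAddGroup F A
  have h := ((hf.1.continuousAt (hU.mem_nhds hx)).tendsto.comp (tendsto_line x v)).sub_const (f x)
  simpa using h

theorem SmoothInto.hasDerivAt_sub {f : X → A} {U : Set X} (hU : IsOpen U) (hf : SmoothInto F f U)
    {x : X} (hx : x ∈ U) (v : X) :
    HasDerivAt (fun t : ℝ => chartAt F (0 : A) (f (x + t • v) - f x))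
      (FrechetLie.mcDeriv F f x v) 0 := by
  simpa using hf.hasDerivAt_curve hU (γ := fun t => x + t • v) (by simpa using hx)
    (hasDerivAt_line x v 0)

theorem SmoothInto.mcDeriv_fun_add {f g : X → A} {U : Set X} (hU : IsOpen U)
    (hf : SmoothInto F f U) (hg : SmoothInto F g U) {x : X} (hx : x ∈ U) (v : X) :
    FrechetLie.mcDeriv F (fun y => f y + g y) x v =
      FrechetLie.mcDeriv F f x v + FrechetLie.mcDeriv F g x v := by
  have := hasDerivAt_chart_add (hf.tendsto_sub hU hx v) (hg.tendsto_sub hU hx v) (by simp)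
    (by simp) (hf.hasDerivAt_sub hU hx v) (hg.hasDerivAt_sub hU hx v)
  refine deriv_eq_of_hasDerivAt ?_
  simpa only [add_sub_add_comm] using this

theorem SmoothInto.mcDeriv_fun_neg {f : X → A} {U : Set X} (hU : IsOpen U)
    (hf : SmoothInto F f U) {x : X} (hx : x ∈ U) (v : X) :
    FrechetLie.mcDeriv F (fun y => -f y) x v = -FrechetLie.mcDeriv F f x v := by
  have := hasDerivAt_chart_neg (hf.tendsto_sub hU hx v) (by simp) (hf.hasDerivAt_sub hU hx v)
  refine deriv_eq_of_hasDerivAt ?_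
  simpa only [neg_sub_neg, neg_sub] using this

/-- The double increment `k (r, s)` of `f` over the parallelogram with sides `r • v` and `s • w`
takes values near `0` in `A` and vanishes on both axes. The second difference of its chart
expression thus reduces to one corner value minus the coordinates of `0`, which need not vanish. -/
theorem SmoothInto.tendsto_second_difference [LocallyConvexSpace ℝ X] {f : X → A} {U : Set X} (hU : IsOpen U)
    (hf : SmoothInto F f U) {x : X} (hx : x ∈ U) (v w : X) :
    Tendsto (fun t : ℝ => t⁻¹ • t⁻¹ • (chartAt F (0 : A) (f (x + t • v + t • w) - f (x + t • w) -
      (f (x + t • v) - f x)) - chartAt F (0 : A) 0)) (𝓝[≠] 0)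
      (𝓝 (dirDeriv (fun y => FrechetLie.mcDeriv F f y v) x w)) := by
  have aff : ∀ L : ℝ × ℝ →L[ℝ] X, CInfOn (fun q => x + L q) univ := fun L =>
    (cInfOn_const x _).add isOpen_univ (cInfOn_clm L _)
  have pull : ∀ L : ℝ × ℝ →L[ℝ] X, IsOpen ((fun q => x + L q) ⁻¹' U) ∧
      SmoothInto F (fun q => f (x + L q)) ((fun q => x + L q) ⁻¹' U) := fun L =>
    have ho : IsOpen ((fun q => x + L q) ⁻¹' U) := hU.preimage (by fun_prop)
    ⟨ho, SmoothInto.comp ho hU hf ((aff L).mono (subset_univ _)) fun _ hq => hq⟩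
  let L₁ : ℝ × ℝ →L[ℝ] X := (ContinuousLinearMap.fst ℝ ℝ ℝ).smulRight v
  let L₂ : ℝ × ℝ →L[ℝ] X := (ContinuousLinearMap.snd ℝ ℝ ℝ).smulRight w
  obtain ⟨o₁, s₁⟩ := pull L₁
  obtain ⟨o₂, s₂⟩ := pull L₂
  obtain ⟨o₃, s₃⟩ := pull (L₁ + L₂)
  set O := ((fun q => x + L₁ q) ⁻¹' U) ∩ ((fun q => x + L₂ q) ⁻¹' U) ∩
    ((fun q => x + (L₁ + L₂) q) ⁻¹' U) with hO
  have oO : IsOpen O := (o₁.inter o₂).inter o₃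
  set k : ℝ × ℝ → A := fun q => f (x + (L₁ + L₂) q) - f (x + L₂ q) - (f (x + L₁ q) - f x) with hk
  have sk : SmoothInto F k O :=
    SmoothInto.sub oO
      (SmoothInto.sub oO (SmoothOn.mono s₃ inter_subset_right)
        (SmoothOn.mono s₂ (inter_subset_left.trans inter_subset_right)))
      (SmoothInto.sub oO (SmoothOn.mono s₁ (inter_subset_left.trans inter_subset_left))
        (smoothOn_const _ _))
  have k0 : ∀ t, k (t, 0) = 0 ∧ k (0, t) = 0 := fun t => by simp [hk, L₁, L₂]
  have hmem : (0 : ℝ × ℝ) ∈ O ∩ k ⁻¹' (chartAt F (0 : A)).source := by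
    refine ⟨by simp [hO, hx], ?_⟩
    have := (k0 0).1
    simp only [mem_preimage]
    rw [show (0 : ℝ × ℝ) = (0, 0) from rfl, this]
    simp
  have hlim := sk.chart.tendsto_second_difference (sk.isOpen_chart oO) hmem (1, 0) (0, 1)
  -- At `(0, t)` the curve `r ↦ k (r, t)` is the difference of the increments of `f` along `v` from
  -- `x + t • w` and from `x`. Its velocity is the corresponding difference of `mcDeriv`, which is
  -- then differentiated in `t`.
  have hval : dirDeriv (fun y => dirDeriv (fun q => chartAt F (0 : A) (k q)) y (1, 0)) 0 (0, 1) =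
      dirDeriv (fun y => FrechetLie.mcDeriv F f y v) x w := by
    have hd := (hf.mcDeriv_const hU v).hasDerivAt hx w
    refine deriv_eq_of_hasDerivAt (hasDerivAt_congr ?_ (HasDerivAt.const_add_curve hd
      (-FrechetLie.mcDeriv F f x v)))
    filter_upwards [(tendsto_line x w).eventually_mem (hU.mem_nhds hx)] with t ht
    have h1 := hasDerivAt_chart_add (hf.tendsto_sub hU ht v)
      (a := fun s : ℝ => f (x + t • w + s • v) - f (x + t • w))
      (b := fun s : ℝ => -(f (x + s • v) - f x))
      (by have := isTopologicalAddGroup F A; simpa using (hf.tendsto_sub hU hx v).neg)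
      (by simp) (by simp) (hf.hasDerivAt_sub hU ht v)
      (hasDerivAt_chart_neg (hf.tendsto_sub hU hx v) (by simp) (hf.hasDerivAt_sub hU hx v))
    rw [add_comm (FrechetLie.mcDeriv F f _ v)] at h1
    refine (deriv_eq_of_hasDerivAt (hasDerivAt_congr (Eventually.of_forall fun s => ?_) h1)).symm
    simp only [hk, L₁, L₂]
    simp [sub_eq_add_neg, add_assoc, add_comm (t • w)]
  rw [hval] at hlim
  refine hlim.congr fun t => ?_
  have e1 : k (t, 0) = 0 := (k0 t).1
  have e2 : k (0, t) = 0 := (k0 t).2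
  have e3 : k (0, 0) = 0 := (k0 0).1
  have e4 : k (t, t) = f (x + t • v + t • w) - f (x + t • w) - (f (x + t • v) - f x) := by
    simp [hk, L₁, L₂, add_assoc]
  have e5 : k 0 = 0 := e3
  simp only [Prod.smul_mk, smul_eq_mul, mul_one, mul_zero, zero_add, Prod.mk_add_mk, add_zero, e1,
    e2, e4, e5, sub_self, sub_zero]

/-- The one-form `mcDeriv F f` is closed. -/
theorem SmoothInto.dirDeriv_mcDeriv_comm [LocallyConvexSpace ℝ X] {f : X → A} {U : Set X} (hU : IsOpen U)
    (hf : SmoothInto F f U) {x : X} (hx : x ∈ U) (v w : X) :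
    dirDeriv (fun y => FrechetLie.mcDeriv F f y v) x w =
      dirDeriv (fun y => FrechetLie.mcDeriv F f y w) x v := by
  refine tendsto_nhds_unique (hf.tendsto_second_difference hU hx v w)
    ((hf.tendsto_second_difference hU hx w v).congr fun t => ?_)
  rw [add_right_comm x (t • w), sub_sub_sub_comm]

end LieValued

/-! ### Iterated derivatives of functions with values in an abelian Lie group -/

section LieIterated

variable {X Y : Type*}
  [AddCommGroup X] [Module ℝ X] [TopologicalSpace X] [IsTopologicalAddGroup X] [ContinuousSMul ℝ X]
  [AddCommGroup Y] [Module ℝ Y] [TopologicalSpace Y] [IsTopologicalAddGroup Y] [ContinuousSMul ℝ Y]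
  [T2Space X] [T2Space Y]
variable (F : Type*) {A : Type*}
  [AddCommGroup F] [Module ℝ F] [TopologicalSpace F] [FrechetSpace F]
  [AddCommGroup A] [TopologicalSpace A] [ChartedSpace F A]

/-- The iterated derivative `∂_{v_n} ⋯ ∂_{v_0} f` of an `A`-valued function. -/
noncomputable def mcIter (n : ℕ) (f : X → A) (v : Fin (n + 1) → X) (x : X) : F :=
  iterDeriv n (fun y => mcDeriv F f y (v 0)) (fun i => v i.succ) x

/-- Iterated derivatives of an `A`-valued function along a list of directions. -/
noncomputable def mcList (f : X → A) (x : X) : List X → F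
  -- A default value: `mcIter` always uses at least one direction.
  | [] => 0
  | a :: l => listDeriv l (fun y => mcDeriv F f y a) x

theorem mcIter_eq_mcList (n : ℕ) (f : X → A) (v : Fin (n + 1) → X) (x : X) :
    mcIter F n f v x = mcList F f x (List.ofFn v) := by
  rw [List.ofFn_succ]
  exact iterDeriv_eq_listDeriv _ _ _

variable {F}

theorem mcDeriv_congr {f g : X → A} {U : Set X} (hU : IsOpen U) (h : EqOn f g U) {x : X}
    (hx : x ∈ U) (v : X) : mcDeriv F f x v = mcDeriv F g x v := by
  refine deriv_congr_of_eventuallyEq ?_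
  filter_upwards [(tendsto_line x v).eventually_mem (hU.mem_nhds hx)] with t ht
  rw [h ht, h hx]

theorem mcIter_congr {n : ℕ} {f g : X → A} {U : Set X} (hU : IsOpen U) (h : EqOn f g U) {x : X}
    (hx : x ∈ U) (v : Fin (n + 1) → X) : mcIter F n f v x = mcIter F n g v x :=
  iterDeriv_congr hU (fun _ hy => mcDeriv_congr hU h hy _) _ hx

theorem mcIter_comp_clm (n : ℕ) (f : X → A) (L : Y →L[ℝ] X) (v : Fin (n + 1) → Y) (y : Y) :
    mcIter F n (fun z => f (L z)) v y = mcIter F n f (fun i => L (v i)) (L y) := by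
  have e : (fun z => mcDeriv F (fun z => f (L z)) z (v 0)) =
      fun z => (fun y => mcDeriv F f y (L (v 0))) (L z) := by
    funext z; simp [mcDeriv]
  rw [mcIter, e]
  exact iterDeriv_comp_clm (fun y => mcDeriv F f y (L (v 0))) L _ y

theorem HasMixedPartialLie.congr {n : ℕ} {f f' : (Fin (n + 1) → ℝ) → A} {w : F}
    (h : HasMixedPartialLie n f w) (e : f =ᶠ[𝓝 0] f') : HasMixedPartialLie n f' w := by
  obtain ⟨g, hg, hw⟩ := h
  refine ⟨g, ?_, hw⟩
  filter_upwards [hg, eventually_finCons e] with t ht hs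
  refine hasDerivAt_congr ?_ ht
  have h0 := hs.self_of_nhds
  filter_upwards [hs] with s hs
  rw [hs, h0]

theorem HasMixedPartialLie.unique {n : ℕ} {f : (Fin (n + 1) → ℝ) → A} {w w' : F}
    (h : HasMixedPartialLie n f w) (h' : HasMixedPartialLie n f w') : w = w' := by
  obtain ⟨g, hg, hw⟩ := h
  obtain ⟨g', hg', hw'⟩ := h'
  refine (hw.congr ?_).unique hw'
  filter_upwards [hg, hg'] with t ht ht'
  exact hasDerivAt_unique ht ht'

variable [FrechetLieAddGroup F A] {f g : X → A} {U : Set X} {x : X}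

theorem SmoothInto.mcDeriv_smul (hU : IsOpen U) (hf : SmoothInto F f U) (hx : x ∈ U) (r : ℝ)
    (v : X) : FrechetLie.mcDeriv F f x (r • v) = r • FrechetLie.mcDeriv F f x v := by
  obtain ⟨V, hV, hxV, h, e⟩ := hf.difference_const hU hx
  simp only [e]
  exact h.dirDeriv_smul hV hxV r v

theorem SmoothInto.mcIter_fun_add {n : ℕ} (hU : IsOpen U) (hf : SmoothInto F f U)
    (hg : SmoothInto F g U) (hx : x ∈ U) (v : Fin (n + 1) → X) :
    mcIter F n (fun y => f y + g y) v x = mcIter F n f v x + mcIter F n g v x :=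
  (iterDeriv_congr hU (fun _ hy => hf.mcDeriv_fun_add hU hg hy _) _ hx).trans
    (CInfOn.iterDeriv_add hU (hf.mcDeriv_const hU _) (hg.mcDeriv_const hU _) _ x hx)

theorem SmoothInto.mcIter_fun_neg {n : ℕ} (hU : IsOpen U) (hf : SmoothInto F f U) (hx : x ∈ U)
    (v : Fin (n + 1) → X) : mcIter F n (fun y => -f y) v x = -mcIter F n f v x :=
  (iterDeriv_congr hU (fun _ hy => hf.mcDeriv_fun_neg hU hy _) _ hx).trans
    (CInfOn.iterDeriv_clm_comp (-ContinuousLinearMap.id ℝ F) hU (hf.mcDeriv_const hU _) _ x hx)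

/-- By additivity the derivative of the zero function equals twice itself. A constant has the same
increments as zero. -/
theorem mcIter_const (n : ℕ) (c : A) (v : Fin (n + 1) → X) (x : X) :
    mcIter F n (fun _ => c) v x = 0 := by
  have h := SmoothInto.mcIter_fun_add (F := F) (x := x) isOpen_univ (smoothOn_const (0 : A) univ)
    (smoothOn_const c univ) trivial v
  have h' := SmoothInto.mcIter_fun_add (F := F) (x := x) isOpen_univ (smoothOn_const (0 : A) univ)
    (smoothOn_const 0 univ) trivial v
  simp only [add_zero, zero_add, left_eq_add, right_eq_add] at h h'
  have hc : mcIter F n (fun _ : X => c) v x = mcIter F n (fun _ : X => (0 : A)) v x := by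
    simp only [mcIter, mcDeriv, sub_self]
  rw [hc, h']

theorem SmoothInto.zsmul {z : ℤ} (hz : z = 1 ∨ z = -1) (hU : IsOpen U) (hf : SmoothInto F f U) :
    SmoothInto F (fun y => z • f y) U := by
  rcases hz with rfl | rfl
  · simpa using hf
  · simpa using hf.neg hU

theorem SmoothInto.mcIter_zsmul {n : ℕ} {z : ℤ} (hz : z = 1 ∨ z = -1) (hU : IsOpen U)
    (hf : SmoothInto F f U) (hx : x ∈ U) (v : Fin (n + 1) → X) :
    mcIter F n (fun y => z • f y) v x = z • mcIter F n f v x := by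
  rcases hz with rfl | rfl
  · simp
  · simpa using hf.mcIter_fun_neg hU hx v

theorem SmoothInto.sum {ι : Type*} (s : Finset ι) {f : ι → X → A} (hU : IsOpen U)
    (hf : ∀ i ∈ s, SmoothInto F (f i) U) : SmoothInto F (fun y => ∑ i ∈ s, f i y) U := by
  classical
  induction s using Finset.induction_on with
  | empty => simpa using smoothOn_const 0 U
  | insert a s ha ih =>
    simp only [Finset.sum_insert ha]
    exact SmoothInto.add hU (hf a (by simp)) (ih fun i hi => hf i (by simp [hi]))

theorem SmoothInto.mcIter_sum {ι : Type*} (s : Finset ι) {n : ℕ} {f : ι → X → A} (hU : IsOpen U)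
    (hf : ∀ i ∈ s, SmoothInto F (f i) U) (hx : x ∈ U) (v : Fin (n + 1) → X) :
    mcIter F n (fun y => ∑ i ∈ s, f i y) v x = ∑ i ∈ s, mcIter F n (f i) v x := by
  classical
  induction s using Finset.induction_on with
  | empty => simpa using mcIter_const n (0 : A) v x
  | insert a s ha ih =>
    simp only [Finset.sum_insert ha]
    have hs : ∀ i ∈ s, SmoothInto F (f i) U := fun i hi => hf i (by simp [hi])
    rw [SmoothInto.mcIter_fun_add hU (hf a (by simp)) (SmoothInto.sum s hU hs) hx, ih hs]

section Symmetry

variable [LocallyConvexSpace ℝ X]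

/-- An exchange that involves the first, translated derivative is closedness of the one-form
`mcDeriv`; behind the first place everything is `F`-valued and the Schwarz theorem applies. -/
theorem SmoothInto.mcList_perm (hU : IsOpen U) (hf : SmoothInto F f U) (hx : x ∈ U) {l l' : List X}
    (hl : l.Perm l') : mcList F f x l = mcList F f x l' := by
  induction hl with
  | nil => rfl
  | cons a h _ => exact CInfOn.listDeriv_perm hU h (hf.mcDeriv_const hU a) hx
  | swap a b l => exact listDeriv_congr hU (fun y hy => hf.dirDeriv_mcDeriv_comm hU hy b a) l hx
  | trans _ _ ih ih' => exact ih.trans ih'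

theorem SmoothInto.mcIter_perm {n : ℕ} (hU : IsOpen U) (hf : SmoothInto F f U) (hx : x ∈ U)
    (v : Fin (n + 1) → X) (σ : Equiv.Perm (Fin (n + 1))) :
    mcIter F n f (fun i => v (σ i)) x = mcIter F n f v x := by
  rw [mcIter_eq_mcList, mcIter_eq_mcList]
  exact hf.mcList_perm hU hx (Equiv.Perm.ofFn_comp_perm σ v)

/-- Any of the derivatives may be taken first. -/
theorem SmoothInto.mcIter_first {n : ℕ} (hU : IsOpen U) (hf : SmoothInto F f U) (hx : x ∈ U)
    (v : Fin (n + 1) → X) (i : Fin (n + 1)) :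
    mcIter F n f v x =
      iterDeriv n (fun y => FrechetLie.mcDeriv F f y (v i)) (fun j => v (i.succAbove j)) x := by
  rw [← hf.mcIter_perm hU hx v i.cycleRange.symm, mcIter]
  simp

/-- The instance of decidable equality is arbitrary because the axioms of a multilinear map quantify
over it. -/
theorem SmoothInto.mcIter_update {n : ℕ} (hU : IsOpen U) (hf : SmoothInto F f U) (hx : x ∈ U)
    [DecidableEq (Fin (n + 1))] (v : Fin (n + 1) → X) (i : Fin (n + 1)) (a : X) :
    mcIter F n f (Function.update v i a) x =
      iterDeriv n (fun y => FrechetLie.mcDeriv F f y a) (fun j => v (i.succAbove j)) x := by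
  rw [hf.mcIter_first hU hx _ i]
  simp

/-- The first direction plays the role of the parameter in `CInfOn.continuousOn_iterDeriv`. -/
theorem SmoothInto.continuous_mcIter {n : ℕ} (hf : SmoothInto F f U)
    (hU : IsOpen U) (hx : x ∈ U) : Continuous fun v : Fin (n + 1) → X => mcIter F n f v x := by
  have h1 : CInfOn (fun p : X × X => FrechetLie.mcDeriv F f p.2 p.1) (univ ×ˢ U) :=
    fun m => ((hf.mcDeriv hU m).comp_clm
      ((ContinuousLinearMap.snd ℝ X X).prod (ContinuousLinearMap.fst ℝ X X))).mono
        fun p hp => ⟨hp.2, trivial⟩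
  have h2 := CInfOn.continuousOn_iterDeriv x (n := n) h1
  have he : {q : X × (Fin n → X) | (q.1, x) ∈ (univ : Set X) ×ˢ U} = univ :=
    eq_univ_of_forall fun q => ⟨trivial, hx⟩
  rw [he, continuousOn_univ] at h2
  exact h2.comp (f := fun v : Fin (n + 1) → X => (v 0, fun i : Fin n => v i.succ)) (by fun_prop)

/-- The iterated derivative at a point as a continuous multilinear map of the directions. -/
noncomputable def SmoothInto.mcMultilinear (n : ℕ) (hf : SmoothInto F f U)
    (hU : IsOpen U) (hx : x ∈ U) : ContinuousMultilinearMap ℝ (fun _ : Fin (n + 1) => X) F where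
  toFun v := mcIter F n f v x
  map_update_add' v i a b := by
    -- With the varied direction moved to the front, linearity in any slot reduces to linearity of
    -- `mcDeriv` in its direction.
    simp only [hf.mcIter_update hU hx]
    exact (iterDeriv_congr hU (fun _ hy => hf.mcDeriv_add hU hy a b) _ hx).trans
      (CInfOn.iterDeriv_add hU (hf.mcDeriv_const hU _) (hf.mcDeriv_const hU _) _ x hx)
  map_update_smul' v i r a := by
    simp only [hf.mcIter_update hU hx]
    exact (iterDeriv_congr hU (fun _ hy => hf.mcDeriv_smul hU hy r a) _ hx).trans
      (CInfOn.iterDeriv_clm_comp (r • ContinuousLinearMap.id ℝ F) hU (hf.mcDeriv_const hU _) _ x hx)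
  cont := hf.continuous_mcIter hU hx

end Symmetry

/-- As for `CInfOn.hasMixedPartial`, only the velocities at `0` enter; after the first, translated
derivative the vector-valued statement takes over. -/
theorem SmoothInto.hasMixedPartialLie {n : ℕ} (hU : IsOpen U) (hf : SmoothInto F f U) (hx : x ∈ U)
    {α : Fin (n + 1) → ℝ → X} {v : Fin (n + 1) → X} (h0 : ∀ i, α i 0 = 0)
    (hα : ∀ i, HasDerivAt (α i) (v i) 0) :
    HasMixedPartialLie n (fun t => f (x + ∑ i, α i (t i))) (mcIter F n f v x) := by
  refine ⟨_, ?_, CInfOn.hasMixedPartial hU hx (α := fun i => α i.succ)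
    (hf.mcDeriv_const hU (v 0)) (fun i => h0 _) fun i => hα _⟩
  filter_upwards [(tendsto_sum_curves x (fun i => h0 (Fin.succ i)) fun i => hα _).eventually_mem
    (hU.mem_nhds hx)] with t ht
  have hγ := HasDerivAt.const_add_curve (hα 0) (x + ∑ i, α (Fin.succ i) (t i))
  have := hf.hasDerivAt_curve hU (by simpa only [h0, add_zero] using ht) hγ
  simp only [h0, add_zero] at this
  convert this using 4 with s
  · rw [Fin.sum_univ_succ]
    simp only [Fin.cons_zero, Fin.cons_succ]
    congr 1
    abel
  · rw [Fin.sum_univ_succ]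
    simp only [Fin.cons_zero, Fin.cons_succ, h0, zero_add]

/-- Smooth homomorphisms of abelian Lie groups intertwine the translated derivatives. -/
theorem SmoothInto.mcDeriv_hom {F₁ A₁ : Type*} [AddCommGroup F₁] [Module ℝ F₁]
    [TopologicalSpace F₁] [FrechetSpace F₁] [AddCommGroup A₁] [TopologicalSpace A₁]
    [ChartedSpace F₁ A₁] [FrechetLieAddGroup F₁ A₁] (h : A →+ A₁)
    (hh : SmoothOn (atlas F A) (atlas F₁ A₁) h univ) (hU : IsOpen U) (hf : SmoothInto F f U)
    (hx : x ∈ U) (v : X) :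
    FrechetLie.mcDeriv F₁ (fun y => h (f y)) x v =
      tangentMapAt F F₁ h 0 (FrechetLie.mcDeriv F f x v) := by
  set e := chartAt F (0 : A) with he
  set e₁ := chartAt F₁ (0 : A₁) with he₁
  have h0 : (0 : A) ∈ e.source := mem_chart_source F 0
  have hO := isOpen_chartDomain isOpen_univ hh.1 e e₁
  have hm := hh.2 e (chart_mem_atlas F 0) e₁ (chart_mem_atlas F₁ 0)
  have h1 := hm.hasDerivAt_curve hO (γ := fun t : ℝ => e (f (x + t • v) - f x))
    (by simp [e.left_inv h0, e.map_source h0, he₁]) (hf.hasDerivAt_sub hU hx v)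
  have h2 : tangentMapAt F F₁ h 0 (FrechetLie.mcDeriv F f x v) =
      dirDeriv (e₁ ∘ h ∘ e.symm) (e (f (x + (0 : ℝ) • v) - f x))
        (FrechetLie.mcDeriv F f x v) := by
    simp [tangentMapAt, he, he₁]
  rw [h2]
  refine deriv_eq_of_hasDerivAt (hasDerivAt_congr ?_ h1)
  filter_upwards [tendsto_chart_zero (F := F) (hf.tendsto_sub hU hx v)] with t ht
  simp only [Function.comp_apply, ← map_sub, he, he₁, OpenPartialHomeomorph.left_inv _ ht]

/-- The tangent map at `0` of a smooth homomorphism of abelian Lie groups. -/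
theorem exists_tangentMap_add {F₁ A₁ : Type*} [AddCommGroup F₁] [Module ℝ F₁]
    [TopologicalSpace F₁] [FrechetSpace F₁] [AddCommGroup A₁] [TopologicalSpace A₁]
    [ChartedSpace F₁ A₁] [FrechetLieAddGroup F₁ A₁] (h : A →+ A₁)
    (hh : SmoothOn (atlas F A) (atlas F₁ A₁) h univ) :
    ∃ L : F →L[ℝ] F₁, ∀ v, L v = tangentMapAt F F₁ h 0 v := by
  have h0 : (0 : A) ∈ (chartAt F (0 : A)).source := mem_chart_source F 0
  have hO := isOpen_chartDomain isOpen_univ hh.1 (chartAt F (0 : A)) (chartAt F₁ (h 0))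
  have hm := hh.2 _ (chart_mem_atlas F 0) _ (chart_mem_atlas F₁ (h 0))
  exact ⟨hm.dirDerivL hO (x := chartAt F (0 : A) 0)
    ⟨(chartAt F (0 : A)).map_source h0, trivial, by
      simp⟩, fun v => rfl⟩

theorem SmoothInto.mcIter_hom {n : ℕ} {F₁ A₁ : Type*} [AddCommGroup F₁] [Module ℝ F₁]
    [TopologicalSpace F₁] [FrechetSpace F₁] [AddCommGroup A₁] [TopologicalSpace A₁]
    [ChartedSpace F₁ A₁] [FrechetLieAddGroup F₁ A₁] (h : A →+ A₁)
    (hh : SmoothOn (atlas F A) (atlas F₁ A₁) h univ) (hU : IsOpen U) (hf : SmoothInto F f U)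
    (hx : x ∈ U) (v : Fin (n + 1) → X) :
    mcIter F₁ n (fun y => h (f y)) v x = tangentMapAt F F₁ h 0 (mcIter F n f v x) := by
  obtain ⟨L, hL⟩ := exists_tangentMap_add h hh
  refine (iterDeriv_congr hU (u' := fun y => L (FrechetLie.mcDeriv F f y (v 0)))
    (fun y hy => ?_) _ hx).trans ?_
  · exact (hf.mcDeriv_hom h hh hU hy _).trans (hL _).symm
  · rw [← hL]
    exact CInfOn.iterDeriv_clm_comp L hU (hf.mcDeriv_const hU _) _ x hx

end LieIterated

/-! ### Antisymmetrization -/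

section Antisymmetrization

open Equiv

variable {E F : Type*} [AddCommGroup F]

/-- The antisymmetrization `∑ σ, ε(σ) f(ξ ∘ σ)`. -/
def antisymm {n : ℕ} (f : (Fin n → E) → F) (ξ : Fin n → E) : F :=
  ∑ σ : Perm (Fin n), (Perm.sign σ : ℤ) • f (fun i => ξ (σ i))

/-- The extension of a permutation by `0 ↦ 0`. -/
abbrev permSucc {n : ℕ} (π : Perm (Fin n)) : Perm (Fin (n + 1)) := Perm.decomposeFin.symm (0, π)

theorem permSucc_zero {n : ℕ} (π : Perm (Fin n)) : permSucc π 0 = 0 := by simp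

theorem permSucc_succ {n : ℕ} (π : Perm (Fin n)) (j : Fin n) : permSucc π j.succ = (π j).succ := by
  simp

theorem permSucc_injective {n : ℕ} : Function.Injective (permSucc (n := n)) := fun π π' h => by
  have := Perm.decomposeFin.symm.injective h
  exact (Prod.mk.inj this).2

theorem sign_permSucc {n : ℕ} (π : Perm (Fin n)) : Perm.sign (permSucc π) = Perm.sign π := by
  rw [permSucc, Perm.decomposeFin.symm_sign]
  simp

/-- Both sides have `(n + 1)!` elements. -/
theorem bijective_of_injective_perm {n : ℕ}
    {e : Fin (n + 1) × Perm (Fin n) → Perm (Fin (n + 1))} (h : Function.Injective e) :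
    Function.Bijective e := by
  rw [Fintype.bijective_iff_injective_and_card]
  refine ⟨h, ?_⟩
  simp [Fintype.card_perm, Nat.factorial_succ]

theorem sign_smul_smul {n : ℕ} (k : ℕ) (σ : Perm (Fin n)) (x : F) :
    (((-1) ^ k * Perm.sign σ : ℤˣ) : ℤ) • x = ((-1 : ℤ) ^ k) • (Perm.sign σ : ℤ) • x := by
  rw [smul_smul]
  simp

/-- Expansion of an antisymmetrization according to the vector in position `k`. -/
theorem antisymm_expand {n : ℕ} (f : (Fin (n + 1) → E) → F) (k : Fin (n + 1))
    (ξ : Fin (n + 1) → E) :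
    antisymm f ξ = ∑ a : Fin (n + 1), ((-1 : ℤ) ^ ((a : ℕ) + k)) •
      antisymm (fun y => f (k.insertNth (ξ a) y)) (a.removeNth ξ) := by
  -- A permutation with `k ↦ a` is determined by a permutation of the remaining `n` indices. The two
  -- cycles that bring `k` and `a` to the front carry the signs `(-1)^k` and `(-1)^a`.
  have hinj : Function.Injective fun q : Fin (n + 1) × Perm (Fin n) =>
      q.1.cycleRange.symm * permSucc q.2 * k.cycleRange := by
    rintro ⟨a, π⟩ ⟨b, π'⟩ h
    have h1 := mul_right_cancel h
    have hab : a = b := by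
      have := congrArg (fun σ : Perm (Fin (n + 1)) => σ 0) h1
      simpa using this
    subst hab
    exact congrArg (Prod.mk a) (permSucc_injective (mul_left_cancel h1))
  rw [antisymm, ← (bijective_of_injective_perm hinj).sum_comp, Fintype.sum_prod_type]
  refine Finset.sum_congr rfl fun a _ => ?_
  rw [antisymm, Finset.smul_sum]
  refine Finset.sum_congr rfl fun π _ => ?_
  rw [← sign_smul_smul]
  congr 2
  · simp only [Perm.sign_mul, Perm.sign_symm, Fin.sign_cycleRange, sign_permSucc, pow_add]
    rw [mul_right_comm]
  · rw [← Fin.cons_comp_cycleRange]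
    funext i
    simp only [Perm.mul_apply, Function.comp_apply]
    refine Fin.cases ?_ (fun j => ?_) (k.cycleRange i)
    · rw [permSucc_zero]; simp
    · rw [permSucc_succ]; simp [Fin.removeNth]

/-- Expansion of an antisymmetrization according to the position of the first vector. -/
theorem antisymm_cons {n : ℕ} (f : (Fin (n + 1) → E) → F) (ζ : E) (η : Fin n → E) :
    antisymm f (Fin.cons ζ η : Fin (n + 1) → E) =
      ∑ k : Fin (n + 1), ((-1 : ℤ) ^ (k : ℕ)) • antisymm (fun y => f (k.insertNth ζ y)) η := by
  -- Here the permutations are sorted by the index `k` that is sent to `0`, and only one cycle is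
  -- needed.
  have hinj : Function.Injective fun q : Fin (n + 1) × Perm (Fin n) =>
      permSucc q.2 * q.1.cycleRange := by
    rintro ⟨a, π⟩ ⟨b, π'⟩ h
    simp only at h
    have hab : a = b := by
      have h1 := congrArg (fun σ : Perm (Fin (n + 1)) => σ a) h
      simp only [Perm.mul_apply, Fin.cycleRange_self, permSucc_zero] at h1
      have h2 : b.cycleRange a = 0 :=
        (permSucc π').injective (h1.symm.trans (permSucc_zero π').symm)
      have h3 := congrArg b.cycleRange.symm h2
      simpa using h3
    subst hab
    rw [permSucc_injective (mul_right_cancel h)]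
  rw [antisymm, ← (bijective_of_injective_perm hinj).sum_comp, Fintype.sum_prod_type]
  refine Finset.sum_congr rfl fun a _ => ?_
  rw [antisymm, Finset.smul_sum]
  refine Finset.sum_congr rfl fun π _ => ?_
  rw [← sign_smul_smul]
  congr 2
  · simp only [Perm.sign_mul, Fin.sign_cycleRange, sign_permSucc, mul_comm]
  · rw [← Fin.cons_comp_cycleRange]
    funext i
    simp only [Perm.mul_apply, Function.comp_apply]
    refine Fin.cases ?_ (fun j => ?_) (a.cycleRange i)
    · rw [permSucc_zero]; simp
    · rw [permSucc_succ]; simp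

theorem antisymm_sum {ι : Type*} (s : Finset ι) {n : ℕ} (f : ι → (Fin n → E) → F)
    (ξ : Fin n → E) : antisymm (fun y => ∑ i ∈ s, f i y) ξ = ∑ i ∈ s, antisymm (f i) ξ := by
  simp only [antisymm, Finset.smul_sum]
  exact Finset.sum_comm

theorem antisymm_zsmul {n : ℕ} (z : ℤ) (f : (Fin n → E) → F)
    (ξ : Fin n → E) : antisymm (fun y => z • f y) ξ = z • antisymm f ξ := by
  simp only [antisymm, Finset.smul_sum]
  exact Finset.sum_congr rfl fun _ _ => smul_comm _ _ _

theorem antisymm_add {n : ℕ} (f g : (Fin n → E) → F) (ξ : Fin n → E) :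
    antisymm (fun y => f y + g y) ξ = antisymm f ξ + antisymm g ξ := by
  simp only [antisymm, smul_add, Finset.sum_add_distrib]

/-- The antisymmetrization of a function that is invariant under a transposition vanishes. -/
theorem antisymm_eq_zero [Module ℝ F] {n : ℕ} (f : (Fin n → E) → F) {i j : Fin n} (hij : i ≠ j)
    (hf : ∀ y, f (fun k => y (Equiv.swap i j k)) = f y) (ξ : Fin n → E) : antisymm f ξ = 0 := by
  have h : antisymm f ξ = -antisymm f ξ := by
    conv_lhs => rw [antisymm, ← Equiv.sum_comp (Equiv.mulRight (Equiv.swap i j))]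
    rw [antisymm, ← Finset.sum_neg_distrib]
    refine Finset.sum_congr rfl fun σ _ => ?_
    have := hf (fun k => ξ (σ k))
    simp only [Equiv.coe_mulRight, Perm.sign_mul, Perm.sign_swap hij, Perm.mul_apply, this]
    simp
  -- Being its own negative forces the value to be zero, since `F` is a real vector space.
  have h2 : (2 : ℝ) • antisymm f ξ = 0 := by
    rw [two_smul]
    nth_rewrite 1 [h]
    simp
  simpa using h2

/-- A pair `(a, b)` codes the ordered pair of distinct indices `a` and `a.succAbove b`. The
involution in the proof exchanges these two, which reverses the condition `b.castSucc < a`. -/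
theorem sum_filter_swap {n : ℕ} (W : Fin (n + 2) → Fin (n + 1) → F) :
    ∑ a : Fin (n + 2), ∑ b : Fin (n + 1), (if b.castSucc < a then 0 else W a b) =
      ∑ j : Fin (n + 2), ∑ i : Fin (n + 1),
        (if i.castSucc < j then W (j.succAbove i) (i.predAbove j) else 0) := by
  rw [← Fintype.sum_prod_type', ← Fintype.sum_prod_type']
  let s : Fin (n + 2) × Fin (n + 1) → Fin (n + 2) × Fin (n + 1) :=
    fun q => (q.1.succAbove q.2, q.2.predAbove q.1)
  have hs : Function.Involutive s := fun q => by
    simp [s, Fin.succAbove_succAbove_predAbove, Fin.predAbove_predAbove_succAbove]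
  refine Fintype.sum_equiv hs.toPerm _ _ fun q => ?_
  have h1 : (s q).1.succAbove (s q).2 = q.1 := congrArg Prod.fst (hs q)
  have h2 : (s q).2.predAbove (s q).1 = q.2 := congrArg Prod.snd (hs q)
  have h3 : (s q).2.castSucc < (s q).1 ↔ ¬ q.2.castSucc < q.1 := by
    obtain ⟨a, b⟩ := q
    show (b.predAbove a).castSucc < a.succAbove b ↔ ¬ b.castSucc < a
    by_cases h : b.castSucc < a
    · rw [Fin.succAbove_of_castSucc_lt _ _ h, Fin.predAbove_of_castSucc_lt _ _ h]
      refine iff_of_false ?_ (not_not.2 h)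
      simp only [Fin.lt_def, Fin.val_castSucc, Fin.val_pred] at h ⊢
      omega
    · rw [Fin.succAbove_of_le_castSucc _ _ (not_lt.1 h),
        Fin.predAbove_of_le_castSucc _ _ (not_lt.1 h), Fin.castSucc_castPred]
      refine iff_of_true ?_ h
      simp only [Fin.lt_def, Fin.val_castSucc, Fin.val_succ] at h ⊢
      omega
  simp only [Function.Involutive.coe_toPerm, h1, h2, h3]
  split_ifs <;> simp_all

/-- Contracting neighbouring entries by `B` and antisymmetrizing gives the Chevalley–Eilenberg
differential of the antisymmetrization for the bracket `B x y - B y x`. -/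
theorem sum_antisymm_contract {n : ℕ} (T : (Fin (n + 1) → E) → F) [AddCommGroup E] (B : E → E → E)
    (hT : ∀ (x y : E) (η : Fin n → E), antisymm T (Fin.cons (x - y) η : Fin (n + 1) → E) =
      antisymm T (Fin.cons x η : Fin (n + 1) → E) - antisymm T (Fin.cons y η : Fin (n + 1) → E))
    (ξ : Fin (n + 2) → E) :
    ∑ k : Fin (n + 1), ((-1 : ℤ) ^ ((k : ℕ) + 1)) • antisymm (fun ξ : Fin (n + 2) → E =>
        T (k.insertNth (B (ξ k.castSucc) (ξ k.succ)) (k.removeNth (k.castSucc.removeNth ξ)))) ξ =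
      ∑ j : Fin (n + 2), ∑ i : Fin (n + 1), if i.castSucc < j then
        ((-1 : ℤ) ^ ((i : ℕ) + (j : ℕ))) • antisymm T
          (Fin.cons (B (ξ i.castSucc) (ξ j) - B (ξ j) (ξ i.castSucc))
            (i.removeNth (j.removeNth ξ)) : Fin (n + 1) → E)
        else 0 := by
  -- `V a b` collects the terms in which the vectors with indices `a` and `a.succAbove b`, in this
  -- order, are fed into `B`.
  set V : Fin (n + 2) → Fin (n + 1) → F := fun a b =>
    antisymm T (Fin.cons (B (ξ a) (ξ (a.succAbove b))) (b.removeNth (a.removeNth ξ)) :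
      Fin (n + 1) → E) with hV
  -- Expand according to the vector in position `k.castSucc`, then according to the one in position
  -- `k` of the rest, which was position `k.succ`. The signs multiply to `(-1)^((k+1)+(a+k)+(b+k)) =
  -- (-1)^(a+b+1) (-1)^k`.
  have key : ∀ k : Fin (n + 1), ((-1 : ℤ) ^ ((k : ℕ) + 1)) • antisymm (fun ξ : Fin (n + 2) → E =>
      T (k.insertNth (B (ξ k.castSucc) (ξ k.succ)) (k.removeNth (k.castSucc.removeNth ξ)))) ξ =
      ∑ a : Fin (n + 2), ∑ b : Fin (n + 1), ((-1 : ℤ) ^ ((a : ℕ) + b + 1)) •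
        ((-1 : ℤ) ^ (k : ℕ)) • antisymm (fun y => T (k.insertNth (B (ξ a) (ξ (a.succAbove b))) y))
          (b.removeNth (a.removeNth ξ)) := by
    intro k
    rw [antisymm_expand _ k.castSucc, Finset.smul_sum]
    refine Finset.sum_congr rfl fun a _ => ?_
    rw [antisymm_expand _ k, Finset.smul_sum, Finset.smul_sum]
    refine Finset.sum_congr rfl fun b _ => ?_
    rw [smul_smul, smul_smul, smul_smul]
    congr 1
    · rw [Fin.val_castSucc, ← pow_add, ← pow_add, ← pow_add]
      rw [show (k : ℕ) + 1 + ((a : ℕ) + k) + ((b : ℕ) + k) =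
        (a : ℕ) + b + 1 + k + 2 * k by ring, pow_add _ _ (2 * (k : ℕ)), pow_mul]
      simp
    · congr 1
      funext y
      have e1 : ∀ (x : E) (z : Fin (n + 1) → E),
          (k.castSucc.insertNth x z : Fin (n + 2) → E) k.succ = z k := by
        intro x z
        rw [← Fin.succAbove_castSucc_self, Fin.insertNth_apply_succAbove]
      rw [e1, Fin.insertNth_apply_same, Fin.insertNth_apply_same, Fin.removeNth_insertNth,
        Fin.removeNth_insertNth]
      rfl
  -- The remaining sum over `k` with sign `(-1)^k` is the expansion `antisymm_cons` for `B(ξ_a,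
  -- ξ_b')` placed in front.
  have hsum : ∑ k : Fin (n + 1), ((-1 : ℤ) ^ ((k : ℕ) + 1)) • antisymm (fun ξ : Fin (n + 2) → E =>
      T (k.insertNth (B (ξ k.castSucc) (ξ k.succ)) (k.removeNth (k.castSucc.removeNth ξ)))) ξ =
      ∑ a : Fin (n + 2), ∑ b : Fin (n + 1), ((-1 : ℤ) ^ ((a : ℕ) + b + 1)) • V a b := by
    simp only [key, hV, antisymm_cons, Finset.smul_sum]
    rw [Finset.sum_comm]
    refine Finset.sum_congr rfl fun a _ => ?_
    rw [Finset.sum_comm]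
  -- Ordered pairs are split according to which index is larger, so that the two orders of each
  -- unordered pair can be collected in one bracket.
  have hsplit : ∀ a b, ((-1 : ℤ) ^ ((a : Fin (n + 2)) + (b : Fin (n + 1)) + 1 : ℕ)) • V a b =
      (if b.castSucc < a then ((-1 : ℤ) ^ ((a : ℕ) + b + 1)) • V a b else 0) +
      (if b.castSucc < a then 0 else ((-1 : ℤ) ^ ((a : ℕ) + b + 1)) • V a b) := by
    intro a b
    split_ifs <;> simp
  rw [hsum, Finset.sum_congr rfl fun a _ => Finset.sum_congr rfl fun b _ => hsplit a b]
  simp only [Finset.sum_add_distrib]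
  rw [sum_filter_swap fun a b => ((-1 : ℤ) ^ ((a : ℕ) + b + 1)) • V a b]
  simp only [← Finset.sum_add_distrib]
  refine Finset.sum_congr rfl fun j _ => Finset.sum_congr rfl fun i _ => ?_
  split_ifs with h
  · have hV2 : V (j.succAbove i) (i.predAbove j) = antisymm T
        (Fin.cons (B (ξ i.castSucc) (ξ j)) (i.removeNth (j.removeNth ξ)) : Fin (n + 1) → E) := by
      simp only [hV]
      rw [Fin.succAbove_succAbove_predAbove, ← Fin.removeNth_removeNth_eq_swap,
        Fin.succAbove_of_castSucc_lt _ _ h]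
    have hV1 : V j i = antisymm T
        (Fin.cons (B (ξ j) (ξ i.castSucc)) (i.removeNth (j.removeNth ξ)) : Fin (n + 1) → E) := by
      simp only [hV]
      rw [Fin.succAbove_of_castSucc_lt _ _ h]
    -- Exchanging the two indices changes the parity of the sum of their positions: this is the
    -- minus sign of the bracket.
    have hs : (-1 : ℤ) ^ ((j.succAbove i : ℕ) + (i.predAbove j : ℕ) + 1) =
        (-1) ^ ((i : ℕ) + j) := by
      rw [pow_succ, Fin.neg_one_pow_succAbove_add_predAbove, add_comm (j : ℕ)]
      simp
    rw [hV2, hV1, hs, hT, pow_succ, add_comm (j : ℕ)]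
    simp only [mul_neg, mul_one, neg_smul, smul_sub]
    abel
  · simp

end Antisymmetrization

/-! ### Lie groups in the preferred chart at the identity -/

section GroupChart

variable (E G : Type*)
  [AddCommGroup E] [Module ℝ E] [TopologicalSpace E] [FrechetSpace E]
  [Group G] [TopologicalSpace G] [ChartedSpace E G]

/-- The coordinates of the identity. -/
noncomputable def chartOne : E := chartAt E (1 : G) 1

/-- The product in the chart at the identity. -/
noncomputable def chartMul (p : E × E) : E :=
  chartAt E (1 : G) ((chartAt E (1 : G)).symm p.1 * (chartAt E (1 : G)).symm p.2)

/-- The domain of the product in the chart at the identity. -/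
def chartMulDomain : Set (E × E) :=
  ((chartAt E (1 : G)).target ×ˢ (chartAt E (1 : G)).target) ∩
    {p | (chartAt E (1 : G)).symm p.1 * (chartAt E (1 : G)).symm p.2 ∈ (chartAt E (1 : G)).source}

theorem chartOne_mem : chartOne E G ∈ (chartAt E (1 : G)).target :=
  (chartAt E (1 : G)).map_source (mem_chart_source E 1)

theorem symm_chartOne : (chartAt E (1 : G)).symm (chartOne E G) = 1 :=
  (chartAt E (1 : G)).left_inv (mem_chart_source E 1)

theorem chartMulDomain_right {x : E} (hx : x ∈ (chartAt E (1 : G)).target) :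
    (x, chartOne E G) ∈ chartMulDomain E G := by
  refine ⟨⟨hx, chartOne_mem E G⟩, ?_⟩
  simpa [symm_chartOne] using (chartAt E (1 : G)).map_target hx

theorem chartMul_one {x : E} (hx : x ∈ (chartAt E (1 : G)).target) :
    chartMul E G (x, chartOne E G) = x := by
  simp [chartMul, symm_chartOne, (chartAt E (1 : G)).right_inv hx]

theorem one_chartMul {x : E} (hx : x ∈ (chartAt E (1 : G)).target) :
    chartMul E G (chartOne E G, x) = x := by
  simp [chartMul, symm_chartOne, (chartAt E (1 : G)).right_inv hx]

variable [FrechetLieGroup E G]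

theorem isOpen_chartMulDomain : IsOpen (chartMulDomain E G) := by
  have hm := FrechetLieGroup.smooth_mul (E := E) (G := G)
  have h := isOpen_chartDomain isOpen_univ hm.1
    ((chartAt E (1 : G)).prod (chartAt E (1 : G))) (chartAt E (1 : G))
  convert h using 1
  ext p
  simp [chartMulDomain]

theorem cInfOn_chartMul : CInfOn (chartMul E G) (chartMulDomain E G) := by
  have hm := FrechetLieGroup.smooth_mul (E := E) (G := G)
  refine CInfOn.mono (hm.2 ((chartAt E (1 : G)).prod (chartAt E (1 : G)))
    ⟨_, chart_mem_atlas E 1, _, chart_mem_atlas E 1, rfl⟩ _ (chart_mem_atlas E 1)) ?_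
  rintro p ⟨h1, h2⟩
  exact ⟨h1, trivial, h2⟩

/-- Exhibits the field as a partial derivative of the smooth map `chartMul`, which is where its
smoothness comes from. -/
theorem leftInvField_eq (ξ x : E) :
    leftInvField E G ξ x = dirDeriv (chartMul E G) (x, chartOne E G) (0, ξ) := by
  simp [leftInvField, dirDeriv, chartMul, chartOne]

theorem cInfOn_leftInvField (ξ : E) :
    CInfOn (leftInvField E G ξ) (chartAt E (1 : G)).target := by
  have h1 := (cInfOn_chartMul E G).dirDeriv_const (isOpen_chartMulDomain E G) (0, ξ)
  have h2 := h1.comp_prodMk_const (isOpen_chartMulDomain E G) (chartOne E G)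
  have e : (fun x => dirDeriv (chartMul E G) (x, chartOne E G) (0, ξ)) = leftInvField E G ξ := by
    funext x; rw [leftInvField_eq]
  rw [e] at h2
  exact h2.mono fun x hx => chartMulDomain_right E G hx

theorem hasDerivAt_chartMul_right {x : E} (hx : x ∈ (chartAt E (1 : G)).target) (η : E) :
    HasDerivAt (fun r : ℝ => chartMul E G (x, chartOne E G + r • η)) (leftInvField E G η x) 0 := by
  have h := (cInfOn_chartMul E G).hasDerivAt (chartMulDomain_right E G hx) (0, η)
  rw [leftInvField_eq]
  simpa using h

theorem leftInvField_one (η : E) : leftInvField E G η (chartOne E G) = η := by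
  refine hasDerivAt_unique (hasDerivAt_chartMul_right E G (chartOne_mem E G) η)
    (hasDerivAt_congr ?_ (hasDerivAt_line (chartOne E G) η 0))
  filter_upwards [(tendsto_line (chartOne E G) η).eventually_mem
    ((chartAt E (1 : G)).open_target.mem_nhds (chartOne_mem E G))] with t ht
  rw [one_chartMul E G ht]

/-- The derivative of a left invariant vector field at the identity. -/
noncomputable def leftInvDeriv (ξ η : E) : E := dirDeriv (leftInvField E G η) (chartOne E G) ξ

/-- `leftInvDeriv E G ξ η` is the mixed second derivative of the product, along `ξ` in the left and
`η` in the right factor; the bracket is its antisymmetric part without the factor one half. -/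
theorem lieBracket_eq (ξ η : E) :
    lieBracket E G ξ η = leftInvDeriv E G ξ η - leftInvDeriv E G η ξ := rfl

theorem hasDerivAt_leftInvField (ξ η : E) :
    HasDerivAt (fun s : ℝ => leftInvField E G η (chartOne E G + s • ξ))
      (leftInvDeriv E G ξ η) 0 :=
  (cInfOn_leftInvField E G η).hasDerivAt (chartOne_mem E G) ξ

theorem lieExp_zero : lieExp E G 0 = 1 := by
  have h := (Classical.choose_spec (FrechetLieGroup.exists_exp (E := E) (G := G)) 0).1 0 0
  simp only [smul_zero] at h
  exact left_eq_mul.1 h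

theorem tendsto_lieExp (ξ : E) : Tendsto (fun t : ℝ => lieExp E G (t • ξ)) (𝓝 0) (𝓝 1) := by
  have h := (Classical.choose_spec (FrechetLieGroup.exists_exp (E := E) (G := G)) ξ).2.1.1
  have h1 := (continuousOn_univ.1 h).tendsto 0
  have h2 : Classical.choose (FrechetLieGroup.exists_exp (E := E) (G := G)) ((0 : ℝ) • ξ) = 1 := by
    rw [zero_smul]; exact lieExp_zero E G
  rwa [h2] at h1

theorem hasDerivAt_lieExp (ξ : E) :
    HasDerivAt (fun t : ℝ => chartAt E (1 : G) (lieExp E G (t • ξ))) ξ 0 :=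
  (Classical.choose_spec (FrechetLieGroup.exists_exp (E := E) (G := G)) ξ).2.2

end GroupChart

/-! ### Group cochains in the chart at the identity and their mixed derivatives -/

section Cochains

variable (E : Type*) {G : Type*} (F : Type*) {A : Type*}
  [AddCommGroup E] [Module ℝ E] [TopologicalSpace E] [FrechetSpace E]
  [Group G] [TopologicalSpace G] [ChartedSpace E G]
  [AddCommGroup F] [Module ℝ F] [TopologicalSpace F] [FrechetSpace F]
  [AddCommGroup A] [TopologicalSpace A] [ChartedSpace F A]

/-- A function on `G^p` in the chart at the identity. -/
noncomputable def chartRep {p : ℕ} (c : (Fin p → G) → A) (x : Fin p → E) : A :=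
  c fun i => (chartAt E (1 : G)).symm (x i)

variable (G) in
/-- The coordinates of the identity of `G^p`. -/
noncomputable def chartOnes (p : ℕ) : Fin p → E := fun _ => chartOne E G

/-- The function `c` on `G^p` is smooth near the identity when read in the chart there. -/
def ChartSmooth {p : ℕ} (c : (Fin p → G) → A) : Prop :=
  ∃ U : Set (Fin p → E), IsOpen U ∧ chartOnes E G p ∈ U ∧
    (∀ x ∈ U, ∀ i, x i ∈ (chartAt E (1 : G)).target) ∧ SmoothInto F (chartRep E c) U

/-- The mixed derivative of `c` along the factors of `G^(n+1)`, in the chart at the identity. -/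
noncomputable def factorDeriv {n : ℕ} (c : (Fin (n + 1) → G) → A) (ξ : Fin (n + 1) → E) : F :=
  mcIter F n (chartRep E c) (fun i => Pi.single i (ξ i)) (chartOnes E G (n + 1))

variable {E F}

theorem chartSmooth_of_smoothOn {p : ℕ} {c : (Fin p → G) → A} {U : Set (Fin p → G)}
    (hU : IsOpen U) (h1 : 1 ∈ U) (hc : SmoothOn (powAtlas (atlas E G) p) (atlas F A) c U) :
    ChartSmooth E F c := by
  let e : OpenPartialHomeomorph (Fin p → G) (Fin p → E) :=
    OpenPartialHomeomorph.pi fun _ => chartAt E (1 : G)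
  have he : ∀ x ∈ e.target, ∀ i, x i ∈ (chartAt E (1 : G)).target := fun x hx i => hx i trivial
  refine ⟨e.target ∩ e.symm ⁻¹' U, e.symm.isOpen_inter_preimage hU,
    ⟨fun i _ => chartOne_mem E G, ?_⟩, fun x hx => he x hx.1, ?_, ?_⟩
  · have : e.symm (chartOnes E G p) = 1 := funext fun i => symm_chartOne E G
    simpa [this] using h1
  · exact hc.1.comp (e.continuousOn_symm.mono inter_subset_left) fun x hx => hx.2
  · rintro _ rfl e' he'
    exact CInfOn.mono (hc.2 e ⟨_, fun _ => chart_mem_atlas E 1, rfl⟩ e' he')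
      fun x hx => ⟨hx.2.1.1, hx.2.1.2, hx.2.2⟩

variable [FrechetLieAddGroup F A]

/-- The derivative of a cochain as a continuous multilinear map. -/
theorem exists_factorMultilinear {n : ℕ} {c : (Fin (n + 1) → G) → A} (hc : ChartSmooth E F c) :
    ∃ T : ContinuousMultilinearMap ℝ (fun _ : Fin (n + 1) => E) F,
      ∀ ξ, T ξ = factorDeriv E F c ξ := by
  obtain ⟨U, hU, h1, -, hs⟩ := hc
  exact ⟨(hs.mcMultilinear n hU h1).compContinuousLinearMap
    fun i => ContinuousLinearMap.single ℝ (fun _ : Fin (n + 1) => E) i, fun ξ => rfl⟩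

theorem exists_antisymm_factorDeriv {n : ℕ} {c : (Fin (n + 1) → G) → A} (hc : ChartSmooth E F c) :
    ∃ ω : E [⋀^Fin (n + 1)]→L[ℝ] F, ∀ ξ, ω ξ = antisymm (factorDeriv E F c) ξ := by
  obtain ⟨T, hT⟩ := exists_factorMultilinear hc
  refine ⟨ContinuousMultilinearMap.alternatization T, fun ξ => ?_⟩
  rw [ContinuousMultilinearMap.alternatization_apply_apply, antisymm]
  refine Finset.sum_congr rfl fun σ _ => ?_
  rw [hT]
  rfl

/-- The antisymmetrized mixed partial derivative of a cochain along curves through the identity. -/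
theorem ChartSmooth.hasMixedPartialLie {n : ℕ} {c : (Fin (n + 1) → G) → A}
    (hc : ChartSmooth E F c) {γ : Fin (n + 1) → ℝ → G} {ξ : Fin (n + 1) → E}
    (h1 : ∀ i, γ i 0 = 1) (hγ : ∀ i, Tendsto (γ i) (𝓝 0) (𝓝 1))
    (hd : ∀ i, HasDerivAt (fun t => chartAt E (1 : G) (γ i t)) (ξ i) 0) :
    HasMixedPartialLie n (fun t => ∑ σ : Equiv.Perm (Fin (n + 1)), (Equiv.Perm.sign σ : ℤ) •
      c (fun i => γ (σ i) (t (σ i)))) (antisymm (factorDeriv E F c) ξ) := by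
  obtain ⟨U, hU, hone, -, hs⟩ := hc
  -- `L σ` permutes the factors: `(L σ x) i = x (σ i)`.
  let L : Equiv.Perm (Fin (n + 1)) → (Fin (n + 1) → E) →L[ℝ] (Fin (n + 1) → E) := fun σ =>
    ContinuousLinearMap.pi fun i => ContinuousLinearMap.proj (σ i)
  set V : Set (Fin (n + 1) → E) := ⋂ σ, (L σ) ⁻¹' U with hV
  have hVo : IsOpen V := isOpen_iInter_of_finite fun σ => hU.preimage (L σ).continuous
  have hL1 : ∀ σ, L σ (chartOnes E G (n + 1)) = chartOnes E G (n + 1) := fun σ => rfl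
  have hoV : chartOnes E G (n + 1) ∈ V := mem_iInter.2 fun σ => by
    simpa only [mem_preimage, hL1] using hone
  have hsσ : ∀ σ, SmoothInto F (fun x => chartRep E c (L σ x)) V := fun σ =>
    SmoothInto.comp hVo hU hs (cInfOn_clm (L σ) V) fun x hx => mem_iInter.1 hx σ
  have hz : ∀ σ : Equiv.Perm (Fin (n + 1)),
      (Equiv.Perm.sign σ : ℤ) = 1 ∨ (Equiv.Perm.sign σ : ℤ) = -1 := fun σ => by
    rcases Int.units_eq_one_or (Equiv.Perm.sign σ) with h | h <;> simp [h]
  have hall : SmoothInto F (fun x => ∑ σ : Equiv.Perm (Fin (n + 1)),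
      (Equiv.Perm.sign σ : ℤ) • chartRep E c (L σ x)) V :=
    SmoothInto.sum _ hVo fun σ _ => SmoothInto.zsmul (hz σ) hVo (hsσ σ)
  have hval : mcIter F n (fun x => ∑ σ : Equiv.Perm (Fin (n + 1)),
      (Equiv.Perm.sign σ : ℤ) • chartRep E c (L σ x)) (fun i => Pi.single i (ξ i))
      (chartOnes E G (n + 1)) = antisymm (factorDeriv E F c) ξ := by
    rw [SmoothInto.mcIter_sum _ hVo (fun σ _ => SmoothInto.zsmul (hz σ) hVo (hsσ σ)) hoV, antisymm]
    refine Finset.sum_congr rfl fun σ _ => ?_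
    -- `L σ` carries a vector in factor `σ i` to factor `i`. Once the order of differentiation is
    -- permuted by `σ` as well, the directions are those of `factorDeriv` at `ξ ∘ σ`.
    rw [SmoothInto.mcIter_zsmul (hz σ) hVo (hsσ σ) hoV, mcIter_comp_clm, hL1, factorDeriv,
      ← hs.mcIter_perm hU hone _ σ]
    congr 2
    funext i k
    simp [L, Pi.single_apply]
  rw [← hval]
  -- The `i`-th curve is the displacement of `γ i` from the identity in the chart, placed in the
  -- `i`-th factor. The sum of these displacements gives the coordinates of the point whose entries
  -- are the `γ i (t i)`.
  have hm := hall.hasMixedPartialLie hVo hoV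
    (α := fun i t => Pi.single i (chartAt E (1 : G) (γ i t) - chartOne E G))
    (v := fun i => Pi.single i (ξ i)) (fun i => by simp [h1, chartOne]) fun i => by
      have := HasDerivAt.clm_comp (HasDerivAt.const_add_curve (hd i) (-chartOne E G))
        (ContinuousLinearMap.single ℝ (fun _ : Fin (n + 1) => E) i)
      simpa [neg_add_eq_sub] using this
  refine hm.congr ?_
  have hsrc : ∀ᶠ t : Fin (n + 1) → ℝ in 𝓝 0, ∀ i, γ i (t i) ∈ (chartAt E (1 : G)).source := by
    rw [eventually_all]
    intro i
    exact ((hγ i).comp ((continuous_apply i).tendsto (0 : Fin (n + 1) → ℝ))).eventually_mem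
      ((chartAt E (1 : G)).open_source.mem_nhds (mem_chart_source E 1))
  filter_upwards [hsrc] with t ht
  refine Finset.sum_congr rfl fun σ _ => congrArg _ (congrArg c (funext fun i => ?_))
  have : (L σ (chartOnes E G (n + 1) +
      ∑ k, Pi.single k (chartAt E (1 : G) (γ k (t k)) - chartOne E G))) i =
      chartAt E (1 : G) (γ (σ i) (t (σ i))) := by
    simp [L, chartOnes, Finset.sum_apply, Pi.single_apply]
  rw [this, (chartAt E (1 : G)).left_inv (ht _)]

end Cochains

/-! ### The derivative of a contracted cochain -/

section Faces

theorem face_zero {G : Type*} [Group G] {p : ℕ} (g : Fin (p + 1) → G) :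
    face 0 g = fun i => g i.succ := rfl

theorem face_last {G : Type*} [Group G] {p : ℕ} (g : Fin (p + 1) → G) :
    face (Fin.last p).succ g = fun i => g i.castSucc := by
  funext i
  exact Fin.contractNth_apply_of_lt _ _ _ _ (by simp)

/-- The form with `insertNth` and `removeNth` fits both the expansions of `antisymm` and the
derivative in a single slot. -/
theorem face_middle {G : Type*} [Group G] {p : ℕ} (j : Fin (p + 1)) (g : Fin (p + 2) → G) :
    face j.castSucc.succ g =
      j.insertNth (g j.castSucc * g j.succ) (j.removeNth (j.castSucc.removeNth g)) := by
  rw [Fin.eq_insertNth_iff]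
  refine ⟨Fin.contractNth_apply_of_eq _ _ _ _ (by simp), funext fun i => ?_⟩
  refine Fin.contractNth_apply_of_ne _ _ _ _ fun h => ?_
  exact Fin.succAbove_ne j i (Fin.ext (by simpa using h.symm))

/-- Skipping `j` or `j + 1` makes no difference on indices that avoid both. -/
theorem succ_succAbove_succAbove {n : ℕ} (j : Fin (n + 1)) (i : Fin n) :
    j.succ.succAbove (j.succAbove i) = j.castSucc.succAbove (j.succAbove i) := by
  rcases lt_or_gt_of_ne (Fin.succAbove_ne j i) with h | h
  · have h' := Fin.castSucc_lt_castSucc_iff.2 h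
    rw [Fin.succAbove_of_castSucc_lt j.succ _ (h'.trans Fin.castSucc_lt_succ),
      Fin.succAbove_of_castSucc_lt j.castSucc _ h']
  · rw [Fin.succAbove_of_le_castSucc j.succ, Fin.succAbove_of_le_castSucc j.castSucc]
    · exact Fin.castSucc_le_castSucc_iff.2 h.le
    · rw [Fin.le_def]; simpa using h

/-- The order `j + 1, j, …` of the factors. -/
def contractPerm {n : ℕ} (j : Fin (n + 1)) : Equiv.Perm (Fin (n + 2)) :=
  j.succ.cycleRange.symm * permSucc j.cycleRange.symm

theorem contractPerm_zero {n : ℕ} (j : Fin (n + 1)) : contractPerm j 0 = j.succ := by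
  rw [contractPerm, Equiv.Perm.mul_apply, permSucc_zero]; simp

theorem contractPerm_one {n : ℕ} (j : Fin (n + 1)) :
    contractPerm j (Fin.succ 0) = j.castSucc := by
  rw [contractPerm, Equiv.Perm.mul_apply, permSucc_succ]; simp

theorem contractPerm_succ {n : ℕ} (j : Fin (n + 1)) (i : Fin n) :
    contractPerm j i.succ.succ = j.castSucc.succAbove (j.succAbove i) := by
  rw [contractPerm, Equiv.Perm.mul_apply, permSucc_succ, ← succ_succAbove_succAbove]; simp

end Faces

section SmoothCongr

variable {X F A : Type*}
  [AddCommGroup X] [Module ℝ X] [TopologicalSpace X] [IsTopologicalAddGroup X] [ContinuousSMul ℝ X]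
  [AddCommGroup F] [Module ℝ F] [TopologicalSpace F] [FrechetSpace F]
  [TopologicalSpace A] [ChartedSpace F A]

theorem SmoothInto.congr_set {f g : X → A} {U : Set X} (hU : IsOpen U)
    (hg : SmoothOn {OpenPartialHomeomorph.refl X} (atlas F A) g U) (h : EqOn f g U) :
    SmoothOn {OpenPartialHomeomorph.refl X} (atlas F A) f U := by
  have hf := hg.1.congr h
  refine ⟨hf, ?_⟩
  rintro _ rfl e' he'
  refine CInfOn.congr (isOpen_chartDomain hU hf (OpenPartialHomeomorph.refl X) e')
    ((hg.2 _ rfl e' he').mono fun x hx => ⟨trivial, hx.2.1, ?_⟩) fun x hx => ?_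
  · have := hx.2.2
    simp only [mem_preimage] at this ⊢
    rwa [← h hx.2.1]
  · exact congrArg e' (h hx.2.1).symm

end SmoothCongr

/-! ### Derivatives through an inserted product, and smoothness of pull-backs along faces -/

section Contraction

variable {E G F A : Type*}
  [AddCommGroup E] [Module ℝ E] [TopologicalSpace E] [FrechetSpace E]
  [Group G] [TopologicalSpace G] [ChartedSpace E G] [FrechetLieGroup E G]
  [AddCommGroup F] [Module ℝ F] [TopologicalSpace F] [FrechetSpace F]
  [AddCommGroup A] [TopologicalSpace A] [ChartedSpace F A] [FrechetLieAddGroup F A]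

/-- The mixed derivative of a function into which a product has been inserted. -/
theorem SmoothInto.hasMixedPartialLie_chartMul {X : Type*} [AddCommGroup X] [Module ℝ X]
    [TopologicalSpace X] [IsTopologicalAddGroup X] [ContinuousSMul ℝ X] [T2Space X]
    [LocallyConvexSpace ℝ X] {f : X → A} {U : Set X} {x : X} (hU : IsOpen U)
    (hf : SmoothInto F f U) (hx : x ∈ U) (N : E →L[ℝ] X) (a b : E) {n : ℕ} (w : Fin n → X) :
    HasMixedPartialLie (n + 1) (fun t : Fin (n + 2) → ℝ =>
        f (x + N (chartMul E G (chartOne E G + t (Fin.succ 0) • a, chartOne E G + t 0 • b) -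
          chartOne E G) + ∑ i : Fin n, t i.succ.succ • w i))
      (mcIter F (n + 1) f (Fin.cons (N b) (Fin.cons (N a) w : Fin (n + 1) → X)) x +
        mcIter F n f (Fin.cons (N (leftInvDeriv E G a b)) w) x) := by
  have hline : Tendsto (fun τ : Fin n → ℝ => x + ∑ i, τ i • w i) (𝓝 0) (𝓝 x) :=
    tendsto_sum_curves x (α := fun i s => s • w i) (fun i => zero_smul ℝ _)
      fun i => hasDerivAt_smul (w i)
  have hbase : Tendsto (fun t : Fin (n + 1) → ℝ => x + N (t 0 • a) + ∑ i : Fin n, t i.succ • w i)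
      (𝓝 0) (𝓝 x) := by
    have : Continuous fun t : Fin (n + 1) → ℝ => x + N (t 0 • a) + ∑ i : Fin n, t i.succ • w i := by
      fun_prop
    simpa using this.tendsto 0
  have htar : Tendsto (fun t : Fin (n + 1) → ℝ => chartOne E G + t 0 • a) (𝓝 0)
      (𝓝 (chartOne E G)) := by
    have : Continuous fun t : Fin (n + 1) → ℝ => chartOne E G + t 0 • a := by fun_prop
    simpa using this.tendsto 0
  -- The right factor is differentiated first: at the identity its velocity is the left invariant
  -- field evaluated at the left factor. Differentiating this expression in the left factor moves
  -- both the base point and the field, whence the two summands of the second function.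
  refine ⟨fun t => FrechetLie.mcDeriv F f (x + N (t 0 • a) + ∑ i : Fin n, t i.succ • w i)
    (N (leftInvField E G b (chartOne E G + t 0 • a))), ?_, fun τ =>
      dirDeriv (fun y => FrechetLie.mcDeriv F f y (N b)) (x + ∑ i, τ i • w i) (N a) +
        FrechetLie.mcDeriv F f (x + ∑ i, τ i • w i) (N (leftInvDeriv E G a b)), ?_, ?_⟩
  · filter_upwards [hbase.eventually_mem (hU.mem_nhds hx), htar.eventually_mem
      ((chartAt E (1 : G)).open_target.mem_nhds (chartOne_mem E G))] with t ht ht'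
    have h1 := HasDerivAt.clm_comp (HasDerivAt.const_add_curve
      (hasDerivAt_chartMul_right E G ht' b) (-chartOne E G)) N
    have h2 := HasDerivAt.const_add_curve h1 (x + ∑ i : Fin n, t i.succ • w i)
    have e0 : x + ∑ i : Fin n, t i.succ • w i + N (-chartOne E G +
        chartMul E G (chartOne E G + t 0 • a, chartOne E G + (0 : ℝ) • b)) =
        x + N (t 0 • a) + ∑ i : Fin n, t i.succ • w i := by
      rw [zero_smul, add_zero, chartMul_one E G ht', neg_add_cancel_left]
      abel
    have h3 := hf.hasDerivAt_curve hU (by rw [e0]; exact ht) h2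
    simp only [e0] at h3
    refine hasDerivAt_congr (Eventually.of_forall fun r => ?_) h3
    simp only [Fin.cons_zero, Fin.cons_succ]
    rw [zero_smul ℝ b, add_zero (chartOne E G), chartMul_one E G ht', add_sub_cancel_left,
      add_right_comm x, neg_add_eq_sub]
  · filter_upwards [hline.eventually_mem (hU.mem_nhds hx)] with τ hτ
    have h1 : HasDerivAt (fun s : ℝ => x + ∑ i, τ i • w i + s • N a) (N a) 0 :=
      hasDerivAt_line _ _ 0
    have h2 := HasDerivAt.clm_comp (hasDerivAt_leftInvField E G a b) N
    -- The product rule; at the identity the field `leftInvField E G b` has the value `b` and the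
    -- derivative `leftInvDeriv E G a b` along `a`.
    have h3 := CInfOn.hasDerivAt_of_linear (H := fun p : X × X => FrechetLie.mcDeriv F f p.1 p.2) hU
      (hf.mcDeriv hU) (fun v w => hf.mcDeriv_add hU hτ v w) hτ (by simp) h1 h2
    simp only [zero_smul, add_zero, leftInvField_one] at h3
    refine hasDerivAt_congr (Eventually.of_forall fun s => ?_) h3
    simp only [Fin.cons_zero, Fin.cons_succ, map_smul]
    rw [add_right_comm x]
  · have hd := hf.mcDeriv_const hU
    have h1 := CInfOn.hasMixedPartial hU hx (α := fun i s => s • w i)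
      (((hd (N b)).dirDeriv_const hU (N a)).add hU (hd (N (leftInvDeriv E G a b))))
      (fun i => zero_smul ℝ _) fun i => hasDerivAt_smul (w i)
    rw [CInfOn.iterDeriv_add hU ((hd (N b)).dirDeriv_const hU (N a)) (hd _) _ x hx] at h1
    exact h1

/-- The map of coordinates belonging to an inner face. -/
noncomputable def chartFace (E G : Type*)
    [AddCommGroup E] [Module ℝ E] [TopologicalSpace E] [FrechetSpace E]
    [Group G] [TopologicalSpace G] [ChartedSpace E G] {n : ℕ} (j : Fin (n + 1))
    (x : Fin (n + 2) → E) : Fin (n + 1) → E :=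
  j.insertNth (chartMul E G (x j.castSucc, x j.succ)) (j.removeNth (j.castSucc.removeNth x))

theorem chartRep_face_middle {n : ℕ} (c : (Fin (n + 1) → G) → A) (j : Fin (n + 1))
    {x : Fin (n + 2) → E} (hx : (x j.castSucc, x j.succ) ∈ chartMulDomain E G) :
    chartRep E (fun g => c (face j.castSucc.succ g)) x = chartRep E c (chartFace E G j x) := by
  rw [chartRep, chartRep, face_middle]
  congr 1
  rw [eq_comm, Fin.eq_insertNth_iff]
  refine ⟨?_, funext fun i => ?_⟩
  · simp only [chartFace, Fin.insertNth_apply_same]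
    exact (chartAt E (1 : G)).left_inv hx.2
  · simp [chartFace, Fin.removeNth]

theorem cInfOn_chartFace {n : ℕ} (j : Fin (n + 1)) :
    IsOpen {x : Fin (n + 2) → E | (x j.castSucc, x j.succ) ∈ chartMulDomain E G} ∧
    CInfOn (chartFace E G j)
      {x : Fin (n + 2) → E | (x j.castSucc, x j.succ) ∈ chartMulDomain E G} := by
  have ho : IsOpen {x : Fin (n + 2) → E | (x j.castSucc, x j.succ) ∈ chartMulDomain E G} :=
    (isOpen_chartMulDomain E G).preimage
      (f := fun x : Fin (n + 2) → E => (x j.castSucc, x j.succ)) (by fun_prop)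
  refine ⟨ho, CInfOn.pi ho fun i => ?_⟩
  rcases Fin.eq_self_or_eq_succAbove j i with rfl | ⟨k, rfl⟩
  · simp only [chartFace, Fin.insertNth_apply_same]
    exact CInfOn.comp ho (isOpen_chartMulDomain E G) (cInfOn_chartMul E G)
      (cInfOn_clm ((ContinuousLinearMap.proj (R := ℝ) (φ := fun _ : Fin (n + 2) => E)
        i.castSucc).prod (ContinuousLinearMap.proj i.succ)) _) fun x hx => hx
  · simp only [chartFace, Fin.insertNth_apply_succAbove]
    exact cInfOn_clm (ContinuousLinearMap.proj (R := ℝ) (φ := fun _ : Fin (n + 2) => E)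
      (j.castSucc.succAbove (j.succAbove k))) _

theorem chartFace_ones {n : ℕ} (j : Fin (n + 1)) :
    chartFace E G j (chartOnes E G (n + 2)) = chartOnes E G (n + 1) := by
  rw [chartFace, eq_comm, Fin.eq_insertNth_iff]
  exact ⟨(chartMul_one E G (chartOne_mem E G)).symm, rfl⟩

/-- The pull-back of a smooth cochain along a face map is smooth. -/
theorem ChartSmooth.face {n : ℕ} {c : (Fin (n + 1) → G) → A} (hc : ChartSmooth E F c)
    (k : Fin (n + 3)) : ChartSmooth E F fun g => c (face k g) := by
  obtain ⟨U, hU, h1, ht, hs⟩ := hc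
  have hT : IsOpen {x : Fin (n + 2) → E | ∀ i, x i ∈ (chartAt E (1 : G)).target} := by
    simp only [ofPred_forall]
    exact isOpen_iInter_of_finite fun i =>
      (chartAt E (1 : G)).open_target.preimage (continuous_apply i)
  have h1T : chartOnes E G (n + 2) ∈
      {x : Fin (n + 2) → E | ∀ i, x i ∈ (chartAt E (1 : G)).target} := fun _ => chartOne_mem E G
  -- The two outer faces only select entries, so they are linear in the chart.
  have hlin : ∀ (k : Fin (n + 3)) (r : Fin (n + 1) → Fin (n + 2)), (∀ g : Fin (n + 2) → G,
      FrechetLie.face k g = fun i => g (r i)) → ChartSmooth E F fun g => c (FrechetLie.face k g) := by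
    intro k r hr
    let L : (Fin (n + 2) → E) →L[ℝ] (Fin (n + 1) → E) :=
      ContinuousLinearMap.pi fun i => ContinuousLinearMap.proj (r i)
    have ho := hT.inter (hU.preimage L.continuous)
    refine ⟨_, ho, ⟨h1T, h1⟩, fun x hx => hx.1, ?_⟩
    have e : chartRep E (fun g => c (FrechetLie.face k g)) = fun x => chartRep E c (L x) := by
      funext x
      simp only [chartRep, hr]
      rfl
    rw [e]
    exact SmoothInto.comp ho hU hs (cInfOn_clm L _) fun x hx => hx.2
  refine Fin.cases (hlin 0 _ face_zero) (fun k => ?_) k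
  refine Fin.lastCases (hlin _ _ face_last) (fun j => ?_) k
  obtain ⟨ho, hF⟩ := cInfOn_chartFace (E := E) (G := G) j
  have hV := hF.continuousOn.isOpen_inter_preimage ho hU
  refine ⟨_, hT.inter hV, ⟨h1T, chartMulDomain_right E G (chartOne_mem E G), ?_⟩,
    fun x hx => hx.1, ?_⟩
  · simpa only [mem_preimage, chartFace_ones] using h1
  have h2 : SmoothInto F (fun x => chartRep E c (chartFace E G j x)) _ :=
    SmoothInto.comp (hT.inter hV) hU hs (hF.mono fun x hx => hx.2.1) fun x hx => hx.2.2
  have he : EqOn (chartRep E fun g => c (FrechetLie.face j.castSucc.succ g))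
      (fun x => chartRep E c (chartFace E G j x)) _ :=
    fun x hx => chartRep_face_middle c j hx
  exact SmoothInto.congr_set (hT.inter hV) h2 (he.mono fun x hx => hx.2.1)

end Contraction

/-! ### Compatibility with the differentials -/

section ChainMap

variable {E G F A : Type*}
  [AddCommGroup E] [Module ℝ E] [TopologicalSpace E] [FrechetSpace E]
  [Group G] [TopologicalSpace G] [ChartedSpace E G] [FrechetLieGroup E G]
  [AddCommGroup F] [Module ℝ F] [TopologicalSpace F] [FrechetSpace F]
  [AddCommGroup A] [TopologicalSpace A] [ChartedSpace F A] [FrechetLieAddGroup F A]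

/-- The selection of entries by `r` maps the direction in factor `i` to the zero vector, and a
multilinear map vanishes when one argument is zero. -/
theorem factorDeriv_eq_zero {n : ℕ} {c : (Fin (n + 1) → G) → A} (hc : ChartSmooth E F c)
    (r : Fin (n + 1) → Fin (n + 2)) {i : Fin (n + 2)} (hi : ∀ k, r k ≠ i) (ξ : Fin (n + 2) → E) :
    factorDeriv E F (fun g : Fin (n + 2) → G => c fun k => g (r k)) ξ = 0 := by
  obtain ⟨U, hU, h1, -, hs⟩ := hc
  let L : (Fin (n + 2) → E) →L[ℝ] (Fin (n + 1) → E) :=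
    ContinuousLinearMap.pi fun i => ContinuousLinearMap.proj (r i)
  have h0 : L (Pi.single i (ξ i)) = 0 := by
    funext k
    simp [L, hi k]
  have h := (hs.mcMultilinear (n + 1) hU h1).map_coord_zero
    (m := fun i => L (Pi.single i (ξ i))) i h0
  exact (mcIter_comp_clm (n + 1) (chartRep E c) L _ (chartOnes E G (n + 2))).trans h

/-- Brings the derivative in slot `j` to the front, the order in which
`SmoothInto.hasMixedPartialLie_chartMul` delivers it. -/
theorem factorDeriv_insertNth {n : ℕ} {c : (Fin (n + 1) → G) → A} (hc : ChartSmooth E F c)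
    (j : Fin (n + 1)) (ζ : E) (η : Fin n → E) :
    factorDeriv E F c (j.insertNth ζ η) =
      mcIter F n (chartRep E c) (Fin.cons (Pi.single j ζ) fun i => Pi.single (j.succAbove i) (η i))
        (chartOnes E G (n + 1)) := by
  obtain ⟨U, hU, h1, -, hs⟩ := hc
  rw [factorDeriv, hs.mcIter_first hU h1 _ j]
  simp only [Fin.insertNth_apply_same, Fin.insertNth_apply_succAbove]
  rfl

/-- One mixed partial derivative is computed twice, on `G^(n+2)` directly and on `G^(n+1)` through
the product. In the first summand both vectors differentiate `c` in slot `j`; the second comes from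
the second-order behaviour of the product. -/
theorem factorDeriv_face_middle {n : ℕ} {c : (Fin (n + 1) → G) → A} (hc : ChartSmooth E F c)
    (j : Fin (n + 1)) (ξ : Fin (n + 2) → E) :
    factorDeriv E F (fun g => c (face j.castSucc.succ g)) ξ =
      mcIter F (n + 1) (chartRep E c) (Fin.cons (Pi.single j (ξ j.succ))
        (Fin.cons (Pi.single j (ξ j.castSucc)) fun i =>
          Pi.single (j.succAbove i) (ξ (j.castSucc.succAbove (j.succAbove i))) :
          Fin (n + 1) → Fin (n + 1) → E)) (chartOnes E G (n + 1)) +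
      factorDeriv E F c (j.insertNth (leftInvDeriv E G (ξ j.castSucc) (ξ j.succ))
        (j.removeNth (j.castSucc.removeNth ξ))) := by
  obtain ⟨U', hU', h1', -, hs'⟩ := hc.face j.castSucc.succ
  rw [factorDeriv_insertNth hc]
  obtain ⟨U, hU, h1, -, hs⟩ := hc
  -- The variables are ordered by `contractPerm j`: the first moves factor `j + 1`, the second
  -- factor `j`, matching the right-factor-first order of `hM2`.
  have hM1 := hs'.hasMixedPartialLie hU' h1'
    (α := fun i t => t • Pi.single (contractPerm j i) (ξ (contractPerm j i)))
    (fun i => zero_smul ℝ _) fun i => hasDerivAt_smul _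
  rw [hs'.mcIter_perm hU' h1' (fun i => Pi.single i (ξ i)) (contractPerm j)] at hM1
  have hM2 := hs.hasMixedPartialLie_chartMul (G := G) hU h1
    (ContinuousLinearMap.single ℝ (fun _ : Fin (n + 1) => E) j) (ξ j.castSucc) (ξ j.succ)
    fun i : Fin n => Pi.single (j.succAbove i) (ξ (j.castSucc.succAbove (j.succAbove i)))
  refine (hM1.congr ?_).unique hM2
  have hval : ∀ (t : Fin (n + 2) → ℝ) (k : Fin (n + 2)), (chartOnes E G (n + 2) +
      ∑ i, t i • (Pi.single (contractPerm j i) (ξ (contractPerm j i)) : Fin (n + 2) → E))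
        (contractPerm j k) = chartOne E G + t k • ξ (contractPerm j k) := by
    intro t k
    simp [chartOnes, Finset.sum_apply, Pi.single_apply]
  have hdom : ∀ᶠ t : Fin (n + 2) → ℝ in 𝓝 0, (chartOne E G + t (Fin.succ 0) • ξ j.castSucc,
      chartOne E G + t 0 • ξ j.succ) ∈ chartMulDomain E G := by
    have hc : Continuous fun t : Fin (n + 2) → ℝ => (chartOne E G + t (Fin.succ 0) • ξ j.castSucc,
      chartOne E G + t 0 • ξ j.succ) := by fun_prop
    refine (hc.tendsto 0).eventually_mem ((isOpen_chartMulDomain E G).mem_nhds ?_)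
    simpa using chartMulDomain_right E G (chartOne_mem E G)
  filter_upwards [hdom] with t ht
  have v0 := hval t 0
  have v1 := hval t (Fin.succ 0)
  have v2 := fun i : Fin n => hval t i.succ.succ
  simp only [contractPerm_zero, contractPerm_one, contractPerm_succ] at v0 v1 v2
  rw [chartRep_face_middle c j (by rw [v0, v1]; exact ht)]
  congr 1
  rw [chartFace, v0, v1, eq_comm, Fin.eq_insertNth_iff]
  constructor
  · simp [chartOnes, Finset.sum_apply, (Fin.succAbove_ne j _).symm]
  · funext i
    simp only [Fin.removeNth]
    rw [v2]
    simp [chartOnes, Finset.sum_apply, Pi.single_apply, Fin.succAbove_ne]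

theorem ChartSmooth.iInter {ι : Type*} [Finite ι] {p : ℕ} {c : ι → (Fin p → G) → A}
    (hc : ∀ k, ChartSmooth E F (c k)) : ∃ U : Set (Fin p → E), IsOpen U ∧ chartOnes E G p ∈ U ∧
      ∀ k, SmoothInto F (chartRep E (c k)) U := by
  choose U hU h1 _ hs using hc
  exact ⟨⋂ k, U k, isOpen_iInter_of_finite hU, mem_iInter.2 h1,
    fun k => SmoothOn.mono (hs k) (iInter_subset _ k)⟩

theorem factorDeriv_sum {ι : Type*} [Fintype ι] {n : ℕ} {z : ι → ℤ} (hz : ∀ k, z k = 1 ∨ z k = -1)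
    {c : ι → (Fin (n + 1) → G) → A} (hc : ∀ k, ChartSmooth E F (c k)) (ξ : Fin (n + 1) → E) :
    factorDeriv E F (fun g => ∑ k, z k • c k g) ξ = ∑ k, z k • factorDeriv E F (c k) ξ := by
  obtain ⟨U, hU, h1, hs⟩ := ChartSmooth.iInter hc
  refine (SmoothInto.mcIter_sum Finset.univ hU
    (fun k _ => SmoothInto.zsmul (hz k) hU (hs k)) h1 _).trans ?_
  exact Finset.sum_congr rfl fun k _ => SmoothInto.mcIter_zsmul (hz k) hU (hs k) h1 _

theorem neg_one_pow_or (k : ℕ) : (-1 : ℤ) ^ k = 1 ∨ (-1 : ℤ) ^ k = -1 := neg_one_pow_eq_or ℤ k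

/-- Each outer face drops a factor and contributes nothing. The exponent `j + 1` is the index of the
inner face that multiplies the entries `j` and `j + 1`. -/
theorem factorDeriv_coboundary {n : ℕ} {c : (Fin (n + 1) → G) → A} (hc : ChartSmooth E F c)
    (ξ : Fin (n + 2) → E) :
    factorDeriv E F (fun g => ∑ k : Fin (n + 3), ((-1 : ℤ) ^ (k : ℕ)) • c (face k g)) ξ =
      ∑ j : Fin (n + 1), ((-1 : ℤ) ^ ((j : ℕ) + 1)) •
        factorDeriv E F (fun g => c (face j.castSucc.succ g)) ξ := by
  rw [factorDeriv_sum (fun k : Fin (n + 3) => neg_one_pow_or (k : ℕ)) fun k => hc.face k,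
    Fin.sum_univ_succ, Fin.sum_univ_castSucc]
  have h0 : factorDeriv E F (fun g : Fin (n + 2) → G => c (face 0 g)) ξ = 0 :=
    factorDeriv_eq_zero hc (fun i => i.succ) (i := 0) (fun k => Fin.succ_ne_zero k) ξ
  have h1 : factorDeriv E F (fun g : Fin (n + 2) → G => c (face (Fin.last (n + 1)).succ g)) ξ =
      0 := by
    simp only [face_last]
    exact factorDeriv_eq_zero hc (fun i => i.castSucc) (i := Fin.last (n + 1))
      (fun k => Fin.castSucc_ne_last k) ξ
  rw [h0, h1]
  simp

/-- The antisymmetrized derivative takes the differential of local cochains to the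
Chevalley–Eilenberg differential. -/
theorem antisymm_factorDeriv_coboundary {n : ℕ} {c : (Fin (n + 1) → G) → A}
    (hc : ChartSmooth E F c) (ξ : Fin (n + 2) → E) :
    antisymm (factorDeriv E F fun g => ∑ k : Fin (n + 3), ((-1 : ℤ) ^ (k : ℕ)) • c (face k g)) ξ =
      ∑ j : Fin (n + 2), ∑ i : Fin (n + 1), if i.castSucc < j then
        ((-1 : ℤ) ^ ((i : ℕ) + (j : ℕ))) • antisymm (factorDeriv E F c)
          (Fin.cons (lieBracket E G (ξ i.castSucc) (ξ j)) (i.removeNth (j.removeNth ξ)) :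
            Fin (n + 1) → E)
        else 0 := by
  obtain ⟨ω, hω⟩ := exists_antisymm_factorDeriv hc
  have hT : ∀ (x y : E) (η : Fin n → E),
      antisymm (factorDeriv E F c) (Fin.cons (x - y) η : Fin (n + 1) → E) =
      antisymm (factorDeriv E F c) (Fin.cons x η : Fin (n + 1) → E) -
        antisymm (factorDeriv E F c) (Fin.cons y η : Fin (n + 1) → E) := by
    intro x y η
    -- Additivity in the first argument is read off from the alternating map with the same values.
    have := ω.map_update_sub (Fin.cons 0 η) 0 x y
    simpa only [Fin.update_cons_zero, hω] using this
  simp only [lieBracket_eq]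
  rw [← sum_antisymm_contract _ (leftInvDeriv E G) hT ξ]
  rw [funext (factorDeriv_coboundary hc), antisymm_sum]
  refine Finset.sum_congr rfl fun j _ => ?_
  rw [antisymm_zsmul, funext (factorDeriv_face_middle hc j), antisymm_add]
  congr 1
  -- It remains to kill the summand that differentiates twice in slot `j`. Exchanging `ξ_j` and
  -- `ξ_{j+1}` there only exchanges the first two directions of differentiation.
  rw [add_eq_right]
  have hne : j.succ ≠ j.castSucc := (Fin.castSucc_lt_succ (i := j)).ne'
  refine antisymm_eq_zero _ hne (fun y => ?_) ξ
  obtain ⟨U, hU, h1, -, hs⟩ := hc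
  rw [← hs.mcIter_perm hU h1 _ (Equiv.swap 0 (Fin.succ 0))]
  congr 1
  funext i
  refine Fin.cases ?_ (fun i => Fin.cases ?_ (fun i => ?_) i) i
  · simp
  · simp
  · have hk : ∀ k, j.castSucc.succAbove (j.succAbove k) ≠ j.castSucc := fun k =>
      Fin.succAbove_ne _ _
    have hk' : ∀ k, j.castSucc.succAbove (j.succAbove k) ≠ j.succ := fun k => by
      rw [← succ_succAbove_succAbove]; exact Fin.succAbove_ne _ _
    rw [Equiv.swap_apply_of_ne_of_ne (Fin.succ_ne_zero _)
      (fun h => Fin.succ_ne_zero _ (Fin.succ_injective _ h))]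
    simp only [Fin.cons_succ]
    rw [Equiv.swap_apply_of_ne_of_ne (hk' i) (hk i)]

end ChainMap

/-! ### The derivation map on cohomology -/

section Derivation

variable {E G F A : Type*}
  [AddCommGroup E] [Module ℝ E] [TopologicalSpace E] [FrechetSpace E]
  [Group G] [TopologicalSpace G] [ChartedSpace E G] [FrechetLieGroup E G]
  [AddCommGroup F] [Module ℝ F] [TopologicalSpace F] [FrechetSpace F]
  [AddCommGroup A] [TopologicalSpace A] [ChartedSpace F A] [FrechetLieAddGroup F A]

theorem exists_chartSmooth {p : ℕ} {z : Germ (𝓝 (1 : Fin p → G)) A}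
    (hz : z ∈ localCochains E G F A p) :
    ∃ c : (Fin p → G) → A, ChartSmooth E F c ∧ z = (c : Germ (𝓝 (1 : Fin p → G)) A) := by
  obtain ⟨c, U, hU, h1, hc, rfl⟩ := hz
  exact ⟨c, chartSmooth_of_smoothOn hU h1 hc, rfl⟩

theorem tendsto_symm_chartOnes (p : ℕ) :
    Tendsto (fun (x : Fin p → E) i => (chartAt E (1 : G)).symm (x i)) (𝓝 (chartOnes E G p))
      (𝓝 1) := by
  rw [tendsto_pi_nhds]
  intro i
  have h := (chartAt E (1 : G)).continuousAt_symm (chartOne_mem E G)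
  have h2 := h.tendsto.comp ((continuous_apply i).tendsto (chartOnes E G p))
  rwa [symm_chartOne] at h2

theorem factorDeriv_congr {n : ℕ} {c c' : (Fin (n + 1) → G) → A} (h : c =ᶠ[𝓝 1] c')
    (ξ : Fin (n + 1) → E) : factorDeriv E F c ξ = factorDeriv E F c' ξ := by
  have h1 := (tendsto_symm_chartOnes (E := E) (G := G) (n + 1)).eventually h
  obtain ⟨U, hU, hUo, h1U⟩ := eventually_nhds_iff.1 h1
  exact mcIter_congr hUo (fun x hx => hU x hx) h1U _

theorem factorDeriv_zero {n : ℕ} (ξ : Fin (n + 1) → E) :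
    factorDeriv E F (fun _ : Fin (n + 1) → G => (0 : A)) ξ = 0 :=
  mcIter_const n (0 : A) _ _

theorem lieCochain_ext {n : ℕ} {ω ω' : LieCochain E F A (n + 1)}
    (h : ∀ ξ, lieEval E F A n ω ξ = lieEval E F A n ω' ξ) : ω = ω' :=
  ULift.ext _ _ (ContinuousAlternatingMap.ext h)

/-- The defining property quantifies over all representatives of the germ, including non-smooth
ones. They agree with `c` near the identity, where the exponential curves stay for small parameters.
-/
theorem ChartSmooth.isDerivedCochain {n : ℕ} {c : (Fin (n + 1) → G) → A}
    (hc : ChartSmooth E F c) {ω : LieCochain E F A (n + 1)}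
    (hω : ∀ ξ, lieEval E F A n ω ξ = antisymm (factorDeriv E F c) ξ) :
    IsDerivedCochain E G F A (n + 1) (c : Germ (𝓝 (1 : Fin (n + 1) → G)) A) ω := by
  intro c' hc' ξ
  rw [hω]
  refine (hc.hasMixedPartialLie (γ := fun i t => lieExp E G (t • ξ i)) (ξ := ξ)
    (fun i => by simp [lieExp_zero]) (fun i => tendsto_lieExp E G _)
    fun i => hasDerivAt_lieExp E G _).congr ?_
  have he : ∀ σ : Equiv.Perm (Fin (n + 1)), ∀ᶠ t : Fin (n + 1) → ℝ in 𝓝 0,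
      c' (fun i => lieExp E G (t (σ i) • ξ (σ i))) =
        c (fun i => lieExp E G (t (σ i) • ξ (σ i))) := fun σ => by
    refine Tendsto.eventually (tendsto_pi_nhds.2 fun i => ?_) (Germ.coe_eq.1 hc')
    exact (tendsto_lieExp E G (ξ (σ i))).comp
      ((continuous_apply (σ i)).tendsto (0 : Fin (n + 1) → ℝ))
  filter_upwards [eventually_all.2 he] with t ht
  exact Finset.sum_congr rfl fun σ _ => by rw [ht σ]

theorem exists_lieCochain {n : ℕ} {c : (Fin (n + 1) → G) → A} (hc : ChartSmooth E F c) :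
    ∃ ω : LieCochain E F A (n + 1),
      ∀ ξ, lieEval E F A n ω ξ = antisymm (factorDeriv E F c) ξ := by
  obtain ⟨ω, hω⟩ := exists_antisymm_factorDeriv hc
  exact ⟨ULift.up ω, hω⟩

/-- Uniqueness of mixed partial derivatives. Every later identity between derived cochains may thus
be checked on one smooth representative. -/
theorem IsDerivedCochain.unique {p : ℕ} {z : Germ (𝓝 (1 : Fin p → G)) A}
    {ω ω' : LieCochain E F A p} (h : IsDerivedCochain E G F A p z ω)
    (h' : IsDerivedCochain E G F A p z ω') : ω = ω' := by
  induction z using Germ.inductionOn with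
  | _ c =>
    cases p with
    | zero => exact ULift.ext _ _ ((h c rfl).trans (h' c rfl).symm)
    | succ n => exact lieCochain_ext fun ξ => (h c rfl ξ).unique (h' c rfl ξ)

theorem exists_isDerivedCochain {p : ℕ} {z : Germ (𝓝 (1 : Fin p → G)) A}
    (hz : z ∈ localCochains E G F A p) : ∃ ω, IsDerivedCochain E G F A p z ω := by
  obtain ⟨c, hc, rfl⟩ := exists_chartSmooth hz
  cases p with
  | zero => exact ⟨ULift.up (c 1), fun c' hc' => (Germ.coe_eq.1 hc').self_of_nhds.symm⟩
  | succ n =>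
    obtain ⟨ω, hω⟩ := exists_lieCochain hc
    exact ⟨ω, hc.isDerivedCochain hω⟩

theorem IsDerivedCochain.lieEval_eq {n : ℕ} {c : (Fin (n + 1) → G) → A}
    (hc : ChartSmooth E F c) {ω : LieCochain E F A (n + 1)}
    (h : IsDerivedCochain E G F A (n + 1) (c : Germ (𝓝 (1 : Fin (n + 1) → G)) A) ω) :
    lieEval E F A n ω = antisymm (factorDeriv E F c) := by
  obtain ⟨ω', hω'⟩ := exists_lieCochain hc
  rw [h.unique (hc.isDerivedCochain hω')]
  exact funext hω'

theorem IsDerivedCochain.add {p : ℕ} {z z' : Germ (𝓝 (1 : Fin p → G)) A}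
    (hz : z ∈ localCochains E G F A p) (hz' : z' ∈ localCochains E G F A p)
    {ω ω' : LieCochain E F A p} (h : IsDerivedCochain E G F A p z ω)
    (h' : IsDerivedCochain E G F A p z' ω') : IsDerivedCochain E G F A p (z + z') (ω + ω') := by
  obtain ⟨c, hc, rfl⟩ := exists_chartSmooth hz
  obtain ⟨c', hc', rfl⟩ := exists_chartSmooth hz'
  cases p with
  | zero =>
    intro b hb
    have h1 : b 1 = c 1 + c' 1 := (Germ.coe_eq.1 hb).self_of_nhds
    rw [h1, ← h c rfl, ← h' c' rfl]
    rfl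
  | succ n =>
    obtain ⟨U, hU, h1, ht, hs⟩ := hc
    obtain ⟨U', hU', h1', ht', hs'⟩ := hc'
    have hadd : SmoothInto F (chartRep E fun g => c g + c' g) (U ∩ U') :=
      SmoothInto.add (hU.inter hU') (SmoothOn.mono hs inter_subset_left)
        (SmoothOn.mono hs' inter_subset_right)
    refine ChartSmooth.isDerivedCochain (c := fun g => c g + c' g)
      ⟨_, hU.inter hU', ⟨h1, h1'⟩, fun x hx => ht x hx.1, hadd⟩ fun ξ => ?_
    rw [map_add, Pi.add_apply, h.lieEval_eq ⟨U, hU, h1, ht, hs⟩,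
      h'.lieEval_eq ⟨U', hU', h1', ht', hs'⟩, ← antisymm_add]
    congr 1
    funext ξ
    exact (SmoothInto.mcIter_fun_add (hU.inter hU') (SmoothOn.mono hs inter_subset_left)
      (SmoothOn.mono hs' inter_subset_right) ⟨h1, h1'⟩ _).symm

theorem localDiff_coe {p : ℕ} (c : (Fin p → G) → A) :
    localDiff E G A p (c : Germ (𝓝 (1 : Fin p → G)) A) =
      ((fun g => ∑ k : Fin (p + 2), ((-1 : ℤ) ^ (k : ℕ)) • c (face k g) :
        (Fin (p + 1) → G) → A) : Germ (𝓝 (1 : Fin (p + 1) → G)) A) := by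
  have h := map_sum (Germ.coeAddHom (𝓝 (1 : Fin (p + 1) → G)) (M := A))
    (fun (k : Fin (p + 2)) g => ((-1 : ℤ) ^ (k : ℕ)) • c (face k g)) Finset.univ
  have e : (∑ k : Fin (p + 2), fun g => ((-1 : ℤ) ^ (k : ℕ)) • c (face k g)) =
      fun g => ∑ k : Fin (p + 2), ((-1 : ℤ) ^ (k : ℕ)) • c (face k g) := by
    funext g; simp
  rw [e] at h
  refine Eq.trans ?_ h.symm
  simp only [localDiff, AddMonoidHom.finsetSum_apply]
  rfl

theorem lieDiff_eq {n : ℕ} {c : (Fin (n + 1) → G) → A} (hc : ChartSmooth E F c)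
    {ω : LieCochain E F A (n + 1)} (hω : lieEval E F A n ω = antisymm (factorDeriv E F c)) :
    lieDiff E G F A (n + 1) ω = antisymm (factorDeriv E F fun g =>
      ∑ k : Fin (n + 3), ((-1 : ℤ) ^ (k : ℕ)) • c (face k g)) := by
  funext ξ
  rw [antisymm_factorDeriv_coboundary hc, ← hω]
  rfl

theorem IsDerivedCochain.mem_lieCocycles {p : ℕ} {z : Germ (𝓝 (1 : Fin p → G)) A}
    (hz : z ∈ localCocycles E G F A p) {ω : LieCochain E F A p}
    (h : IsDerivedCochain E G F A p z ω) : ω ∈ lieCocycles E G F A p := by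
  obtain ⟨c, hc, rfl⟩ := exists_chartSmooth hz.1
  cases p with
  | zero => rfl
  | succ n =>
    have h0 := (AddMonoidHom.mem_ker).1 hz.2
    rw [localDiff_coe] at h0
    refine (AddMonoidHom.mem_ker).2 ?_
    rw [lieDiff_eq hc (h.lieEval_eq hc)]
    have : ∀ ξ, factorDeriv E F (fun g => ∑ k : Fin (n + 3), ((-1 : ℤ) ^ (k : ℕ)) • c (face k g)) ξ =
        0 := fun ξ => (factorDeriv_congr (c' := fun _ => 0) (Germ.coe_eq.1 h0) ξ).trans
      (factorDeriv_zero ξ)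
    funext ξ
    simp [antisymm, this]

theorem isDerivedCochain_zero (p : ℕ) :
    IsDerivedCochain E G F A p (0 : Germ (𝓝 (1 : Fin p → G)) A) 0 := by
  have h0 : (0 : Germ (𝓝 (1 : Fin p → G)) A) ∈ localCochains E G F A p := zero_mem _
  obtain ⟨ω, hω⟩ := exists_isDerivedCochain h0
  have h1 := hω.add h0 h0 hω
  rw [add_zero] at h1
  -- By additivity and uniqueness `ω = ω + ω`.
  have h2 : ω = 0 := by simpa using hω.unique h1
  rwa [h2] at hω

theorem IsDerivedCochain.mem_lieCoboundaries {p : ℕ} {z : Germ (𝓝 (1 : Fin p → G)) A}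
    (hz : z ∈ localCocycles E G F A p) (hz' : z ∈ localCoboundaries E G F A p)
    {ω : LieCochain E F A p} (h : IsDerivedCochain E G F A p z ω) :
    ω ∈ lieCoboundaries E G F A p := by
  have hzero : z = 0 → ω ∈ lieCoboundaries E G F A p := by
    rintro rfl
    rw [h.unique (isDerivedCochain_zero p)]
    exact zero_mem _
  cases p with
  | zero => exact hzero hz'
  | succ p =>
    obtain ⟨b, hb, rfl⟩ := hz'
    obtain ⟨c, hc, rfl⟩ := exists_chartSmooth hb
    cases p with
    | zero =>
      -- The two faces `G → G^0` coincide, so their alternating sum, the differential in degree `0`,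
      -- vanishes.
      refine hzero ?_
      rw [localDiff_coe, ← Germ.coe_zero]
      congr 1
      funext g
      simp [Fin.sum_univ_two, Subsingleton.elim (face 1 g) (face 0 g)]
    | succ n =>
      -- The primitive is the derived cochain of the group cochain whose differential is given.
      obtain ⟨θ, hθ⟩ := exists_lieCochain hc
      refine ⟨θ, ?_⟩
      rw [lieDiff_eq hc (funext hθ)]
      rw [localDiff_coe] at h
      refine (h.lieEval_eq ?_).symm
      -- The second neighbourhood serves only to keep the domain inside the chart, as `ChartSmooth`
      -- requires.
      obtain ⟨U, hU, h1, hs⟩ := ChartSmooth.iInter fun k => hc.face k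
      obtain ⟨V, hV, h1V, htV, -⟩ := hc.face 0
      exact ⟨U ∩ V, hU.inter hV, ⟨h1, h1V⟩, fun x hx => htV x hx.2,
        SmoothOn.mono (SmoothInto.sum Finset.univ hU fun k _ =>
          SmoothInto.zsmul (neg_one_pow_or (k : ℕ)) hU (hs k)) inter_subset_left⟩

variable (E G F A) in
/-- The derivation map on cocycles. -/
noncomputable def derivedCocycle (p : ℕ) : localCocycles E G F A p →+ lieCocycles E G F A p :=
  AddMonoidHom.mk' (fun z => ⟨Classical.choose (exists_isDerivedCochain z.2.1),
    (Classical.choose_spec (exists_isDerivedCochain z.2.1)).mem_lieCocycles z.2⟩) fun z z' =>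
    Subtype.ext ((Classical.choose_spec (exists_isDerivedCochain (z + z').2.1)).unique
      ((Classical.choose_spec (exists_isDerivedCochain z.2.1)).add z.2.1 z'.2.1
        (Classical.choose_spec (exists_isDerivedCochain z'.2.1))))

theorem isDerivedCochain_derivedCocycle {p : ℕ} (z : localCocycles E G F A p) :
    IsDerivedCochain E G F A p z (derivedCocycle E G F A p z) :=
  Classical.choose_spec (exists_isDerivedCochain z.2.1)

variable (E G F A) in
-- Any map with the required property agrees with the constructed one on the class of every cocycle,
-- because the derived cochain is unique.
theorem existsUnique_isDerivationMap (p : ℕ) :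
    ∃! φ : LocalCohomology E G F A p →+ LieCohomology E G F A p, IsDerivationMap E G F A φ := by
  refine ⟨QuotientAddGroup.map _ _ (derivedCocycle E G F A p) fun z hz =>
    (isDerivedCochain_derivedCocycle z).mem_lieCoboundaries z.2 hz, fun z =>
    ⟨_, isDerivedCochain_derivedCocycle z, rfl⟩, fun ψ hψ => ?_⟩
  ext z
  obtain ⟨ω, hω, he⟩ := hψ z
  have : ω = derivedCocycle E G F A p z :=
    Subtype.ext (hω.unique (isDerivedCochain_derivedCocycle z))
  rw [this] at he
  exact he

end Derivation

/-! ### Homomorphisms -/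

section GroupHom

variable {E G E₁ G₁ : Type*}
  [AddCommGroup E] [Module ℝ E] [TopologicalSpace E] [FrechetSpace E]
  [Group G] [TopologicalSpace G] [ChartedSpace E G] [FrechetLieGroup E G]
  [AddCommGroup E₁] [Module ℝ E₁] [TopologicalSpace E₁] [FrechetSpace E₁]
  [Group G₁] [TopologicalSpace G₁] [ChartedSpace E₁ G₁] [FrechetLieGroup E₁ G₁]

variable (E E₁) in
/-- A homomorphism in the charts at the identity. -/
noncomputable def chartHom (f : G₁ →* G) (x : E₁) : E :=
  chartAt E (1 : G) (f ((chartAt E₁ (1 : G₁)).symm x))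

variable (E E₁) in
/-- The domain of a homomorphism in the charts at the identity. -/
def chartHomDomain (f : G₁ →* G) : Set E₁ :=
  (chartAt E₁ (1 : G₁)).target ∩
    {x | f ((chartAt E₁ (1 : G₁)).symm x) ∈ (chartAt E (1 : G)).source}

variable {f : G₁ →* G}

theorem tangentMapAt_one (f : G₁ →* G) (v : E₁) :
    tangentMapAt E₁ E f 1 v = dirDeriv (chartHom E E₁ f) (chartOne E₁ G₁) v := by
  rw [tangentMapAt, map_one]
  rfl

theorem chartHom_one (f : G₁ →* G) : chartHom E E₁ f (chartOne E₁ G₁) = chartOne E G := by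
  rw [chartHom, symm_chartOne, map_one]
  rfl

theorem chartOne_mem_chartHomDomain (f : G₁ →* G) :
    chartOne E₁ G₁ ∈ chartHomDomain E E₁ f := by
  refine ⟨chartOne_mem E₁ G₁, ?_⟩
  simp [symm_chartOne]

theorem isOpen_chartHomDomain (hf : SmoothOn (atlas E₁ G₁) (atlas E G) f univ) :
    IsOpen (chartHomDomain E E₁ f) := by
  have h := isOpen_chartDomain isOpen_univ hf.1 (chartAt E₁ (1 : G₁)) (chartAt E (1 : G))
  rw [univ_inter] at h
  exact h

theorem cInfOn_chartHom (hf : SmoothOn (atlas E₁ G₁) (atlas E G) f univ) :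
    CInfOn (chartHom E E₁ f) (chartHomDomain E E₁ f) :=
  CInfOn.mono (hf.2 _ (chart_mem_atlas E₁ 1) _ (chart_mem_atlas E 1))
    fun _ hx => ⟨hx.1, trivial, hx.2⟩

theorem chartHom_mem {x : E₁} (hx : x ∈ chartHomDomain E E₁ f) :
    chartHom E E₁ f x ∈ (chartAt E (1 : G)).target :=
  (chartAt E (1 : G)).map_source hx.2

theorem chartHom_chartMul {x y : E₁} (hx : x ∈ chartHomDomain E E₁ f)
    (hy : y ∈ chartHomDomain E E₁ f) (hxy : (x, y) ∈ chartMulDomain E₁ G₁) :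
    chartHom E E₁ f (chartMul E₁ G₁ (x, y)) =
      chartMul E G (chartHom E E₁ f x, chartHom E E₁ f y) := by
  have h := (chartAt E₁ (1 : G₁)).left_inv hxy.2
  have h1 := (chartAt E (1 : G)).left_inv hx.2
  have h2 := (chartAt E (1 : G)).left_inv hy.2
  simp only [chartMul, chartHom] at *
  rw [h, h1, h2, map_mul]

/-- The tangent map at `1` of a smooth homomorphism. -/
theorem exists_tangentMap (hf : SmoothOn (atlas E₁ G₁) (atlas E G) f univ) :
    ∃ L : E₁ →L[ℝ] E, ∀ v, L v = tangentMapAt E₁ E f 1 v :=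
  ⟨(cInfOn_chartHom hf).dirDerivL (isOpen_chartHomDomain hf) (chartOne_mem_chartHomDomain f),
    fun v => (tangentMapAt_one f v).symm⟩

/-- Left invariant vector fields are related by homomorphisms. -/
theorem dirDeriv_chartHom_leftInvField (hf : SmoothOn (atlas E₁ G₁) (atlas E G) f univ) (η : E₁)
    {x : E₁} (hx : x ∈ chartHomDomain E E₁ f) :
    dirDeriv (chartHom E E₁ f) x (leftInvField E₁ G₁ η x) =
      leftInvField E G (tangentMapAt E₁ E f 1 η) (chartHom E E₁ f x) := by
  have hO := isOpen_chartHomDomain hf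
  have hC := cInfOn_chartHom hf
  -- The identity `f (x y) = f x * f y` is differentiated in `y` at the identity: `h1` treats the
  -- left side and `h4` the right.
  have h1 := hC.hasDerivAt_curve hO (γ := fun r : ℝ => chartMul E₁ G₁ (x, chartOne E₁ G₁ + r • η))
    (by simpa [chartMul_one E₁ G₁ hx.1] using hx) (hasDerivAt_chartMul_right E₁ G₁ hx.1 η)
  have h2 := hC.hasDerivAt (chartOne_mem_chartHomDomain f) η
  rw [← tangentMapAt_one] at h2
  have h3 : HasDerivAt (fun _ : ℝ => chartHom E E₁ f x) (0 : E) 0 := by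
    simpa using hasDerivAt_line (chartHom E E₁ f x) (0 : E) 0
  have h4 := (cInfOn_chartMul E G).hasDerivAt_curve (isOpen_chartMulDomain E G)
    (γ := fun r : ℝ => (chartHom E E₁ f x, chartHom E E₁ f (chartOne E₁ G₁ + r • η)))
    (by simpa [chartHom_one] using chartMulDomain_right E G (chartHom_mem hx))
    (hasDerivAt_prodMk h3 h2)
  simp only [zero_smul, add_zero, chartHom_one, chartMul_one E₁ G₁ hx.1] at h1 h4
  rw [← leftInvField_eq] at h4
  refine hasDerivAt_unique h1 (hasDerivAt_congr ?_ h4)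
  have hc : Tendsto (fun r : ℝ => (x, chartOne E₁ G₁ + r • η)) (𝓝 0) (𝓝 (x, chartOne E₁ G₁)) :=
    Tendsto.prodMk_nhds tendsto_const_nhds (tendsto_line _ _)
  filter_upwards [hc.eventually_mem ((isOpen_chartMulDomain E₁ G₁).mem_nhds
      (chartMulDomain_right E₁ G₁ hx.1)),
    (tendsto_line _ η).eventually_mem (hO.mem_nhds (chartOne_mem_chartHomDomain f))] with r hr hr'
  exact (chartHom_chartMul hx hr' hr).symm

/-- Differentiates the relation between left invariant fields at the identity along `ξ`. The
correction term is a second derivative of `f`, symmetric in `ξ` and `η`, and so cancels in the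
bracket. -/
theorem leftInvDeriv_tangentMapAt (hf : SmoothOn (atlas E₁ G₁) (atlas E G) f univ) (ξ η : E₁) :
    leftInvDeriv E G (tangentMapAt E₁ E f 1 ξ) (tangentMapAt E₁ E f 1 η) =
      dirDeriv (fun y => dirDeriv (chartHom E E₁ f) y η) (chartOne E₁ G₁) ξ +
        tangentMapAt E₁ E f 1 (leftInvDeriv E₁ G₁ ξ η) := by
  have hO := isOpen_chartHomDomain hf
  have hC := cInfOn_chartHom hf
  have h1 := chartOne_mem_chartHomDomain (E := E) (E₁ := E₁) f
  have hξ := hC.hasDerivAt h1 ξ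
  have hd := CInfOn.hasDerivAt_of_linear
    (H := fun p : E₁ × E₁ => dirDeriv (chartHom E E₁ f) p.1 p.2) hO hC.dirDeriv
    (fun v w => hC.dirDeriv_add hO h1 v w) h1 (γ := fun s : ℝ => chartOne E₁ G₁ + s • ξ)
    (by rw [zero_smul, add_zero]; rfl) (hasDerivAt_line _ ξ 0) (hasDerivAt_leftInvField E₁ G₁ ξ η)
  rw [← tangentMapAt_one] at hξ
  have hr := (cInfOn_leftInvField E G (tangentMapAt E₁ E f 1 η)).hasDerivAt_curve
    (chartAt E (1 : G)).open_target
    (γ := fun s : ℝ => chartHom E E₁ f (chartOne E₁ G₁ + s • ξ))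
    (by simpa [chartHom_one] using chartOne_mem E G) hξ
  simp only [zero_smul, add_zero, chartHom_one, leftInvField_one] at hd hr
  rw [tangentMapAt_one f (leftInvDeriv E₁ G₁ ξ η)]
  refine hasDerivAt_unique hr (hasDerivAt_congr ?_ hd)
  filter_upwards [(tendsto_line _ ξ).eventually_mem (hO.mem_nhds h1)] with s hs
  exact dirDeriv_chartHom_leftInvField hf η hs

/-- The tangent map of a smooth homomorphism preserves brackets. -/
theorem tangentMapAt_lieBracket (hf : SmoothOn (atlas E₁ G₁) (atlas E G) f univ) (ξ η : E₁) :
    tangentMapAt E₁ E f 1 (lieBracket E₁ G₁ ξ η) =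
      lieBracket E G (tangentMapAt E₁ E f 1 ξ) (tangentMapAt E₁ E f 1 η) := by
  obtain ⟨L, hL⟩ := exists_tangentMap hf
  rw [lieBracket_eq, lieBracket_eq, leftInvDeriv_tangentMapAt hf, leftInvDeriv_tangentMapAt hf,
    (cInfOn_chartHom hf).dirDeriv_comm (isOpen_chartHomDomain hf) (chartOne_mem_chartHomDomain f) η ξ,
    add_sub_add_left_eq_sub, ← hL, map_sub, hL, hL]

theorem tendsto_hom (hf : SmoothOn (atlas E₁ G₁) (atlas E G) f univ) :
    Tendsto f (𝓝 1) (𝓝 1) := by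
  simpa using (continuousOn_univ.1 hf.1).tendsto 1

/-- Only the initial velocity of `f (exp (t ξ))` is needed, so there is no recourse to `f (exp (t
ξ)) = exp (t df ξ)`. -/
theorem hasDerivAt_hom_lieExp (hf : SmoothOn (atlas E₁ G₁) (atlas E G) f univ) (ξ : E₁) :
    HasDerivAt (fun t : ℝ => chartAt E (1 : G) (f (lieExp E₁ G₁ (t • ξ))))
      (tangentMapAt E₁ E f 1 ξ) 0 := by
  have e : chartAt E₁ (1 : G₁) (lieExp E₁ G₁ ((0 : ℝ) • ξ)) = chartOne E₁ G₁ := by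
    rw [zero_smul, lieExp_zero, chartOne]
  have h := (cInfOn_chartHom hf).hasDerivAt_curve (isOpen_chartHomDomain hf)
    (γ := fun t : ℝ => chartAt E₁ (1 : G₁) (lieExp E₁ G₁ (t • ξ)))
    (by rw [e]; exact chartOne_mem_chartHomDomain f) (hasDerivAt_lieExp E₁ G₁ ξ)
  rw [e, ← tangentMapAt_one] at h
  refine hasDerivAt_congr ?_ h
  filter_upwards [(tendsto_lieExp E₁ G₁ ξ).eventually_mem
    ((chartAt E₁ (1 : G₁)).open_source.mem_nhds (mem_chart_source E₁ 1))] with t ht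
  rw [chartHom, (chartAt E₁ (1 : G₁)).left_inv ht]

end GroupHom

/-! ### Smoothness of the power of a map -/

section PowerMap

variable {M N E F : Type*} [TopologicalSpace M] [TopologicalSpace N]
  [AddCommGroup E] [Module ℝ E] [TopologicalSpace E] [IsTopologicalAddGroup E] [ContinuousSMul ℝ E]
  [T2Space E]
  [AddCommGroup F] [Module ℝ F] [TopologicalSpace F] [IsTopologicalAddGroup F] [ContinuousSMul ℝ F]
  [T2Space F] [LocallyConvexSpace ℝ F]
  {𝒜 : Set (OpenPartialHomeomorph M E)} {ℬ : Set (OpenPartialHomeomorph N F)}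

theorem SmoothOn.pow {f : M → N} (hf : SmoothOn 𝒜 ℬ f univ) (p : ℕ) :
    SmoothOn (powAtlas 𝒜 p) (powAtlas ℬ p) (fun (g : Fin p → M) i => f (g i)) univ := by
  have hfc := continuousOn_univ.1 hf.1
  have hc : Continuous fun (g : Fin p → M) i => f (g i) :=
    continuous_pi fun i => hfc.comp (continuous_apply i)
  refine ⟨hc.continuousOn, ?_⟩
  rintro _ ⟨c, hcA, rfl⟩ _ ⟨c', hcB, rfl⟩
  have hO := isOpen_chartDomain isOpen_univ hc.continuousOn (OpenPartialHomeomorph.pi c)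
    (OpenPartialHomeomorph.pi c')
  refine CInfOn.pi hO fun i => ?_
  exact CInfOn.comp (f := fun x : Fin p → E => x i) hO
    (isOpen_chartDomain isOpen_univ hf.1 (c i) (c' i)) (hf.2 _ (hcA i) _ (hcB i))
    (cInfOn_clm (ContinuousLinearMap.proj (R := ℝ) (φ := fun _ : Fin p => E) i) _)
    fun x hx => ⟨hx.1 i trivial, trivial, hx.2.2 i trivial⟩

end PowerMap

/-! ### Functoriality of local cohomology -/

section Pullback

variable {E G F A E₁ G₁ F₁ A₁ : Type*}
  [AddCommGroup E] [Module ℝ E] [TopologicalSpace E] [FrechetSpace E]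
  [Group G] [TopologicalSpace G] [ChartedSpace E G] [FrechetLieGroup E G]
  [AddCommGroup F] [Module ℝ F] [TopologicalSpace F] [FrechetSpace F]
  [AddCommGroup A] [TopologicalSpace A] [ChartedSpace F A] [FrechetLieAddGroup F A]
  [AddCommGroup E₁] [Module ℝ E₁] [TopologicalSpace E₁] [FrechetSpace E₁]
  [Group G₁] [TopologicalSpace G₁] [ChartedSpace E₁ G₁] [FrechetLieGroup E₁ G₁]
  [AddCommGroup F₁] [Module ℝ F₁] [TopologicalSpace F₁] [FrechetSpace F₁]
  [AddCommGroup A₁] [TopologicalSpace A₁] [ChartedSpace F₁ A₁] [FrechetLieAddGroup F₁ A₁]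
  {f : G₁ →* G} {h : A →+ A₁}

theorem tendsto_hom_pow (hf : SmoothOn (atlas E₁ G₁) (atlas E G) f univ) (p : ℕ) :
    Tendsto (fun (g : Fin p → G₁) i => f (g i)) (𝓝 1) (𝓝 1) :=
  tendsto_pi_nhds.2 fun i => (tendsto_hom hf).comp ((continuous_apply i).tendsto 1)

/-- The map `c ↦ h ∘ c ∘ f^p` on germs. -/
def germTransport (hf : SmoothOn (atlas E₁ G₁) (atlas E G) f univ) (h : A →+ A₁) (p : ℕ) :
    Germ (𝓝 (1 : Fin p → G)) A →+ Germ (𝓝 (1 : Fin p → G₁)) A₁ where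
  toFun γ := (γ.map h).compTendsto _ (tendsto_hom_pow hf p)
  map_zero' := congrArg _ (funext fun _ => map_zero h)
  map_add' γ δ := by
    induction γ using Germ.inductionOn
    induction δ using Germ.inductionOn
    exact congrArg _ (funext fun _ => map_add h _ _)

theorem germTransport_coe (hf : SmoothOn (atlas E₁ G₁) (atlas E G) f univ) (h : A →+ A₁) {p : ℕ}
    (c : (Fin p → G) → A) : germTransport hf h p (c : Germ (𝓝 (1 : Fin p → G)) A) =
      ((fun g => h (c fun i => f (g i)) : (Fin p → G₁) → A₁) : Germ (𝓝 (1 : Fin p → G₁)) A₁) := rfl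

theorem germTransport_mem_localCochains (hf : SmoothOn (atlas E₁ G₁) (atlas E G) f univ)
    (hh : SmoothOn (atlas F A) (atlas F₁ A₁) h univ) {p : ℕ} {z : Germ (𝓝 (1 : Fin p → G)) A}
    (hz : z ∈ localCochains E G F A p) :
    germTransport hf h p z ∈ localCochains E₁ G₁ F₁ A₁ p := by
  obtain ⟨c, U, hU, h1, hc, rfl⟩ := hz
  have hp := hf.pow p
  have hV := hU.preimage (continuousOn_univ.1 hp.1)
  refine ⟨_, _, hV, ?_, ?_, germTransport_coe hf h c⟩
  · simpa [← Pi.one_def] using h1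
  · have hcov : ∀ g : Fin p → G, ∃ e ∈ powAtlas (atlas E G) p, g ∈ e.source := fun g =>
      ⟨_, ⟨_, fun i => chart_mem_atlas E (g i), rfl⟩, fun i _ => mem_chart_source E (g i)⟩
    have hcf := SmoothOn.comp hcov hV hU hc (hp.mono (subset_univ _)) fun _ hg => hg
    exact SmoothOn.comp (fun a => ⟨_, chart_mem_atlas F a, mem_chart_source F a⟩) hV
      isOpen_univ hh hcf fun _ _ => trivial

theorem face_hom (f : G₁ →* G) {p : ℕ} (k : Fin (p + 2)) (g : Fin (p + 1) → G₁) :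
    face k (fun i => f (g i)) = fun i => f (face k g i) := by
  funext i
  refine Fin.cases rfl (fun j => ?_) k
  simp only [face, Fin.cases_succ, Fin.contractNth]
  split_ifs <;> simp

/-- The group homomorphism commutes with the faces, and `h` with the alternating sum. -/
theorem germTransport_localDiff (hf : SmoothOn (atlas E₁ G₁) (atlas E G) f univ) (h : A →+ A₁)
    {p : ℕ} (z : Germ (𝓝 (1 : Fin p → G)) A) :
    germTransport hf h (p + 1) (localDiff E G A p z) =
      localDiff E₁ G₁ A₁ p (germTransport hf h p z) := by
  induction z using Germ.inductionOn with
  | _ c =>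
    rw [localDiff_coe, germTransport_coe, germTransport_coe, localDiff_coe]
    congr 1
    funext g
    simp only [map_sum, map_zsmul, face_hom]

theorem germTransport_mem_localCocycles (hf : SmoothOn (atlas E₁ G₁) (atlas E G) f univ)
    (hh : SmoothOn (atlas F A) (atlas F₁ A₁) h univ) {p : ℕ} {z : Germ (𝓝 (1 : Fin p → G)) A}
    (hz : z ∈ localCocycles E G F A p) :
    germTransport hf h p z ∈ localCocycles E₁ G₁ F₁ A₁ p := by
  refine ⟨germTransport_mem_localCochains hf hh hz.1, ?_⟩
  have h0 := AddMonoidHom.mem_ker.1 hz.2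
  exact AddMonoidHom.mem_ker.2 (by rw [← germTransport_localDiff, h0, map_zero])

theorem germTransport_mem_localCoboundaries (hf : SmoothOn (atlas E₁ G₁) (atlas E G) f univ)
    (hh : SmoothOn (atlas F A) (atlas F₁ A₁) h univ) {p : ℕ} {z : Germ (𝓝 (1 : Fin p → G)) A}
    (hz : z ∈ localCoboundaries E G F A p) :
    germTransport hf h p z ∈ localCoboundaries E₁ G₁ F₁ A₁ p := by
  cases p with
  | zero =>
    obtain rfl : z = 0 := hz
    rw [map_zero]
    exact zero_mem _
  | succ p =>
    obtain ⟨b, hb, rfl⟩ := hz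
    exact ⟨_, germTransport_mem_localCochains hf hh hb, (germTransport_localDiff hf h b).symm⟩

/-- The map `c ↦ h ∘ c ∘ f^p` on local cohomology. -/
noncomputable def localInduced (hf : SmoothOn (atlas E₁ G₁) (atlas E G) f univ)
    (hh : SmoothOn (atlas F A) (atlas F₁ A₁) h univ) (p : ℕ) :
    LocalCohomology E G F A p →+ LocalCohomology E₁ G₁ F₁ A₁ p :=
  QuotientAddGroup.map _ _ (((germTransport hf h p).comp (localCocycles E G F A p).subtype).codRestrict
    (localCocycles E₁ G₁ F₁ A₁ p) fun z => germTransport_mem_localCocycles hf hh z.2)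
    fun _ hz => germTransport_mem_localCoboundaries hf hh hz

theorem isLocalInduced_localInduced (hf : SmoothOn (atlas E₁ G₁) (atlas E G) f univ)
    (hh : SmoothOn (atlas F A) (atlas F₁ A₁) h univ) (p : ℕ) :
    IsLocalInduced E G F A E₁ G₁ F₁ A₁ f h (localInduced hf hh p) := fun z =>
  ⟨⟨_, germTransport_mem_localCocycles hf hh z.2⟩, fun c hc => by
    rw [← germTransport_coe hf, hc], rfl⟩

/-! ### Functoriality of Lie algebra cohomology -/

theorem exists_isLieTransport (hf : SmoothOn (atlas E₁ G₁) (atlas E G) f univ)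
    (hh : SmoothOn (atlas F A) (atlas F₁ A₁) h univ) (p : ℕ) :
    ∃ T : LieCochain E F A p →+ LieCochain E₁ F₁ A₁ p, ∀ ω, IsLieTransport E F E₁ F₁ f h p ω (T ω) := by
  cases p with
  | zero =>
    exact ⟨AddMonoidHom.mk' (fun ω => ULift.up (h ω.down)) fun ω θ =>
      ULift.ext _ _ (map_add h _ _), fun ω => rfl⟩
  | succ n =>
    obtain ⟨L, hL⟩ := exists_tangentMap hf
    obtain ⟨K, hK⟩ := exists_tangentMap_add h hh
    refine ⟨AddMonoidHom.mk' (fun ω => ULift.up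
      (K.compContinuousAlternatingMap (ω.down.compContinuousLinearMap L))) fun ω θ =>
      lieCochain_ext fun ξ => map_add K _ _, fun ω ξ => ?_⟩
    simp only [← hL, ← hK]
    rfl

/-- The tangent map of `f` preserves brackets and that of `h` is linear. -/
theorem IsLieTransport.lieDiff_eq (hf : SmoothOn (atlas E₁ G₁) (atlas E G) f univ)
    (hh : SmoothOn (atlas F A) (atlas F₁ A₁) h univ) {n : ℕ} {ω : LieCochain E F A (n + 1)}
    {ω₁ : LieCochain E₁ F₁ A₁ (n + 1)} (hω : IsLieTransport E F E₁ F₁ f h (n + 1) ω ω₁)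
    (ξ : Fin (n + 2) → E₁) : lieDiff E₁ G₁ F₁ A₁ (n + 1) ω₁ ξ =
      tangentMapAt F F₁ h 0 (lieDiff E G F A (n + 1) ω fun i => tangentMapAt E₁ E f 1 (ξ i)) := by
  obtain ⟨K, hK⟩ := exists_tangentMap_add h hh
  simp only [lieDiff, AddMonoidHom.coe_mk, ZeroHom.coe_mk, ← hK, map_sum]
  refine Finset.sum_congr rfl fun j _ => Finset.sum_congr rfl fun i _ => ?_
  split_ifs
  · rw [map_zsmul, hω, hK]
    congr 2
    refine congrArg (lieEval E F A n ω) (funext fun k => ?_)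
    refine Fin.cases ?_ (fun k => rfl) k
    exact tangentMapAt_lieBracket hf _ _
  · rw [map_zero]

theorem IsLieTransport.mem_lieCocycles (hf : SmoothOn (atlas E₁ G₁) (atlas E G) f univ)
    (hh : SmoothOn (atlas F A) (atlas F₁ A₁) h univ) {p : ℕ} {ω : LieCochain E F A p}
    {ω₁ : LieCochain E₁ F₁ A₁ p} (hω : IsLieTransport E F E₁ F₁ f h p ω ω₁)
    (hz : ω ∈ lieCocycles E G F A p) : ω₁ ∈ lieCocycles E₁ G₁ F₁ A₁ p := by
  cases p with
  | zero => rfl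
  | succ n =>
    obtain ⟨K, hK⟩ := exists_tangentMap_add h hh
    have h0 := AddMonoidHom.mem_ker.1 hz
    refine AddMonoidHom.mem_ker.2 (funext fun ξ => ?_)
    rw [hω.lieDiff_eq hf hh, h0, ← hK]
    exact map_zero K

theorem IsLieTransport.mem_lieCoboundaries (hf : SmoothOn (atlas E₁ G₁) (atlas E G) f univ)
    (hh : SmoothOn (atlas F A) (atlas F₁ A₁) h univ) {p : ℕ} {ω : LieCochain E F A p}
    {ω₁ : LieCochain E₁ F₁ A₁ p} (hω : IsLieTransport E F E₁ F₁ f h p ω ω₁)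
    (hz : ω ∈ lieCoboundaries E G F A p) : ω₁ ∈ lieCoboundaries E₁ G₁ F₁ A₁ p := by
  obtain ⟨K, hK⟩ := exists_tangentMap_add h hh
  cases p with
  | zero =>
    obtain rfl : ω = 0 := hz
    exact ULift.ext _ _ (hω.trans (map_zero h))
  | succ p =>
    obtain ⟨θ, hθ⟩ := hz
    cases p with
    | zero =>
      -- The differential vanishes in degree `0`, so a coboundary in degree `1` is zero and any
      -- primitive will do.
      refine ⟨0, funext fun ξ => ?_⟩
      rw [hω, ← hθ, ← hK]
      exact (map_zero K).symm
    | succ n =>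
      obtain ⟨T, hT⟩ := exists_isLieTransport hf hh (n + 1)
      refine ⟨T θ, funext fun ξ => ?_⟩
      rw [(hT θ).lieDiff_eq hf hh, hθ, hω]

theorem exists_isLieInduced (hf : SmoothOn (atlas E₁ G₁) (atlas E G) f univ)
    (hh : SmoothOn (atlas F A) (atlas F₁ A₁) h univ) (p : ℕ) :
    ∃ Ψ : LieCohomology E G F A p →+ LieCohomology E₁ G₁ F₁ A₁ p,
      IsLieInduced E G F A E₁ G₁ F₁ A₁ f h Ψ := by
  obtain ⟨T, hT⟩ := exists_isLieTransport hf hh p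
  exact ⟨QuotientAddGroup.map _ _ ((T.comp (lieCocycles E G F A p).subtype).codRestrict
    (lieCocycles E₁ G₁ F₁ A₁ p) fun ω => (hT ω).mem_lieCocycles hf hh ω.2)
    fun ω hω => (hT ω).mem_lieCoboundaries hf hh hω,
    fun ω => ⟨⟨_, (hT ω).mem_lieCocycles hf hh ω.2⟩, hT ω, rfl⟩⟩

/-! ### Naturality of the derivation map -/

/-- The derivation map commutes with `c ↦ h ∘ c ∘ f^p` and `ω ↦ dh ∘ ω ∘ (df)^p`. -/
theorem IsDerivedCochain.germTransport (hf : SmoothOn (atlas E₁ G₁) (atlas E G) f univ)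
    (hh : SmoothOn (atlas F A) (atlas F₁ A₁) h univ) {p : ℕ} {z : Germ (𝓝 (1 : Fin p → G)) A}
    (hz : z ∈ localCochains E G F A p) {ω : LieCochain E F A p}
    (hω : IsDerivedCochain E G F A p z ω) {ω₁ : LieCochain E₁ F₁ A₁ p}
    (hω₁ : IsLieTransport E F E₁ F₁ f h p ω ω₁) :
    IsDerivedCochain E₁ G₁ F₁ A₁ p (germTransport hf h p z) ω₁ := by
  obtain ⟨c, hc, rfl⟩ := exists_chartSmooth hz
  obtain ⟨K, hK⟩ := exists_tangentMap_add h hh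
  cases p with
  | zero =>
    intro b hb
    rw [germTransport_coe] at hb
    refine hω₁.trans ?_
    rw [(Germ.coe_eq.1 hb).self_of_nhds, hω c rfl]
    congr 2
    exact Subsingleton.elim _ _
  | succ n =>
    intro b hb ξ
    rw [germTransport_coe] at hb
    obtain ⟨U, hU, hone, ht, hs⟩ := id hc
    -- Only the values are changed to `A₁`; the domain remains the chart of `G`, and `f` enters
    -- later through the curves.
    have hs' : SmoothInto F₁ (chartRep E fun g => h (c g)) U :=
      SmoothOn.comp (g := h) (fun a => ⟨_, chart_mem_atlas F a, mem_chart_source F a⟩) hU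
        isOpen_univ hh hs fun _ _ => trivial
    have hc' : ChartSmooth E F₁ fun g => h (c g) := ⟨U, hU, hone, ht, hs'⟩
    have hd : ∀ ζ, factorDeriv E F₁ (fun g => h (c g)) ζ = K (factorDeriv E F c ζ) := fun ζ =>
      (hs.mcIter_hom h hh hU hone _).trans (hK _).symm
    have hval : antisymm (factorDeriv E F₁ fun g => h (c g)) (fun i => tangentMapAt E₁ E f 1 (ξ i)) =
        lieEval E₁ F₁ A₁ n ω₁ ξ := by
      rw [hω₁, hω.lieEval_eq hc, ← hK]
      simp only [antisymm, map_sum, map_zsmul, hd]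
    have hcurve : ∀ i, Tendsto (fun t : ℝ => f (lieExp E₁ G₁ (t • ξ i))) (𝓝 0) (𝓝 1) := fun i =>
      (tendsto_hom hf).comp (tendsto_lieExp E₁ G₁ (ξ i))
    rw [← hval]
    -- The curves `f (exp (t ξ_i))` in `G` have velocities `df ξ_i`, so the derivative of `h ∘ c ∘
    -- f^p` along exponential curves of `G₁` is one of `h ∘ c` along these.
    refine (hc'.hasMixedPartialLie (γ := fun i t => f (lieExp E₁ G₁ (t • ξ i)))
      (fun i => by simp [lieExp_zero]) hcurve fun i => hasDerivAt_hom_lieExp hf (ξ i)).congr ?_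
    have he : ∀ σ : Equiv.Perm (Fin (n + 1)), ∀ᶠ t : Fin (n + 1) → ℝ in 𝓝 0,
        b (fun i => lieExp E₁ G₁ (t (σ i) • ξ (σ i))) =
          h (c fun i => f (lieExp E₁ G₁ (t (σ i) • ξ (σ i)))) := fun σ => by
      refine Tendsto.eventually (tendsto_pi_nhds.2 fun i => ?_) (Germ.coe_eq.1 hb)
      exact (tendsto_lieExp E₁ G₁ (ξ (σ i))).comp
        ((continuous_apply (σ i)).tendsto (0 : Fin (n + 1) → ℝ))
    filter_upwards [eventually_all.2 he] with t ht
    exact Finset.sum_congr rfl fun σ _ => by rw [ht σ]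

/-- Stated for any `Φ` and `Ψ` with the prescribed effect on cocycles. Both ways around the square
lead to a derived cochain of the same transported germ, and that cochain is unique. -/
theorem IsDerivationMap.naturality (hf : SmoothOn (atlas E₁ G₁) (atlas E G) f univ)
    (hh : SmoothOn (atlas F A) (atlas F₁ A₁) h univ) {p : ℕ}
    {Φ : LocalCohomology E G F A p →+ LocalCohomology E₁ G₁ F₁ A₁ p}
    {Ψ : LieCohomology E G F A p →+ LieCohomology E₁ G₁ F₁ A₁ p}
    (hΦ : IsLocalInduced E G F A E₁ G₁ F₁ A₁ f h Φ) (hΨ : IsLieInduced E G F A E₁ G₁ F₁ A₁ f h Ψ)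
    {φ : LocalCohomology E G F A p →+ LieCohomology E G F A p}
    {φ₁ : LocalCohomology E₁ G₁ F₁ A₁ p →+ LieCohomology E₁ G₁ F₁ A₁ p}
    (hφ : IsDerivationMap E G F A φ) (hφ₁ : IsDerivationMap E₁ G₁ F₁ A₁ φ₁)
    (x : LocalCohomology E G F A p) : φ₁ (Φ x) = Ψ (φ x) := by
  induction x using QuotientAddGroup.induction_on with
  | H z =>
    obtain ⟨z₁, hz₁, hΦz⟩ := hΦ z
    obtain ⟨ω, hω, hφz⟩ := hφ z
    obtain ⟨ω₁, hω₁, hφ₁z⟩ := hφ₁ z₁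
    obtain ⟨θ, hθ, hΨω⟩ := hΨ ω
    -- The cocycle `z₁` is specified only through representatives of `z`, so one is chosen.
    have hz : FrechetLie.germTransport hf h p z = z₁ := by
      obtain ⟨c, -, hc⟩ := exists_chartSmooth z.2.1
      rw [hc, germTransport_coe]
      exact hz₁ c hc.symm
    have h1 := hω.germTransport hf hh z.2.1 hθ
    rw [hz] at h1
    have h2 : θ = ω₁ := Subtype.ext (h1.unique hω₁)
    calc φ₁ (Φ (localClass E G F A z)) = lieClass E₁ G₁ F₁ A₁ ω₁ := by rw [hΦz, hφ₁z]
      _ = Ψ (φ (localClass E G F A z)) := by rw [hφz, hΨω, h2]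

end Pullback

end FrechetLie

theorem proposition2p3
    {E G F A : Type*}
    [AddCommGroup E] [Module ℝ E] [TopologicalSpace E] [FrechetSpace E]
    [Group G] [TopologicalSpace G] [ChartedSpace E G] [FrechetLieGroup E G]
    [AddCommGroup F] [Module ℝ F] [TopologicalSpace F] [FrechetSpace F]
    [AddCommGroup A] [TopologicalSpace A] [ChartedSpace F A] [FrechetLieAddGroup F A]
    (p : ℕ) :
    (∃! φ : LocalCohomology E G F A p →+ LieCohomology E G F A p, IsDerivationMap E G F A φ) ∧
    ∀ {E₁ G₁ F₁ A₁ : Type*}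
      [AddCommGroup E₁] [Module ℝ E₁] [TopologicalSpace E₁] [FrechetSpace E₁]
      [Group G₁] [TopologicalSpace G₁] [ChartedSpace E₁ G₁] [FrechetLieGroup E₁ G₁]
      [AddCommGroup F₁] [Module ℝ F₁] [TopologicalSpace F₁] [FrechetSpace F₁]
      [AddCommGroup A₁] [TopologicalSpace A₁] [ChartedSpace F₁ A₁] [FrechetLieAddGroup F₁ A₁]
      (f : G₁ →* G) (h : A →+ A₁),
      SmoothOn (atlas E₁ G₁) (atlas E G) f Set.univ →
      SmoothOn (atlas F A) (atlas F₁ A₁) h Set.univ →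
      ∃ (Φ : LocalCohomology E G F A p →+ LocalCohomology E₁ G₁ F₁ A₁ p)
        (Ψ : LieCohomology E G F A p →+ LieCohomology E₁ G₁ F₁ A₁ p),
        IsLocalInduced E G F A E₁ G₁ F₁ A₁ f h Φ ∧ IsLieInduced E G F A E₁ G₁ F₁ A₁ f h Ψ ∧
        ∀ (φ : LocalCohomology E G F A p →+ LieCohomology E G F A p)
          (φ₁ : LocalCohomology E₁ G₁ F₁ A₁ p →+ LieCohomology E₁ G₁ F₁ A₁ p),
          IsDerivationMap E G F A φ → IsDerivationMap E₁ G₁ F₁ A₁ φ₁ →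
          ∀ x, φ₁ (Φ x) = Ψ (φ x) := by
  refine ⟨existsUnique_isDerivationMap E G F A p, fun f h hf hh => ?_⟩
  obtain ⟨Ψ, hΨ⟩ := exists_isLieInduced hf hh p
  have hΦ := isLocalInduced_localInduced hf hh p
  exact ⟨_, Ψ, hΦ, hΨ, fun φ φ₁ hφ hφ₁ x => hφ.naturality hf hh hΦ hΨ hφ₁ x⟩
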